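/- Let $G=K_2^3$ be the multigraph with two vertices and three parallel edges. For $n\ge 1$, the random $n$-lift $L_n(G)$ is the random bipartite multigraph on $V_1\cup V_2$, where $V_1,V_2$ are disjoint sets of $n$ vertices each, whose edges are those of three independent, uniformly distributed perfect matchings between $V_1$ and $V_2$, one for each edge of $G$; edges that come from different matchings are regarded as different edges, even if they have the same endpoints. Let $X_G$ be the number of perfect matchings of $L_n(G)$, where a perfect matching is a set of edges that meets every vertex exactly once. For $k\ge 2$, let $w_k$ be the number of non-backtracking closed $k$-walks in $G$, i.e. of sequences $i_0e_1i_1e_2\cdots i_{k-1}e_k$ of vertices $i_j$ and edges $e_j$ of $G$, with indices modulo $k$, such that $e_j$ joins $i_{j-1}$ and $i_j$, and $e_j\ne e_{j+1}$, for every $j$ (also cyclically). Put $\lambda_k=w_k/(2k)$ and $\delta_k=(-1/2)^k$, and let $(Y_k)_{k\ge2}$ be independent Poisson random variables with $\mathbb{E}Y_k=\lambda_k$. Then the infinite product $$W=\prod_{i=1}^{\infty}(1+\delta_{2i})^{Y_{2i}}e^{-\lambda_{2i}\delta_{2i}}$$ converges almost surely (its finite partial products converge unconditionally to a real number), and, as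 $n\to\infty$, $$\frac{X_G}{\mathbb{E}X_G}\ \longrightarrow\ W\quad\text{in distribution.}$$ -/

import Mathlib

open MeasureTheory ProbabilityTheory Filter
open scoped NNReal

namespace RandomLift

/-- The multigraph `K_2^3`: the two vertices `0` and `1`, joined by three parallel edges. -/
def K23 : Graph (Fin 2) (Fin 3) := Graph.banana 0 1 Set.univ

/-- A `k`-cyclic sequence of vertices `i` and edges `e` of a multigraph (indices modulo `k`) is a
non-backtracking closed `k`-walk if `e j` joins `i j` to `i (j + 1)` and consecutive edges are
distinct (also cyclically). The walk has a starting point and a direction. -/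
def IsNonbacktrackingClosedWalk {α β : Type*} (G : Graph α β) (k : ℕ)
    (p : (ZMod k → α) × (ZMod k → β)) : Prop :=
  ∀ j : ZMod k, G.IsLink (p.2 j) (p.1 j) (p.1 (j + 1)) ∧ p.2 j ≠ p.2 (j + 1)

/-- `w_k`, the number of non-backtracking closed `k`-walks in a multigraph. -/
noncomputable def walkCount {α β : Type*} (G : Graph α β) (k : ℕ) : ℕ :=
  {p | IsNonbacktrackingClosedWalk G k p}.ncard

/-- A perfect matching of a multigraph, as a set of (labelled, non-loop) edges that meets every
vertex exactly once. Parallel edges are different edges. -/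
def IsPerfectMatching {α β : Type*} (G : Graph α β) (M : Set β) : Prop :=
  (∀ e ∈ M, ∃ x y, x ≠ y ∧ G.IsLink e x y) ∧ ∀ v ∈ G.vertexSet, ∃! e, e ∈ M ∧ G.Inc e v

/-- The number of perfect matchings of a multigraph. -/
noncomputable def matchingCount {α β : Type*} (G : Graph α β) : ℕ :=
  {M | IsPerfectMatching G M}.ncard

/-- The `n`-lift of a loopless multigraph `G` given by permutations `σ e`, one for each edge.
The vertex `i` of `G` is replaced by the `n` vertices `(i, a)`, and an edge `e` of `G` with ends
`i < j` by the perfect matching that consists of the `n` edges `(e, a)`, where `(e, a)` joins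
`(i, a)` to `(j, σ e a)`. So a perfect matching between the copies of `i` and of `j` is the same
as a permutation `σ e`. -/
def lift {α β : Type*} [LinearOrder α] (G : Graph α β) {n : ℕ}
    (σ : β → Equiv.Perm (Fin n)) : Graph (α × Fin n) (β × Fin n) where
  vertexSet := {x | x.1 ∈ G.vertexSet}
  IsLink e x y := G.IsLink e.1 x.1 y.1 ∧
    ((x.1 < y.1 ∧ x.2 = e.2 ∧ y.2 = σ e.1 e.2) ∨ (y.1 < x.1 ∧ y.2 = e.2 ∧ x.2 = σ e.1 e.2))
  isLink_symm := fun _ _ => ⟨fun _ _ h => ⟨h.1.symm, h.2.symm⟩⟩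
  eq_or_eq_of_isLink_of_isLink := by
    rintro ⟨e, a⟩ ⟨x, x'⟩ ⟨y, y'⟩ ⟨v, v'⟩ ⟨w, w'⟩ ⟨h1, h2⟩ ⟨h3, h4⟩
    simp only [Prod.mk.injEq] at *
    rcases h1.eq_and_eq_or_eq_and_eq h3 with ⟨rfl, rfl⟩ | ⟨rfl, rfl⟩
    · rcases h2 with h2 | h2 <;> rcases h4 with h4 | h4
      · exact Or.inl ⟨rfl, h2.2.1.trans h4.2.1.symm⟩
      · exact absurd h2.1 h4.1.not_gt
      · exact absurd h2.1 h4.1.not_gt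
      · exact Or.inl ⟨rfl, h2.2.2.trans h4.2.2.symm⟩
    · rcases h2 with h2 | h2 <;> rcases h4 with h4 | h4
      · exact absurd h2.1 h4.1.not_gt
      · exact Or.inr ⟨rfl, h2.2.1.trans h4.2.1.symm⟩
      · exact Or.inr ⟨rfl, h2.2.2.trans h4.2.2.symm⟩
      · exact absurd h2.1 h4.1.not_gt
  left_mem_of_isLink := fun _ _ _ h => h.1.left_mem

/-- Every set of permutations of `Fin n` is an event. -/
instance permMeasurableSpace (n : ℕ) : MeasurableSpace (Equiv.Perm (Fin n)) := ⊤

instance permDiscreteMeasurableSpace (n : ℕ) :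
    DiscreteMeasurableSpace (Equiv.Perm (Fin n)) := ⟨fun _ => trivial⟩

/-- The law of the data of a random `n`-lift: the permutations `σ e` are uniformly distributed and
independent for the different edges `e`. -/
noncomputable def liftMeasure (β : Type*) [Fintype β] (n : ℕ) :
    Measure (β → Equiv.Perm (Fin n)) :=
  Measure.pi fun _ => uniformOn Set.univ

instance liftMeasure_isProbabilityMeasure (β : Type*) [Fintype β] (n : ℕ) :
    IsProbabilityMeasure (liftMeasure β n) := by
  unfold liftMeasure; infer_instance

/-- `X_G`, the number of perfect matchings in the random `n`-lift of `G`. -/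
noncomputable def X {α β : Type*} [LinearOrder α] (G : Graph α β) (n : ℕ)
    (σ : β → Equiv.Perm (Fin n)) : ℝ :=
  matchingCount (lift G σ)

/-- `λ_k = w_k / (2k)` for the multigraph `K_2^3`. -/
noncomputable def lam (k : ℕ) : ℝ≥0 := (walkCount K23 k : ℝ≥0) / (2 * k)

/-- `δ_k = (-1/2)^k`. -/
noncomputable def delta (k : ℕ) : ℝ := (-1 / 2) ^ k

/-- The factor `(1 + δ_k)^y e^{-λ_k δ_k}` of the limit. -/
noncomputable def factor (k y : ℕ) : ℝ := (1 + delta k) ^ y * Real.exp (-(lam k * delta k))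

end RandomLift

/-! Small subgraph conditioning: up to an arbitrarily small L² error, the fluctuation of `X / 𝔼 X`
is caused by the numbers of short cycles of the lift. Their lengths are even because the lift is
bipartite. Fix `m` and let `Z` be the vector of the numbers of cycles of lengths `2, 4, …, 2 m`.
Three facts are needed. (a) Under the uniform law `Z` tends to independent Poisson variables with
means `λ_{2i}`. (b) Under the planted law, which weights a lift by `X`, `Z` tends to independent
Poisson variables with means `λ_{2i} (1 + δ_{2i})`. (c) `limsup 𝔼 X² / (𝔼 X)² ≤ ∏ exp (λ_{2i}
δ_{2i}²) = 32 / (15 √3)`. By (a) and (b) the conditional mean of `X / 𝔼 X` given `Z` tends to the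
ratio of the two Poisson laws, which is the partial product `W_m` of `W`
(`limitProb_mul_limitRatio`). Since `𝔼 W_m²` is the partial product in (c), the distance `𝔼 (X / 𝔼 X
- W_m(Z))²` is small for large `m` and `n`, after truncation of `Z` to a finite box
(`eventually_integral_sub_sq_le`). Finally `W_m(Z)` tends to `W_m` in law, and `W_m` tends to `W`
almost surely.

For (c), a perfect matching is a colouring of the vertices, and the first moment becomes an integral
of `esymmTwo ^ n` over a triangle. Pairs of matchings with `d` common edges contribute the integral
of `esymmTwo ^ d` times the trace of the symmetric power of order `n - d` of a `3 × 3` matrix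
(`sum_card_model_cover₂`). This matrix is similar to the square of a symmetric matrix, and its
largest eigenvalue is at most `4 / 3`, with equality at the centre of the triangle
(`trace_symPow_bounds`). Laplace's method at the centre and the concentration of `d` at `n / 3` give
the constant.

For (a) and (b), the edges of a cycle are inserted into a random lift by transpositions. This
produces a uniform lift among those that contain the cycle, and it adds exactly this cycle to `Z`
unless a short walk joins its vertices. The result is the recursion of the Poisson weights with an
error `O(1 / n)` (`exists_switching_error`), which together with tightness determines the limit
(`IsAsymptoticallyPoisson.tendsto`). The means come from transfer matrices; for a planted matching
the eigenvalues are `1` and `-1 / 2`, whence the factor `1 + δ_k` (`plantedMean_third`). -/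

namespace RandomLift

/-! ### Perfect matchings of a lift as colourings of its vertices. -/

/-- The vertices of a lift of `K_2^3`: the side and the label. -/
abbrev Vert (n : ℕ) := Bool × Fin n

/-- The other end of the edge of colour `e` at a vertex of the lift. -/
def step {n : ℕ} (σ : Fin 3 → Equiv.Perm (Fin n)) (e : Fin 3) : Vert n → Vert n
  | (false, x) => (true, σ e x)
  | (true, y) => (false, (σ e).symm y)

@[simp] lemma step_false {n : ℕ} (σ : Fin 3 → Equiv.Perm (Fin n)) (e : Fin 3) (x : Fin n) :
    step σ e (false, x) = (true, σ e x) := rfl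

@[simp] lemma step_true {n : ℕ} (σ : Fin 3 → Equiv.Perm (Fin n)) (e : Fin 3) (x : Fin n) :
    step σ e (true, x) = (false, (σ e).symm x) := rfl

@[simp] lemma step_step {n : ℕ} (σ : Fin 3 → Equiv.Perm (Fin n)) (e : Fin 3) (v : Vert n) :
    step σ e (step σ e v) = v := by
  rcases v with ⟨_ | _, x⟩ <;> simp

@[simp] lemma step_fst {n : ℕ} (σ : Fin 3 → Equiv.Perm (Fin n)) (e : Fin 3) (v : Vert n) :
    (step σ e v).1 = !v.1 := by
  rcases v with ⟨_ | _, x⟩ <;> simp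

/-- The lifts whose edges respect the classes `κ e` of the vertices. -/
def model {n : ℕ} {T : Type*} [DecidableEq T] (κ : Fin 3 → Vert n → T) :
    Finset (Fin 3 → Equiv.Perm (Fin n)) :=
  Finset.univ.filter fun σ => ∀ e v, κ e (step σ e v) = κ e v

lemma mem_model {n : ℕ} {T : Type*} [DecidableEq T] {κ : Fin 3 → Vert n → T}
    {σ : Fin 3 → Equiv.Perm (Fin n)} :
    σ ∈ model κ ↔ ∀ e v, κ e (step σ e v) = κ e v := by simp [model]

lemma mem_model_iff_comp {n : ℕ} {T : Type*} [DecidableEq T] {κ : Fin 3 → Vert n → T}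
    {σ : Fin 3 → Equiv.Perm (Fin n)} :
    σ ∈ model κ ↔ ∀ e x, κ e (true, σ e x) = κ e (false, x) := by
  rw [mem_model]
  refine ⟨fun h e x => h e (false, x), fun h e v => ?_⟩
  rcases v with ⟨_ | _, x⟩
  · exact h e x
  · have := h e ((σ e).symm x)
    simp at this
    simp [this]

/-- The classes of the vertices when the vertex `v` is covered by an edge of colour `τ v`. -/
def cover {n : ℕ} (τ : Vert n → Fin 3) (e : Fin 3) (v : Vert n) : Bool := decide (τ v = e)

lemma mem_model_cover {n : ℕ} {τ : Vert n → Fin 3} {σ : Fin 3 → Equiv.Perm (Fin n)} :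
    σ ∈ model (cover τ) ↔ ∀ e v, τ (step σ e v) = e ↔ τ v = e := by
  simp [mem_model, cover]

lemma K23_lift_isLink {n : ℕ} (σ : Fin 3 → Equiv.Perm (Fin n)) (e : Fin 3 × Fin n)
    (x y : Fin 2 × Fin n) : (lift K23 σ).IsLink e x y ↔
      (x = (0, e.2) ∧ y = (1, σ e.1 e.2)) ∨ (y = (0, e.2) ∧ x = (1, σ e.1 e.2)) := by
  obtain ⟨x, x'⟩ := x
  obtain ⟨y, y'⟩ := y
  obtain ⟨e, a⟩ := e
  simp only [lift, K23, Graph.banana_isLink, Set.mem_univ, true_and, Prod.mk.injEq]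
  fin_cases x <;> fin_cases y <;> simp

lemma K23_lift_inc_zero {n : ℕ} (σ : Fin 3 → Equiv.Perm (Fin n)) (e : Fin 3 × Fin n)
    (a : Fin n) : (lift K23 σ).Inc e (0, a) ↔ e.2 = a := by
  simp only [Graph.Inc, K23_lift_isLink]
  constructor
  · rintro ⟨y, h | h⟩
    · simpa using h.1.symm
    · simp at h
  · rintro rfl
    exact ⟨_, Or.inl ⟨rfl, rfl⟩⟩

lemma K23_lift_inc_one {n : ℕ} (σ : Fin 3 → Equiv.Perm (Fin n)) (e : Fin 3 × Fin n)
    (a : Fin n) : (lift K23 σ).Inc e (1, a) ↔ σ e.1 e.2 = a := by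
  simp only [Graph.Inc, K23_lift_isLink]
  constructor
  · rintro ⟨y, h | h⟩
    · simp at h
    · simpa using h.2.symm
  · rintro rfl
    exact ⟨_, Or.inr ⟨rfl, rfl⟩⟩

lemma isPerfectMatching_lift_K23 {n : ℕ} (σ : Fin 3 → Equiv.Perm (Fin n))
    (M : Set (Fin 3 × Fin n)) : IsPerfectMatching (lift K23 σ) M ↔
      (∀ a, ∃! e, e ∈ M ∧ e.2 = a) ∧ ∀ a, ∃! e, e ∈ M ∧ σ e.1 e.2 = a := by
  constructor
  · rintro ⟨-, h⟩
    refine ⟨fun a => ?_, fun a => ?_⟩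
    · simpa only [K23_lift_inc_zero] using h (0, a) (by simp [lift, K23])
    · simpa only [K23_lift_inc_one] using h (1, a) (by simp [lift, K23])
  · rintro ⟨h0, h1⟩
    refine ⟨fun e _ => ⟨(0, e.2), (1, σ e.1 e.2), by simp, ?_⟩, ?_⟩
    · rw [K23_lift_isLink]; exact Or.inl ⟨rfl, rfl⟩
    · rintro ⟨i, a⟩ -
      fin_cases i
      · simpa only [Fin.zero_eta, K23_lift_inc_zero] using h0 a
      · simpa only [Fin.mk_one, K23_lift_inc_one] using h1 a

/-- The perfect matchings of a lift are the colourings of its vertices by the colour of the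
matching edge. -/
lemma matchingCount_lift_K23 {n : ℕ} (σ : Fin 3 → Equiv.Perm (Fin n)) :
    matchingCount (lift K23 σ) =
      (Finset.univ.filter fun τ : Vert n → Fin 3 => σ ∈ model (cover τ)).card := by
  rw [matchingCount, ← Set.ncard_coe_finset]
  symm
  refine Set.ncard_congr (fun τ _ => {p : Fin 3 × Fin n | τ (false, p.2) = p.1}) ?_ ?_ ?_
  · intro τ h
    simp only [Finset.coe_filter, Finset.mem_univ, true_and, Set.mem_ofPred_eq,
      mem_model_cover] at h
    rw [Set.mem_ofPred_eq, isPerfectMatching_lift_K23]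
    refine ⟨fun a => ⟨(τ (false, a), a), by simp, ?_⟩, fun a => ?_⟩
    · rintro ⟨e, b⟩ ⟨h1, rfl⟩
      simp only [Set.mem_ofPred_eq] at h1
      simp [h1]
    · refine ⟨(τ (true, a), (σ (τ (true, a))).symm a), ⟨?_, by simp⟩, ?_⟩
      · exact (h _ (true, a)).2 rfl
      · rintro ⟨e, b⟩ ⟨h1, rfl⟩
        simp only [Set.mem_ofPred_eq] at h1
        have := (h e (false, b)).2 h1
        simp only [step_false] at this
        simp [this]
  · intro τ τ' h h' heq
    simp only [Finset.coe_filter, Finset.mem_univ, true_and, Set.mem_ofPred_eq,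
      mem_model_cover] at h h'
    have h0 : ∀ x, τ (false, x) = τ' (false, x) := fun x => by
      have : (τ (false, x), x) ∈ {p : Fin 3 × Fin n | τ' (false, p.2) = p.1} := by
        rw [← heq]; simp
      exact this.symm
    ext1 ⟨i, x⟩
    cases i
    · exact h0 x
    · have h2 := (h _ (true, x)).2 rfl
      have h3 := (h' (τ (true, x)) (true, x)).1
      simp only [step_true] at h2 h3
      rw [h0] at h2
      exact (h3 h2).symm
  · intro M hM
    rw [Set.mem_ofPred_eq, isPerfectMatching_lift_K23] at hM
    obtain ⟨hM0, hM1⟩ := hM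
    choose f hf hf' using hM0
    choose g hg hg' using hM1
    have hfM : ∀ e x, (e, x) ∈ M ↔ (f x).1 = e := fun e x => by
      constructor
      · intro hm
        rw [← hf' x (e, x) ⟨hm, rfl⟩]
      · rintro rfl
        have := hf x
        have h2 : ((f x).1, x) = f x := Prod.ext rfl this.2.symm
        rw [h2]; exact this.1
    have hgM : ∀ e x, (e, x) ∈ M ↔ (g (σ e x)).1 = e := fun e x => by
      constructor
      · intro hm
        rw [← hg' (σ e x) (e, x) ⟨hm, rfl⟩]
      · intro h
        have := hg (σ e x)
        have h2 : (e, x) = g (σ e x) := by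
          refine Prod.ext h.symm ((σ e).injective ?_)
          have h3 := this.2
          rw [h] at h3
          exact h3.symm
        rw [h2]; exact this.1
    refine ⟨fun v => if v.1 then (g v.2).1 else (f v.2).1, ?_, ?_⟩
    · simp only [Finset.coe_filter, Finset.mem_univ, true_and, Set.mem_ofPred_eq, mem_model_cover]
      rintro e ⟨i, x⟩
      cases i
      · simp [← hfM, ← hgM]
      · have := hgM e ((σ e).symm x)
        simp only [Equiv.apply_symm_apply] at this
        simp [← hfM, this]
    · ext ⟨e, x⟩
      simp [hfM]

/-- Writing `X` as a sum of indicators reduces its moments to counting lifts that respect prescribed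
vertex classes. -/
lemma X_K23 {n : ℕ} (σ : Fin 3 → Equiv.Perm (Fin n)) :
    X K23 n σ = ∑ τ : Vert n → Fin 3, if σ ∈ model (cover τ) then (1 : ℝ) else 0 := by
  rw [X, matchingCount_lift_K23, Finset.sum_boole]

lemma integral_liftMeasure {n : ℕ} (F : (Fin 3 → Equiv.Perm (Fin n)) → ℝ) :
    ∫ σ, F σ ∂liftMeasure (Fin 3) n = (∑ σ, F σ) / (n.factorial : ℝ) ^ 3 := by
  have h : ∀ σ, (liftMeasure (Fin 3) n).real {σ} = 1 / (n.factorial : ℝ) ^ 3 := fun σ => by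
    rw [liftMeasure, Measure.real, Measure.pi_singleton]
    simp [uniformOn_univ, Fintype.card_perm, ENNReal.toReal_pow]
  rw [integral_fintype (Integrable.of_finite)]
  simp [h, div_eq_inv_mul, Finset.mul_sum]

end RandomLift

/-! ### Counting lifts with prescribed vertex classes. -/

namespace RandomLift

open Finset in
/-- The number of permutations that match the fibres of two functions. -/
lemma card_perm_comp_eq {α T : Type*} [Fintype α] [DecidableEq α] [Fintype T] [DecidableEq T]
    (p q : α → T) :
    (univ.filter fun π : Equiv.Perm α => ∀ x, q (π x) = p x).card =
      if ∀ t, (univ.filter fun x => p x = t).card = (univ.filter fun x => q x = t).card then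
        ∏ t, (univ.filter fun x => p x = t).card.factorial else 0 := by
  split_ifs with h
  · have e : ∀ t, Nonempty ({x // p x = t} ≃ {x // q x = t}) := fun t => by
      rw [← Fintype.card_eq, Fintype.card_subtype, Fintype.card_subtype]
      exact h t
    -- A reference solution, built from bijections between the fibres. Every solution is `ρ * π₀`
    -- with `ρ` in the stabiliser of `q`, so the count is the order of that stabiliser.
    let π₀ : Equiv.Perm α := (Equiv.sigmaFiberEquiv p).symm.trans
      ((Equiv.sigmaCongrRight fun t => (e t).some).trans (Equiv.sigmaFiberEquiv q))
    have hπ₀ : ∀ x, q (π₀ x) = p x := fun x => by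
      simp only [π₀, Equiv.trans_apply, Equiv.sigmaCongrRight_apply]
      exact (((e _).some) _).2
    have := DomMulAct.stabilizer_card q
    rw [Fintype.card_subtype] at this
    simp_rw [Fintype.card_subtype, ← h] at this
    rw [← this]
    refine card_nbij' (fun π => π * π₀⁻¹) (fun π => π * π₀) ?_ ?_ ?_ ?_
    · intro π hπ
      simp only [coe_filter, mem_univ, true_and, Set.mem_ofPred_eq] at hπ ⊢
      ext x
      have h2 := hπ₀ (π₀⁻¹ x)
      rw [← Equiv.Perm.mul_apply, mul_inv_cancel, Equiv.Perm.one_apply] at h2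
      simp [hπ, h2]
    · intro π hπ
      simp only [coe_filter, mem_univ, true_and, Set.mem_ofPred_eq] at hπ ⊢
      intro x
      have := congrFun hπ (π₀ x)
      simp only [Function.comp_apply] at this
      simp [this, hπ₀]
    · intro π _; simp
    · intro π _; simp
  · rw [card_eq_zero, filter_eq_empty_iff]
    intro π _ hπ
    refine h fun t => ?_
    refine card_nbij π ?_ π.injective.injOn ?_
    · intro x; simp [hπ]
    · intro y hy
      simp only [coe_filter, mem_univ, true_and, Set.mem_ofPred_eq] at hy
      exact ⟨π.symm y, by simp [← hπ, hy], by simp⟩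

/-- The number of vertices on side `i` in the class `t`. -/
def classCard {n : ℕ} {T : Type*} [DecidableEq T] (κ : Vert n → T) (i : Bool) (t : T) : ℕ :=
  (Finset.univ.filter fun x => κ (i, x) = t).card

/-- The permutations of the three colours are chosen independently, and each of them only has to map
every class on one side onto the same class on the other side. -/
lemma card_model {n : ℕ} {T : Type*} [Fintype T] [DecidableEq T] (κ : Fin 3 → Vert n → T) :
    (model κ).card = ∏ e, if ∀ t, classCard (κ e) false t = classCard (κ e) true t then
      ∏ t, (classCard (κ e) false t).factorial else 0 := by
  have : model κ = Fintype.piFinset fun e => Finset.univ.filter fun π : Equiv.Perm (Fin n) =>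
      ∀ x, κ e (true, π x) = κ e (false, x) := by
    ext σ
    simp [mem_model_iff_comp]
  rw [this, Fintype.card_piFinset]
  refine Finset.prod_congr rfl fun e _ => ?_
  convert card_perm_comp_eq (fun x => κ e (false, x)) (fun x => κ e (true, x)) <;> rfl

/-- The number of times that a function takes each value. -/
def counts {n : ℕ} {S : Type*} [DecidableEq S] (f : Fin n → S) (s : S) : ℕ :=
  (Finset.univ.filter fun i => f i = s).card

open Finset in
lemma prod_apply_eq_prod_pow_counts {n : ℕ} {S R : Type*} [DecidableEq S] [Fintype S]
    [CommMonoid R] (f : Fin n → S) (w : S → R) : ∏ i, w (f i) = ∏ s, w s ^ counts f s := by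
  rw [← prod_fiberwise' univ f w]
  simp [counts]

open Finset in
/-- A sum over functions of a quantity that depends only on the numbers of times that each value
is taken. -/
lemma sum_counts {n : ℕ} {S : Type*} [DecidableEq S] [Fintype S] (w : S → ℝ)
    (Ψ : (S → ℕ) → ℝ) :
    ∑ f : Fin n → S, (∏ i, w (f i)) * Ψ (counts f) =
      ∑ k ∈ piAntidiag (univ : Finset S) n,
        (Nat.multinomial univ k : ℝ) * (∏ s, w s ^ k s) * Ψ k := by
  classical
  -- The linear functional with value `Ψ k` on the monomial with exponents `k`. Applied to the
  -- multinomial expansion of `(∑ w s * X s) ^ n` it yields the identity for an arbitrary `Ψ`.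
  let L : MvPolynomial S ℝ →ₗ[ℝ] ℝ :=
    (MvPolynomial.basisMonomials S ℝ).constr ℝ fun k => Ψ k
  have hmon : ∀ k : S → ℕ, ∏ s, (MvPolynomial.X s : MvPolynomial S ℝ) ^ k s =
      MvPolynomial.monomial (Finsupp.equivFunOnFinite.symm k) 1 := fun k => by
    rw [MvPolynomial.monomial_eq, Finsupp.prod_fintype _ _ (by simp)]
    simp
  have hL : ∀ k : S → ℕ, L (∏ s, (MvPolynomial.X s : MvPolynomial S ℝ) ^ k s) = Ψ k := fun k => by
    have := (MvPolynomial.basisMonomials S ℝ).constr_basis ℝ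
      (fun k : S →₀ ℕ => Ψ k) (Finsupp.equivFunOnFinite.symm k)
    rw [MvPolynomial.coe_basisMonomials] at this
    rw [hmon]
    simpa [L] using this
  have hL' : ∀ k : S → ℕ, L (∏ s, (MvPolynomial.C (w s) * MvPolynomial.X s :
      MvPolynomial S ℝ) ^ k s) = (∏ s, w s ^ k s) * Ψ k := fun k => by
    rw [← hL, ← smul_eq_mul, ← map_smul]
    congr 1
    simp_rw [mul_pow, prod_mul_distrib, ← map_pow, ← map_prod]
    rw [MvPolynomial.smul_eq_C_mul]
  have h1 := Fintype.sum_pow (fun s => (MvPolynomial.C (w s) * MvPolynomial.X s :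
    MvPolynomial S ℝ)) n
  rw [sum_pow_eq_sum_piAntidiag] at h1
  have h2 := congrArg L h1
  rw [map_sum, map_sum] at h2
  rw [sum_congr rfl fun f _ => by rw [prod_apply_eq_prod_pow_counts, ← hL',
    ← prod_apply_eq_prod_pow_counts f fun s => (MvPolynomial.C (w s) * MvPolynomial.X s :
    MvPolynomial S ℝ)], ← h2]
  refine sum_congr rfl fun k _ => ?_
  rw [mul_assoc, ← hL', ← nsmul_eq_mul, ← nsmul_eq_mul]
  exact map_nsmul L _ _

/-- The number of elements, with multiplicities `k`, in the class `t`. -/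
def classSum {S T : Type*} [Fintype S] [DecidableEq T] (c : S → T) (t : T) (k : S → ℕ) : ℕ :=
  ∑ s, if c s = t then k s else 0

lemma classCard_comp {n : ℕ} {S T : Type*} [Fintype S] [DecidableEq S] [DecidableEq T]
    (c : S → T) (F : Vert n → S) (i : Bool) (t : T) :
    classCard (fun v => c (F v)) i t = classSum c t (counts fun x => F (i, x)) := by
  unfold classCard classSum counts
  have h : ∀ s, (if c s = t then (Finset.univ.filter fun x => F (i, x) = s).card else 0) =
      ∑ x, if c s = t then (if F (i, x) = s then 1 else 0) else 0 := fun s => by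
    split_ifs <;> simp
  simp_rw [h, Finset.card_filter]
  rw [Finset.sum_comm]
  refine Finset.sum_congr rfl fun x _ => ?_
  rw [Finset.sum_eq_single (F (i, x))] <;> simp +contextual [eq_comm]

lemma sum_vert_fun {n : ℕ} {S : Type*} [Fintype S] [DecidableEq S]
    (G : (Fin n → S) → (Fin n → S) → ℝ) :
    ∑ F : Vert n → S, G (fun x => F (false, x)) (fun x => F (true, x)) = ∑ f, ∑ g, G f g := by
  rw [← Fintype.sum_prod_type']
  refine Fintype.sum_equiv ((Equiv.curry Bool (Fin n) S).trans
    (Equiv.boolArrowEquivProd (Fin n → S))) _ _ fun F => ?_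
  rfl

open Finset in
/-- The weighted number of pairs of a typing of the vertices and a lift that respects the classes
of the types. -/
lemma sum_card_model {n : ℕ} {S T : Type*} [Fintype S] [DecidableEq S] [Fintype T]
    [DecidableEq T] (c : Fin 3 → S → T) (w : S → ℝ) (Θ : (S → ℕ) → ℝ) :
    ∑ F : Vert n → S, (∏ v, w (F v)) * Θ (counts fun x => F (false, x)) *
        ((model fun e v => c e (F v)).card : ℝ) =
      ∑ k ∈ piAntidiag (univ : Finset S) n, ∑ m ∈ piAntidiag (univ : Finset S) n,
        (Nat.multinomial univ k : ℝ) * (∏ s, w s ^ k s) *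
          ((Nat.multinomial univ m : ℝ) * (∏ s, w s ^ m s) *
          (Θ k * ∏ e, if ∀ t, classSum (c e) t k = classSum (c e) t m then
            ∏ t, ((classSum (c e) t k).factorial : ℝ) else 0)) := by
  simp_rw [← mul_sum, ← sum_counts w (n := n), card_model, classCard_comp]
  have := sum_vert_fun (n := n) (S := S) fun f g => (∏ i, w (f i)) * ((∏ i, w (g i)) *
    (Θ (counts f) * ∏ e, if ∀ t, classSum (c e) t (counts f) = classSum (c e) t (counts g) then
            ∏ t, ((classSum (c e) t (counts f)).factorial : ℝ) else 0))
  simp_rw [← mul_sum] at this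
  rw [← this]
  refine sum_congr rfl fun F _ => ?_
  rw [Fintype.prod_prod_type, Fintype.prod_bool]
  push_cast
  ring

end RandomLift

/-! ### The first moment and Dirichlet integrals. -/

namespace RandomLift

open Finset in
/-- The number of pairs of a lift and one of its perfect matchings, weighted by a function of the
numbers of matching edges of each colour. -/
lemma sum_card_model_cover {n : ℕ} (Θ : (Fin 3 → ℕ) → ℝ) :
    ∑ τ : Vert n → Fin 3, Θ (counts fun x => τ (false, x)) * ((model (cover τ)).card : ℝ) =
      (n.factorial : ℝ) ^ 2 * ∑ k ∈ piAntidiag (univ : Finset (Fin 3)) n,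
        Θ k * ∏ e, ((n - k e).factorial : ℝ) / (k e).factorial := by
  have h := sum_card_model (n := n) (fun (e s : Fin 3) => decide (s = e)) (fun _ => 1) Θ
  simp only [prod_const_one, one_mul, one_pow, mul_one] at h
  change ∑ τ : Vert n → Fin 3, Θ (counts fun x => τ (false, x)) *
    ((model fun e v => decide (τ v = e)).card : ℝ) = _
  rw [h, mul_sum]
  have htrue : ∀ e (k : Fin 3 → ℕ), classSum (fun s => decide (s = e)) true k = k e := fun e k => by
    simp [classSum]
  have hfalse : ∀ e (k : Fin 3 → ℕ), k ∈ piAntidiag (univ : Finset (Fin 3)) n →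
      classSum (fun s => decide (s = e)) false k = n - k e := fun e k hk => by
    rw [mem_piAntidiag] at hk
    rw [← hk.1]
    fin_cases e <;> simp [classSum, Fin.sum_univ_three] <;> omega
  refine sum_congr rfl fun k hk => ?_
  -- The class `true` of colour `e` has `k e` vertices on one side and `m e` on the other, so only
  -- `m = k` contributes.
  rw [sum_eq_single k]
  · have hk' := Nat.multinomial_spec univ k
    rw [(mem_piAntidiag.1 hk).1] at hk'
    have hk2 : (∏ e, ((k e).factorial : ℝ)) * (Nat.multinomial univ k : ℝ) = n.factorial := by
      exact_mod_cast hk'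
    have hpos : (∏ e, ((k e).factorial : ℝ)) ≠ 0 :=
      prod_ne_zero_iff.2 fun e _ => by positivity
    rw [← hk2]
    simp only [implies_true, if_true, Fintype.prod_bool, htrue, hfalse _ k hk, prod_mul_distrib,
      prod_div_distrib]
    field_simp
  · intro m hm hmk
    refine mul_eq_zero_of_right _ (mul_eq_zero_of_right _ (mul_eq_zero_of_right _ ?_))
    rw [prod_eq_zero_iff]
    by_contra! hne
    refine hmk (funext fun e => ?_)
    have := hne e (mem_univ e)
    simp only [ne_eq, ite_eq_right_iff, not_forall, exists_prop] at this
    have := this.1 true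
    rw [htrue, htrue] at this
    exact this.symm
  · exact fun h => absurd hk h

/-- The triangle of the points with nonnegative barycentric coordinates. -/
def simplex : Set (ℝ × ℝ) := {p | 0 ≤ p.1 ∧ 0 ≤ p.2 ∧ p.1 + p.2 ≤ 1}

/-- The barycentric coordinates. -/
def bary (p : ℝ × ℝ) : Fin 3 → ℝ := ![p.1, p.2, 1 - p.1 - p.2]

@[simp] lemma bary_zero (p : ℝ × ℝ) : bary p 0 = p.1 := rfl
@[simp] lemma bary_one (p : ℝ × ℝ) : bary p 1 = p.2 := rfl
@[simp] lemma bary_two (p : ℝ × ℝ) : bary p 2 = 1 - p.1 - p.2 := rfl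

lemma bary_nonneg {p : ℝ × ℝ} (hp : p ∈ simplex) (e : Fin 3) : 0 ≤ bary p e := by
  obtain ⟨h0, h1, h2⟩ := hp
  fin_cases e <;> simp [bary] <;> linarith

@[fun_prop] lemma continuous_bary (e : Fin 3) : Continuous fun p => bary p e := by
  fin_cases e <;> simp [bary] <;> fun_prop

lemma isClosed_simplex : IsClosed simplex :=
  ((isClosed_le continuous_const continuous_fst).inter
    ((isClosed_le continuous_const continuous_snd).inter
    (isClosed_le (continuous_fst.add continuous_snd) continuous_const)))

lemma measurableSet_simplex : MeasurableSet simplex := isClosed_simplex.measurableSet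

lemma isCompact_simplex : IsCompact simplex := by
  refine (isCompact_Icc (a := ((0 : ℝ), (0 : ℝ))) (b := (1, 1))).of_isClosed_subset
    isClosed_simplex ?_
  rintro ⟨x, y⟩ ⟨h0, h1, h2⟩
  simp only at h0 h1 h2
  refine ⟨⟨h0, h1⟩, ⟨?_, ?_⟩⟩ <;> simp only <;> linarith

lemma integrableOn_simplex {f : ℝ × ℝ → ℝ} (hf : Continuous f) : IntegrableOn f simplex :=
  hf.continuousOn.integrableOn_compact isCompact_simplex

/-- The Beta integral, by induction on `c`: the function `y ^ (b + 1) * (s - y) ^ (c + 1)` vanishes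
at both ends, and integrating its derivative trades a power of `s - y` for a power of `y`. -/
lemma integral_pow_mul_sub_pow (b c : ℕ) (s : ℝ) :
    ∫ y in (0 : ℝ)..s, y ^ b * (s - y) ^ c =
      s ^ (b + c + 1) * (b.factorial * c.factorial / (b + c + 1).factorial) := by
  induction c generalizing b with
  | zero =>
    simp only [pow_zero, mul_one, integral_pow, Nat.factorial_succ]
    have := Nat.factorial_ne_zero b
    push_cast
    field_simp
    simp
  | succ c ih =>
    have hd : ∀ y ∈ Set.uIcc 0 s, HasDerivAt (fun y : ℝ => y ^ (b + 1) * (s - y) ^ (c + 1))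
        ((b + 1) * (y ^ b * (s - y) ^ (c + 1)) - (c + 1) * (y ^ (b + 1) * (s - y) ^ c)) y := by
      intro y _
      have h1 := (hasDerivAt_pow (b + 1) y).mul (((hasDerivAt_id y).const_sub s).pow (c + 1))
      refine h1.congr_deriv ?_
      simp
      ring
    have := intervalIntegral.integral_eq_sub_of_hasDerivAt hd
      (Continuous.intervalIntegrable (by fun_prop) _ _)
    rw [intervalIntegral.integral_sub (Continuous.intervalIntegrable (by fun_prop) _ _)
      (Continuous.intervalIntegrable (by fun_prop) _ _), intervalIntegral.integral_const_mul,
      intervalIntegral.integral_const_mul, ih (b + 1)] at this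
    simp only [sub_self, ne_eq, Nat.add_eq_zero_iff, one_ne_zero, and_false, not_false_eq_true,
      zero_pow, mul_zero, zero_mul] at this
    have hb : (b : ℝ) + 1 ≠ 0 := by positivity
    rw [sub_eq_zero, mul_comm, ← eq_div_iff hb] at this
    rw [this, show b + 1 + c + 1 = b + (c + 1) + 1 by ring, Nat.factorial_succ b,
      Nat.factorial_succ c]
    push_cast
    field_simp

lemma setIntegral_simplex {f : ℝ × ℝ → ℝ} (hf : Continuous f) :
    ∫ p in simplex, f p = ∫ x in (0 : ℝ)..1, ∫ y in (0 : ℝ)..(1 - x), f (x, y) := by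
  rw [← integral_indicator measurableSet_simplex, Measure.volume_eq_prod,
    integral_prod _ ((integrable_indicator_iff measurableSet_simplex).2 (integrableOn_simplex hf)),
    intervalIntegral.integral_of_le zero_le_one, ← integral_Icc_eq_integral_Ioc,
    ← integral_indicator measurableSet_Icc]
  congr 1
  ext x
  by_cases hx : x ∈ Set.Icc (0 : ℝ) 1
  · rw [Set.indicator_of_mem hx, intervalIntegral.integral_of_le (by linarith [hx.2]),
      ← integral_Icc_eq_integral_Ioc, ← integral_indicator measurableSet_Icc]
    congr 1
    ext y
    refine Set.indicator_eq_indicator ?_ rfl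
    simp only [simplex, Set.mem_ofPred_eq, Set.mem_Icc]
    constructor
    · rintro ⟨_, h1, h2⟩; exact ⟨h1, by linarith⟩
    · rintro ⟨h1, h2⟩; exact ⟨hx.1, h1, by linarith⟩
  · rw [Set.indicator_of_notMem hx]
    refine (integral_congr_ae (Eventually.of_forall fun y => ?_)).trans (integral_zero _ _)
    refine Set.indicator_of_notMem ?_ _
    rintro ⟨h0, h1, h2⟩
    exact hx ⟨h0, by simp only at h1 h2; linarith⟩

/-- The Dirichlet integral. -/
lemma prod_factorial_eq_integral (q : Fin 3 → ℕ) :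
    ∏ e, ((q e).factorial : ℝ) =
      (∑ e, q e + 2).factorial * ∫ p in simplex, ∏ e, bary p e ^ q e := by
  rw [setIntegral_simplex (by fun_prop)]
  simp only [Fin.prod_univ_three, Fin.sum_univ_three, bary_zero, bary_one, bary_two]
  simp_rw [mul_assoc, intervalIntegral.integral_const_mul, integral_pow_mul_sub_pow,
    ← mul_assoc, intervalIntegral.integral_mul_const, integral_pow_mul_sub_pow]
  rw [show q 0 + (q 1 + q 2 + 1) + 1 = q 0 + q 1 + q 2 + 2 by ring]
  field_simp
  simp

open Finset in
/-- The expected number of perfect matchings, weighted by the number of edges of each colour. -/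
lemma sum_prod_factorial_div (n : ℕ) (x : Fin 3 → ℝ) :
    ∑ k ∈ piAntidiag (univ : Finset (Fin 3)) n,
        (∏ e, x e ^ k e) * ∏ e, ((n - k e).factorial : ℝ) / (k e).factorial =
      (2 * n + 2).factorial / n.factorial * ∫ p in simplex,
        (x 0 * (bary p 1 * bary p 2) + x 1 * (bary p 0 * bary p 2) +
          x 2 * (bary p 0 * bary p 1)) ^ n := by
  -- Since `∑ k = n`, the exponent `n - k 0` is `k 1 + k 2`, and so on. Hence the multinomial
  -- expansion produces the monomials `∏ bary p e ^ (n - k e)`, whose Dirichlet integrals are the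
  -- products of the factorials `(n - k e)!` up to the constant `(2 n + 2)!`. The variables `x`
  -- serve later to tilt the law of the colour counts.
  have h : ∀ p, (x 0 * (bary p 1 * bary p 2) + x 1 * (bary p 0 * bary p 2) +
      x 2 * (bary p 0 * bary p 1)) ^ n = ∑ k ∈ piAntidiag (univ : Finset (Fin 3)) n,
      (n.factorial / (∏ e, ((k e).factorial : ℝ)) * ∏ e, x e ^ k e) *
        ∏ e, bary p e ^ (n - k e) := fun p => by
    have := sum_pow_eq_sum_piAntidiag (univ : Finset (Fin 3)) ![x 0 * (bary p 1 * bary p 2),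
      x 1 * (bary p 0 * bary p 2), x 2 * (bary p 0 * bary p 1)] n
    rw [Fin.sum_univ_three] at this
    simp only [Matrix.cons_val] at this
    rw [this]
    refine sum_congr rfl fun k hk => ?_
    have hk1 := (mem_piAntidiag.1 hk).1
    have hk' := Nat.multinomial_spec univ k
    rw [hk1] at hk'
    have hk2 : (∏ e, ((k e).factorial : ℝ)) * (Nat.multinomial univ k : ℝ) = n.factorial := by
      exact_mod_cast hk'
    have hpos : (∏ e, ((k e).factorial : ℝ)) ≠ 0 :=
      prod_ne_zero_iff.2 fun e _ => by positivity
    rw [← hk2, mul_div_cancel_left₀ _ hpos, mul_assoc]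
    congr 1
    rw [Fin.sum_univ_three] at hk1
    simp only [Fin.prod_univ_three, Matrix.cons_val]
    rw [show n - k 0 = k 1 + k 2 by omega, show n - k 1 = k 0 + k 2 by omega,
      show n - k 2 = k 0 + k 1 by omega]
    simp only [pow_add, mul_pow]
    ring
  simp_rw [h]
  rw [integral_finsetSum _ fun k _ => integrableOn_simplex (by fun_prop), mul_sum]
  refine sum_congr rfl fun k hk => ?_
  have hk1 := (mem_piAntidiag.1 hk).1
  have hq : ∑ e, (n - k e) = 2 * n := by
    rw [Fin.sum_univ_three] at hk1 ⊢
    omega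
  rw [integral_const_mul, prod_div_distrib, prod_factorial_eq_integral, hq]
  have hpos : (∏ e, ((k e).factorial : ℝ)) ≠ 0 :=
    prod_ne_zero_iff.2 fun e _ => by positivity
  field_simp

end RandomLift

/-! ### Symmetric powers of matrices and contingency tables. -/

namespace SymmetricPower

open Finset MvPolynomial

/-- The exponents of the monomials of degree `N` in three variables. -/
abbrev Exponent (N : ℕ) := {r : Fin 3 → ℕ // r ∈ piAntidiag (univ : Finset (Fin 3)) N}

/-- The monomial with given exponents. -/
noncomputable def mono (r : Fin 3 → ℕ) : MvPolynomial (Fin 3) ℝ := ∏ s, X s ^ r s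

lemma mono_eq (r : Fin 3 → ℕ) : mono r = monomial (Finsupp.equivFunOnFinite.symm r) 1 := by
  rw [mono, monomial_eq, Finsupp.prod_fintype _ _ (by simp)]
  simp

lemma coeff_mono (r c : Fin 3 → ℕ) :
    coeff (Finsupp.equivFunOnFinite.symm c) (mono r) = if r = c then 1 else 0 := by
  rw [mono_eq, coeff_monomial]
  simp

/-- The linear change of variables given by a matrix. -/
noncomputable def substLin (A : Matrix (Fin 3) (Fin 3) ℝ) :
    MvPolynomial (Fin 3) ℝ →ₐ[ℝ] MvPolynomial (Fin 3) ℝ :=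
  aeval fun s => ∑ t, C (A s t) * X t

/-- The matrix of the symmetric power of a matrix, in the basis of monomials. -/
noncomputable def symPow (N : ℕ) (A : Matrix (Fin 3) (Fin 3) ℝ) :
    Matrix (Exponent N) (Exponent N) ℝ :=
  Matrix.of fun r c => coeff (Finsupp.equivFunOnFinite.symm c.1) (substLin A (mono r))

lemma substLin_mono (A : Matrix (Fin 3) (Fin 3) ℝ) (r : Fin 3 → ℕ) :
    substLin A (mono r) = ∏ s, (∑ t, C (A s t) * X t) ^ r s := by
  simp [substLin, mono]

lemma isHomogeneous_substLin_mono (A : Matrix (Fin 3) (Fin 3) ℝ) {N : ℕ} (r : Exponent N) :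
    (substLin A (mono r)).IsHomogeneous N := by
  rw [substLin_mono]
  have h := IsHomogeneous.prod (univ : Finset (Fin 3))
    (fun s => (∑ t, C (A s t) * X t : MvPolynomial (Fin 3) ℝ) ^ r.1 s) (fun s => 1 * r.1 s)
    fun s _ => IsHomogeneous.pow (IsHomogeneous.sum _ _ _ fun t _ => by
      simpa using (isHomogeneous_C_mul_X (A s t) t)) _
  simpa [(mem_piAntidiag.1 r.2).1] using h

lemma substLin_mono_eq_sum (A : Matrix (Fin 3) (Fin 3) ℝ) {N : ℕ} (r : Exponent N) :
    substLin A (mono r) = ∑ c : Exponent N, C (symPow N A r c) * mono c := by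
  ext d
  obtain ⟨d, rfl⟩ := Finsupp.equivFunOnFinite.symm.surjective d
  simp only [coeff_sum, coeff_C_mul, coeff_mono, mul_ite, mul_one, mul_zero]
  by_cases hd : d ∈ piAntidiag (univ : Finset (Fin 3)) N
  · rw [sum_eq_single (⟨d, hd⟩ : Exponent N)]
    · simp [symPow]
    · intro c _ hc
      rw [if_neg]
      exact fun h => hc (Subtype.ext h)
    · simp
  · rw [sum_eq_zero, (isHomogeneous_substLin_mono A r).coeff_eq_zero]
    · intro h
      apply hd
      rw [mem_piAntidiag]
      refine ⟨?_, by simp⟩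
      rw [← h, Finsupp.degree_eq_sum]
      simp
    · intro c _
      rw [if_neg]
      rintro rfl
      exact hd c.2

/-- Functoriality: the substitution by `A * B` is the one by `A` followed by the one by `B`. This
makes the traces of symmetric powers invariant under similarity. -/
lemma symPow_mul (N : ℕ) (A B : Matrix (Fin 3) (Fin 3) ℝ) :
    symPow N (A * B) = symPow N A * symPow N B := by
  have hcomp : substLin (A * B) = (substLin B).comp (substLin A) := by
    refine algHom_ext fun s => ?_
    simp only [substLin, aeval_X, AlgHom.comp_apply, map_sum, map_mul, algHom_C, Matrix.mul_apply,
      algebraMap_eq, mul_sum, sum_mul, mul_assoc]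
    rw [sum_comm]
  ext r c
  rw [Matrix.mul_apply]
  conv_lhs => rw [symPow, Matrix.of_apply, hcomp, AlgHom.comp_apply, substLin_mono_eq_sum A r,
    map_sum, coeff_sum]
  refine sum_congr rfl fun d _ => ?_
  rw [map_mul, algHom_C, algebraMap_eq, coeff_C_mul]
  rfl

lemma symPow_diagonal (N : ℕ) (β : Fin 3 → ℝ) (r : Exponent N) :
    symPow N (Matrix.diagonal β) r r = ∏ s, β s ^ r.1 s := by
  have : ∀ s : Fin 3, (∑ t, C (Matrix.diagonal β s t) * X t : MvPolynomial (Fin 3) ℝ) =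
      C (β s) * X s := fun s => by
    rw [sum_eq_single s]
    · simp
    · intro t _ hts
      rw [Matrix.diagonal_apply_ne _ hts.symm]; simp
    · simp
  rw [symPow, Matrix.of_apply, substLin_mono]
  simp_rw [this, mul_pow, prod_mul_distrib, ← map_pow, ← map_prod]
  rw [coeff_C_mul]
  change _ * coeff _ (mono r.1) = _
  rw [coeff_mono, if_pos rfl, mul_one]

/-- The symmetric powers of similar matrices have the same trace. -/
lemma trace_symPow_eq_of_mul_eq (N : ℕ) {A B D D' : Matrix (Fin 3) (Fin 3) ℝ}
    (hD : D * D' = 1) (h : D * A = B * D) : (symPow N A).trace = (symPow N B).trace := by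
  have hA : A = D' * (B * D) := by
    rw [← h, ← mul_assoc, mul_eq_one_comm.1 hD, one_mul]
  rw [hA, symPow_mul, Matrix.trace_mul_comm, ← symPow_mul, mul_assoc, hD, mul_one]

lemma trace_symPow_diagonal (N : ℕ) (β : Fin 3 → ℝ) :
    (symPow N (Matrix.diagonal β)).trace =
      ∑ r ∈ piAntidiag (univ : Finset (Fin 3)) N, ∏ s, β s ^ r s := by
  rw [Matrix.trace, ← sum_coe_sort (piAntidiag (univ : Finset (Fin 3)) N)]
  exact sum_congr rfl fun r _ => symPow_diagonal N β r

/-- The row sums of a table. -/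
def rowSum (k : Fin 3 × Fin 3 → ℕ) (s : Fin 3) : ℕ := ∑ t, k (s, t)

/-- The column sums of a table. -/
def colSum (k : Fin 3 × Fin 3 → ℕ) (t : Fin 3) : ℕ := ∑ s, k (s, t)

/-- Expanding `∏ s, (∑ t, A s t * X t) ^ r s` distributes the `r s` factors of row `s` among the
columns. The choices form a table with row sums `r`, and the exponents of the resulting monomial are
its column sums. -/
lemma symPow_apply (N : ℕ) (A : Matrix (Fin 3) (Fin 3) ℝ) (r c : Exponent N) :
    symPow N A r c = ∑ k ∈ piAntidiag (univ : Finset (Fin 3 × Fin 3)) N,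
      if rowSum k = r.1 ∧ colSum k = c.1 then
        (∏ s, ((r.1 s).factorial : ℝ)) / (∏ p, ((k p).factorial : ℝ)) * ∏ p, A p.1 p.2 ^ k p
      else 0 := by
  rw [symPow, Matrix.of_apply, substLin_mono]
  simp_rw [sum_pow_eq_sum_piAntidiag]
  rw [prod_univ_sum, coeff_sum]
  have hterm : ∀ κ : Fin 3 → Fin 3 → ℕ, κ ∈ Fintype.piFinset (fun s => piAntidiag univ (r.1 s)) →
      coeff (Finsupp.equivFunOnFinite.symm c.1) (∏ s, ((Nat.multinomial univ (κ s) : ℕ) :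
        MvPolynomial (Fin 3) ℝ) * ∏ t, (C (A s t) * X t) ^ κ s t) =
      if colSum (fun p => κ p.1 p.2) = c.1 then
        (∏ s, ((r.1 s).factorial : ℝ)) / (∏ p : Fin 3 × Fin 3, ((κ p.1 p.2).factorial : ℝ)) *
          ∏ p : Fin 3 × Fin 3, A p.1 p.2 ^ κ p.1 p.2 else 0 := by
    intro κ hκ
    have hX : ∏ s, ∏ t, (X t : MvPolynomial (Fin 3) ℝ) ^ κ s t =
        mono (colSum fun p => κ p.1 p.2) := by
      rw [Finset.prod_comm, mono]
      refine prod_congr rfl fun t _ => ?_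
      rw [prod_pow_eq_pow_sum]; rfl
    simp_rw [mul_pow, prod_mul_distrib]
    rw [hX]
    simp_rw [← map_pow, ← map_natCast (C : ℝ →+* MvPolynomial (Fin 3) ℝ), ← map_prod,
      ← mul_assoc, ← map_mul]
    rw [coeff_C_mul, coeff_mono, mul_ite, mul_one, mul_zero]
    refine if_congr Iff.rfl ?_ rfl
    rw [Fintype.prod_prod_type, Fintype.prod_prod_type, ← prod_div_distrib]
    congr 1
    refine prod_congr rfl fun s _ => ?_
    have hs := (mem_piAntidiag.1 (Fintype.mem_piFinset.1 hκ s)).1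
    have h2 := Nat.multinomial_spec univ (κ s)
    rw [hs] at h2
    rw [eq_div_iff (prod_ne_zero_iff.2 fun e _ => by positivity), ← h2]
    push_cast
    ring
  rw [sum_congr rfl hterm, ← sum_filter, ← sum_filter]
  refine sum_nbij' (fun κ p => κ p.1 p.2) (fun k s t => k (s, t)) ?_ ?_ ?_ ?_ ?_
  · intro κ hκ
    simp only [mem_filter, Fintype.mem_piFinset, mem_piAntidiag] at hκ ⊢
    obtain ⟨h1, h2⟩ := hκ
    have hrow : rowSum (fun p => κ p.1 p.2) = r.1 := funext fun s => (h1 s).1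
    refine ⟨⟨?_, by simp⟩, hrow, h2⟩
    have h3 := (mem_piAntidiag.1 r.2).1
    rw [Fintype.sum_prod_type, ← h3, ← hrow]
    rfl
  · intro k hk
    simp only [mem_filter, Fintype.mem_piFinset, mem_piAntidiag] at hk ⊢
    obtain ⟨h1, h2, h3⟩ := hk
    refine ⟨fun s => ⟨?_, by simp⟩, h3⟩
    rw [← h2]; rfl
  · intro κ _; rfl
  · intro k _; rfl
  · intro κ _; rfl

/-- Two tables with the same margins, counted with weights. -/
lemma trace_symPow_mul_symPow (N : ℕ) (A B : Matrix (Fin 3) (Fin 3) ℝ) (hB : B.IsSymm) :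
    (symPow N (A * B)).trace = ∑ k ∈ piAntidiag (univ : Finset (Fin 3 × Fin 3)) N,
      ∑ m ∈ piAntidiag (univ : Finset (Fin 3 × Fin 3)) N,
        if rowSum k = rowSum m ∧ colSum k = colSum m then
          ((∏ s, ((rowSum k s).factorial : ℝ)) / (∏ p, ((k p).factorial : ℝ)) *
            ∏ p, A p.1 p.2 ^ k p) *
          ((∏ s, ((colSum k s).factorial : ℝ)) / (∏ p, ((m p).factorial : ℝ)) *
            ∏ p, B p.1 p.2 ^ m p) else 0 := by
  -- The tables of the second factor are transposed, so that both factors refer to tables with row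
  -- sums `r` and column sums `c`; the symmetry of `B` keeps the weights.
  have hswap : ∀ r c : Exponent N, symPow N B c r =
      ∑ m ∈ piAntidiag (univ : Finset (Fin 3 × Fin 3)) N,
      if rowSum m = r.1 ∧ colSum m = c.1 then
        (∏ s, ((c.1 s).factorial : ℝ)) / (∏ p, ((m p).factorial : ℝ)) * ∏ p, B p.1 p.2 ^ m p
      else 0 := fun r c => by
    rw [symPow_apply]
    refine sum_nbij' (fun k p => k p.swap) (fun k p => k p.swap) ?_ ?_ ?_ ?_ ?_
    · intro k hk
      rw [mem_piAntidiag] at hk ⊢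
      refine ⟨?_, by simp⟩
      rw [← hk.1]
      exact Fintype.sum_equiv (Equiv.prodComm _ _) _ _ fun p => rfl
    · intro k hk
      rw [mem_piAntidiag] at hk ⊢
      refine ⟨?_, by simp⟩
      rw [← hk.1]
      exact Fintype.sum_equiv (Equiv.prodComm _ _) _ _ fun p => rfl
    · intro k _; simp
    · intro k _; simp
    · intro k _
      refine if_congr and_comm ?_ rfl
      congr 1
      · congr 1
        exact (Fintype.prod_equiv (Equiv.prodComm _ _) _ _ fun p => rfl).symm
      · refine Fintype.prod_equiv (Equiv.prodComm _ _) _ _ fun p => ?_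
        simp only [Equiv.prodComm_apply, Prod.fst_swap, Prod.snd_swap, Prod.swap_swap]
        rw [hB.apply]
  have hmem : ∀ k ∈ piAntidiag (univ : Finset (Fin 3 × Fin 3)) N,
      rowSum k ∈ piAntidiag (univ : Finset (Fin 3)) N ∧
      colSum k ∈ piAntidiag (univ : Finset (Fin 3)) N := fun k hk => by
    simp only [mem_piAntidiag] at hk ⊢
    rw [← hk.1]
    exact ⟨⟨(Fintype.sum_prod_type k).symm, by simp⟩,
      ⟨(Fintype.sum_prod_type_right k).symm, by simp⟩⟩
  rw [symPow_mul, Matrix.trace]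
  simp only [Matrix.diag_apply, Matrix.mul_apply, hswap]
  simp only [symPow_apply, sum_mul_sum]
  simp_rw [sum_comm (s := (univ : Finset (Exponent N)))
    (t := piAntidiag (univ : Finset (Fin 3 × Fin 3)) N)]
  refine sum_congr rfl fun k hk => sum_congr rfl fun m hm => ?_
  rw [sum_eq_single (⟨rowSum k, (hmem k hk).1⟩ : Exponent N),
    sum_eq_single (⟨colSum k, (hmem k hk).2⟩ : Exponent N)]
  · simp only [and_self, if_true, eq_comm (a := rowSum m), eq_comm (a := colSum m), mul_ite,
      mul_zero]
  · intro c _ hc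
    rw [if_neg, zero_mul]
    exact fun h => hc (Subtype.ext h.2.symm)
  · simp
  · intro r _ hr
    refine sum_eq_zero fun c _ => ?_
    rw [if_neg, zero_mul]
    exact fun h => hr (Subtype.ext h.1.symm)
  · simp

end SymmetricPower

/-! ### The second moment as a sum of integrals of traces. -/

namespace RandomLift

open Finset SymmetricPower

lemma sum_piAntidiag_sum {α β : Type*} [Fintype α] [Fintype β] [DecidableEq α] [DecidableEq β]
    (n : ℕ) (G : (α ⊕ β → ℕ) → ℝ) :
    ∑ k ∈ piAntidiag (univ : Finset (α ⊕ β)) n, G k =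
      ∑ q ∈ antidiagonal n, ∑ D ∈ piAntidiag (univ : Finset α) q.1,
        ∑ k ∈ piAntidiag (univ : Finset β) q.2, G (Sum.elim D k) := by
  simp_rw [← sum_product']
  rw [sum_sigma']
  refine sum_nbij' (fun k => ⟨(∑ a, k (Sum.inl a), ∑ b, k (Sum.inr b)),
    (fun a => k (Sum.inl a), fun b => k (Sum.inr b))⟩) (fun x => Sum.elim x.2.1 x.2.2)
    ?_ ?_ ?_ ?_ ?_
  · intro k hk
    rw [mem_piAntidiag, Fintype.sum_sum_type] at hk
    simp [hk.1]
  · rintro ⟨q, D, k⟩ h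
    simp only [mem_sigma, HasAntidiagonal.mem_antidiagonal, mem_product, mem_piAntidiag] at h
    simp [Fintype.sum_sum_type, h]
  · intro k _
    ext (a | b) <;> rfl
  · rintro ⟨⟨a, b⟩, D, k⟩ h
    simp only [mem_sigma, HasAntidiagonal.mem_antidiagonal, mem_product, mem_piAntidiag] at h
    obtain ⟨-, ⟨rfl, -⟩, ⟨rfl, -⟩⟩ := h
    rfl
  · intro k _
    congr 1
    ext (a | b) <;> rfl

/-- The class of a vertex with respect to the edges of colour `e` and two matchings, when the
vertex is covered by a common edge (`inl`), or by two different edges (`inr`). -/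
def pairClass (e : Fin 3) : Fin 3 ⊕ Fin 3 × Fin 3 → Bool × Bool
  | .inl s => (decide (s = e), decide (s = e))
  | .inr p => (decide (p.1 = e), decide (p.2 = e))

/-- The indicator function of the valid types. -/
def pairWeight : Fin 3 ⊕ Fin 3 × Fin 3 → ℝ
  | .inl _ => 1
  | .inr p => if p.1 = p.2 then 0 else 1

/-- The classes of the vertices for two perfect matchings. -/
def cover₂ {n : ℕ} (τ τ' : Vert n → Fin 3) (e : Fin 3) (v : Vert n) : Bool × Bool :=
  (decide (τ v = e), decide (τ' v = e))

/-- A vertex carries either a common colour (`inl`) or two different colours (`inr`), and the weight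
`0` of the diagonal pairs makes this encoding unique. The two kinds are separated because the former
yield powers of `esymmTwo` and the latter a trace. -/
lemma sum_cover₂ {n : ℕ} :
    ∑ τ : Vert n → Fin 3, ∑ τ' : Vert n → Fin 3, ((model (cover₂ τ τ')).card : ℝ) =
      ∑ F : Vert n → Fin 3 ⊕ Fin 3 × Fin 3, (∏ v, pairWeight (F v)) *
        ((model fun e v => pairClass e (F v)).card : ℝ) := by
  rw [← Fintype.sum_prod_type' (f := fun τ τ' : Vert n → Fin 3 =>
    ((model (cover₂ τ τ')).card : ℝ))]
  rw [← sum_filter_add_sum_filter_not (univ : Finset (Vert n → Fin 3 ⊕ Fin 3 × Fin 3))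
    (fun F => ∀ v, pairWeight (F v) ≠ 0)]
  rw [add_eq_left.2]
  · refine sum_bij' (fun x _ v => if x.1 v = x.2 v then Sum.inl (x.1 v) else
      Sum.inr (x.1 v, x.2 v)) (fun F _ => (fun v => Sum.elim id Prod.fst (F v),
        fun v => Sum.elim id Prod.snd (F v))) ?_ ?_ ?_ ?_ ?_
    · intro x _
      simp only [mem_filter, mem_univ, true_and]
      intro v
      split_ifs <;> simp [pairWeight, *]
    · simp
    · intro x _
      ext v <;> dsimp only <;> split_ifs <;> simp [*]
    · intro F hF
      simp only [mem_filter, mem_univ, true_and] at hF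
      ext v : 1
      have := hF v
      rcases h : F v with s | ⟨s, t⟩
      · simp [h]
      · rw [h] at this
        simp only [pairWeight] at this
        simp only [h, Sum.elim_inr]
        rw [if_neg]
        intro h2
        simp [h2] at this
    · intro x _
      rw [prod_eq_one, one_mul]
      · congr 3
        ext e v : 2
        dsimp only
        split_ifs with h
        · simp [cover₂, pairClass, h]
        · simp [cover₂, pairClass]
      · intro v _
        dsimp only
        split_ifs <;> simp [pairWeight, *]
  · refine sum_eq_zero fun F hF => ?_
    simp only [mem_filter, mem_univ, true_and, not_forall, ne_eq, not_not] at hF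
    obtain ⟨v, hv⟩ := hF
    rw [prod_eq_zero (mem_univ v) hv, zero_mul]

/-- The matrix of ones off the diagonal. -/
def offDiag : Matrix (Fin 3) (Fin 3) ℝ := Matrix.of fun s t => if s = t then 0 else 1

/-- The off-diagonal matrix with the third coordinate. -/
def thirdMat (x : Fin 3 → ℝ) : Matrix (Fin 3) (Fin 3) ℝ :=
  Matrix.of fun s t => if s = t then 0 else x (-(s + t))

lemma offDiag_isSymm : offDiag.IsSymm := by
  ext s t; simp [offDiag, eq_comm]

/-- Whether a table vanishes on the diagonal. -/
abbrev ZeroDiag (k : Fin 3 × Fin 3 → ℕ) : Prop := ∀ e, k (e, e) = 0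

lemma prod_offDiag_pow (k : Fin 3 × Fin 3 → ℕ) :
    ∏ p, offDiag p.1 p.2 ^ k p = if ZeroDiag k then 1 else 0 := by
  split_ifs with h
  · refine prod_eq_one fun p _ => ?_
    obtain ⟨s, t⟩ := p
    by_cases hst : s = t
    · subst hst; simp [h s]
    · simp [offDiag, hst]
  · simp only [ZeroDiag, not_forall] at h
    obtain ⟨e, he⟩ := h
    exact prod_eq_zero (mem_univ (e, e)) (by simp [offDiag, he])

lemma prod_pairWeight_pow (D : Fin 3 → ℕ) (k : Fin 3 × Fin 3 → ℕ) :
    ∏ s, pairWeight s ^ (Sum.elim D k) s = if ZeroDiag k then 1 else 0 := by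
  rw [← prod_offDiag_pow, Fintype.prod_sum_type]
  simp [pairWeight, offDiag]

/-- The number of vertices that are not covered by the colour `e`. -/
def restSum (D : Fin 3 → ℕ) (k : Fin 3 × Fin 3 → ℕ) (e : Fin 3) : ℕ :=
  (∑ s, if s = e then 0 else D s) + ∑ p : Fin 3 × Fin 3, if p.1 = e ∨ p.2 = e then 0 else k p

lemma classSum_pairClass (D : Fin 3 → ℕ) {k : Fin 3 × Fin 3 → ℕ} (hk : ZeroDiag k) (e : Fin 3) :
    classSum (pairClass e) (true, true) (Sum.elim D k) = D e ∧
    classSum (pairClass e) (true, false) (Sum.elim D k) = rowSum k e ∧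
    classSum (pairClass e) (false, true) (Sum.elim D k) = colSum k e ∧
    classSum (pairClass e) (false, false) (Sum.elim D k) = restSum D k e := by
  have h0 := hk 0
  have h1 := hk 1
  have h2 := hk 2
  fin_cases e <;>
  simp [classSum, pairClass, Fintype.sum_sum_type, Fintype.sum_prod_type, Fin.sum_univ_three,
    rowSum, colSum, restSum, h0, h1, h2]

lemma restSum_add (D : Fin 3 → ℕ) {k : Fin 3 × Fin 3 → ℕ} (hk : ZeroDiag k) (e : Fin 3) :
    restSum D k e + D e + rowSum k e + colSum k e = ∑ s, D s + ∑ p, k p := by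
  have h0 := hk 0
  have h1 := hk 1
  have h2 := hk 2
  fin_cases e <;>
  simp [Fintype.sum_prod_type, Fin.sum_univ_three, rowSum, colSum, restSum, h0, h1, h2] <;>
  omega

lemma sum_restSum (D : Fin 3 → ℕ) {k : Fin 3 × Fin 3 → ℕ} (hk : ZeroDiag k) :
    ∑ e, restSum D k e = 2 * ∑ s, D s + ∑ p, k p := by
  have h0 := hk 0
  have h1 := hk 1
  have h2 := hk 2
  simp [Fintype.sum_prod_type, Fin.sum_univ_three, restSum, h0, h1, h2]
  omega

/-- A vertex with common colour `e` is missed by both matchings in the two other colours. A vertex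
with colours `s ≠ t` is missed only in the third colour, which is `-(s + t)` modulo `3`. -/
lemma prod_pow_restSum (x : Fin 3 → ℝ) (D : Fin 3 → ℕ) {k : Fin 3 × Fin 3 → ℕ}
    (hk : ZeroDiag k) :
    ∏ e, x e ^ restSum D k e = (∏ e, (x (e + 1) * x (e + 2)) ^ D e) *
      ∏ p : Fin 3 × Fin 3, thirdMat x p.1 p.2 ^ k p := by
  have h0 := hk 0
  have h1 := hk 1
  have h2 := hk 2
  have e1 : (-1 : Fin 3) = 2 := by decide
  have e2 : (-2 : Fin 3) = 1 := by decide
  have e3 : (2 + 1 : Fin 3) = 0 := by decide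
  have e4 : (1 + 2 : Fin 3) = 0 := by decide
  have e5 : (2 + 2 : Fin 3) = 1 := by decide
  have e6 : (1 + 1 : Fin 3) = 2 := by decide
  simp [Fintype.sum_prod_type, Fintype.prod_prod_type, Fin.sum_univ_three, Fin.prod_univ_three,
    restSum, thirdMat, h0, h1, h2, e1, e2, e3, e4, e5, e6, pow_add, mul_pow]
  ring

/-- The contribution of the tables with given margins to the second moment. -/
lemma multinomial_sumElim (D : Fin 3 → ℕ) (k : Fin 3 × Fin 3 → ℕ) {n : ℕ}
    (h : ∑ s, D s + ∑ p, k p = n) :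
    (Nat.multinomial univ (Sum.elim D k) : ℝ) =
      n.factorial / ((∏ s, ((D s).factorial : ℝ)) * ∏ p, ((k p).factorial : ℝ)) := by
  have h2 := Nat.multinomial_spec univ (Sum.elim D k)
  rw [Fintype.sum_sum_type, Fintype.prod_sum_type] at h2
  simp only [Sum.elim_inl, Sum.elim_inr, h] at h2
  rw [← h2]
  have h3 : (∏ s, ((D s).factorial : ℝ)) ≠ 0 := prod_ne_zero_iff.2 fun e _ => by positivity
  have h4 : (∏ p, ((k p).factorial : ℝ)) ≠ 0 := prod_ne_zero_iff.2 fun e _ => by positivity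
  push_cast
  field_simp

/-- Each of the four classes must have equal sizes on both sides. The size of the class that both
matchings miss follows from the total `n`, so the remaining conditions concern `D` and the two
margins. -/
lemma prod_pairClass {n : ℕ} (D D' : Fin 3 → ℕ) {k m : Fin 3 × Fin 3 → ℕ} (hk : ZeroDiag k)
    (hm : ZeroDiag m) (hDk : ∑ s, D s + ∑ p, k p = n) (hDm : ∑ s, D' s + ∑ p, m p = n) :
    (∏ e, if ∀ t, classSum (pairClass e) t (Sum.elim D k) =
      classSum (pairClass e) t (Sum.elim D' m) then
        ∏ t, ((classSum (pairClass e) t (Sum.elim D k)).factorial : ℝ) else 0) =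
      if D = D' ∧ rowSum k = rowSum m ∧ colSum k = colSum m then
        (∏ e, ((D e).factorial : ℝ)) * (∏ e, ((rowSum k e).factorial : ℝ)) *
        (∏ e, ((colSum k e).factorial : ℝ)) * ∏ e, ((restSum D k e).factorial : ℝ) else 0 := by
  have hiff : ∀ e, (∀ t, classSum (pairClass e) t (Sum.elim D k) =
      classSum (pairClass e) t (Sum.elim D' m)) ↔
      D e = D' e ∧ rowSum k e = rowSum m e ∧ colSum k e = colSum m e := fun e => by
    obtain ⟨a1, a2, a3, a4⟩ := classSum_pairClass D hk e
    obtain ⟨b1, b2, b3, b4⟩ := classSum_pairClass D' hm e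
    have hr := restSum_add D hk e
    have hr' := restSum_add D' hm e
    simp only [Prod.forall, Bool.forall_bool, a1, a2, a3, a4, b1, b2, b3, b4]
    constructor
    · rintro ⟨⟨_, h1⟩, h2, h3⟩; exact ⟨h3, h2, h1⟩
    · rintro ⟨h1, h2, h3⟩
      exact ⟨⟨by omega, h3⟩, h2, h1⟩
  split_ifs with h
  · obtain ⟨h1, h2, h3⟩ := h
    rw [← prod_mul_distrib, ← prod_mul_distrib, ← prod_mul_distrib]
    refine prod_congr rfl fun e _ => ?_
    rw [if_pos ((hiff e).2 ⟨congrFun h1 e, congrFun h2 e, congrFun h3 e⟩)]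
    obtain ⟨a1, a2, a3, a4⟩ := classSum_pairClass D hk e
    rw [Fintype.prod_prod_type, Fintype.prod_bool, Fintype.prod_bool, Fintype.prod_bool,
      a1, a2, a3, a4]
    ring
  · rw [prod_eq_zero_iff]
    by_contra! hne
    have h4 : ∀ e, D e = D' e ∧ rowSum k e = rowSum m e ∧ colSum k e = colSum m e := fun e => by
      have := hne e (mem_univ e)
      simp only [ne_eq, ite_eq_right_iff, not_forall, exists_prop] at this
      exact (hiff e).1 this.1
    exact h ⟨funext fun e => (h4 e).1, funext fun e => (h4 e).2.1, funext fun e => (h4 e).2.2⟩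

/-- One of the two factors `1 / ∏ D!` cancels against the factorials of the classes covered twice.
The row and column factorials are assigned to different tables, so that each table becomes a summand
of an entry of a symmetric power; the factorials of `restSum` are left for a Dirichlet integral. -/
lemma pair_summand {n : ℕ} (D D' : Fin 3 → ℕ) (k m : Fin 3 × Fin 3 → ℕ)
    (hDk : ∑ s, D s + ∑ p, k p = n) (hDm : ∑ s, D' s + ∑ p, m p = n) :
    (Nat.multinomial univ (Sum.elim D k) : ℝ) * (∏ s, pairWeight s ^ (Sum.elim D k) s) *
      ((Nat.multinomial univ (Sum.elim D' m) : ℝ) * (∏ s, pairWeight s ^ (Sum.elim D' m) s) *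
        ∏ e, if ∀ t, classSum (pairClass e) t (Sum.elim D k) =
          classSum (pairClass e) t (Sum.elim D' m) then
            ∏ t, ((classSum (pairClass e) t (Sum.elim D k)).factorial : ℝ) else 0) =
      if D = D' ∧ rowSum k = rowSum m ∧ colSum k = colSum m then
        (n.factorial : ℝ) ^ 2 * (((∏ s, ((rowSum k s).factorial : ℝ)) /
          (∏ p, ((k p).factorial : ℝ)) *
            if ZeroDiag k then ∏ e, ((restSum D k e).factorial : ℝ) else 0) *
          ((∏ s, ((colSum k s).factorial : ℝ)) / (∏ p, ((m p).factorial : ℝ)) *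
            ∏ p, offDiag p.1 p.2 ^ m p)) / ∏ e, ((D e).factorial : ℝ) else 0 := by
  rw [prod_pairWeight_pow, prod_pairWeight_pow, prod_offDiag_pow]
  by_cases hzk : ZeroDiag k
  · by_cases hzm : ZeroDiag m
    · rw [prod_pairClass D D' hzk hzm hDk hDm, multinomial_sumElim D k hDk,
        multinomial_sumElim D' m hDm, if_pos hzk, if_pos hzm, if_pos hzk]
      split_ifs with h
      · obtain ⟨rfl, -, -⟩ := h
        have h3 : (∏ s, ((D s).factorial : ℝ)) ≠ 0 :=
          prod_ne_zero_iff.2 fun e _ => by positivity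
        have h4 : (∏ p, ((k p).factorial : ℝ)) ≠ 0 :=
          prod_ne_zero_iff.2 fun e _ => by positivity
        have h5 : (∏ p, ((m p).factorial : ℝ)) ≠ 0 :=
          prod_ne_zero_iff.2 fun e _ => by positivity
        field_simp
      · ring
    · rw [if_neg hzm]; simp only [mul_zero, zero_mul, zero_div, ite_self]
  · simp only [if_neg hzk, mul_zero, zero_mul, zero_div, ite_self]

/-- The second elementary symmetric polynomial of the barycentric coordinates. -/
def esymmTwo (p : ℝ × ℝ) : ℝ := bary p 1 * bary p 2 + bary p 0 * bary p 2 + bary p 0 * bary p 1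

lemma integral_simplex_sum₃ {ι₁ ι₂ ι₃ : Type*} (s₁ : Finset ι₁) (s₂ : Finset ι₂) (s₃ : Finset ι₃)
    (a : ι₁ → ι₂ → ι₃ → ℝ) {g : ι₁ → ι₂ → ℝ × ℝ → ℝ} (hg : ∀ i j, Continuous (g i j)) :
    ∫ p in simplex, ∑ i ∈ s₁, ∑ j ∈ s₂, ∑ k ∈ s₃, a i j k * g i j p =
      ∑ i ∈ s₁, ∑ j ∈ s₂, ∑ k ∈ s₃, a i j k * ∫ p in simplex, g i j p := by
  have hg' : ∀ i j k, Continuous fun p => a i j k * g i j p := fun i j k =>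
    continuous_const.mul (hg i j)
  rw [integral_finsetSum _ fun i _ => integrableOn_simplex (continuous_finsetSum _ fun j _ =>
    continuous_finsetSum _ fun k _ => hg' i j k)]
  refine sum_congr rfl fun i _ => ?_
  rw [integral_finsetSum _ fun j _ => integrableOn_simplex (
    continuous_finsetSum _ fun k _ => hg' i j k)]
  refine sum_congr rfl fun j _ => ?_
  rw [integral_finsetSum _ fun k _ => integrableOn_simplex (hg' i j k)]
  simp_rw [integral_const_mul]

/-- The number of triples of a lift and two of its perfect matchings. -/
lemma sum_card_model_cover₂ {n : ℕ} :
    ∑ τ : Vert n → Fin 3, ∑ τ' : Vert n → Fin 3, ((model (cover₂ τ τ')).card : ℝ) =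
      (n.factorial : ℝ) ^ 2 * ∑ q ∈ antidiagonal n, ((n + q.1 + 2).factorial : ℝ) /
        q.1.factorial * ∫ p in simplex, esymmTwo p ^ q.1 *
          (symPow q.2 (thirdMat (bary p) * offDiag)).trace := by
  rw [sum_cover₂]
  have h := sum_card_model (n := n) pairClass pairWeight fun _ => 1
  simp only [mul_one, one_mul] at h
  rw [h, sum_piAntidiag_sum, mul_sum]
  refine sum_congr rfl fun q hq => ?_
  have hq' := HasAntidiagonal.mem_antidiagonal.1 hq
  -- the summand for a given table on each side
  have hterm : ∀ D ∈ piAntidiag (univ : Finset (Fin 3)) q.1,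
      ∀ k ∈ piAntidiag (univ : Finset (Fin 3 × Fin 3)) q.2,
      ∑ m ∈ piAntidiag univ n, (Nat.multinomial univ (Sum.elim D k) : ℝ) *
        (∏ s, pairWeight s ^ (Sum.elim D k) s) * ((Nat.multinomial univ m : ℝ) *
          (∏ s, pairWeight s ^ m s) * ∏ e, if ∀ t, classSum (pairClass e) t (Sum.elim D k) =
            classSum (pairClass e) t m then
              ∏ t, ((classSum (pairClass e) t (Sum.elim D k)).factorial : ℝ) else 0) =
      (n.factorial : ℝ) ^ 2 * (∑ m ∈ piAntidiag (univ : Finset (Fin 3 × Fin 3)) q.2,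
        if rowSum k = rowSum m ∧ colSum k = colSum m then
          ((∏ s, ((rowSum k s).factorial : ℝ)) / (∏ p, ((k p).factorial : ℝ)) *
            if ZeroDiag k then ∏ e, ((restSum D k e).factorial : ℝ) else 0) *
          ((∏ s, ((colSum k s).factorial : ℝ)) / (∏ p, ((m p).factorial : ℝ)) *
            ∏ p, offDiag p.1 p.2 ^ m p) else 0) / ∏ e, ((D e).factorial : ℝ) := by
    intro D hD k hk
    have hD' : ∑ s, D s = q.1 := (mem_piAntidiag.1 hD).1
    have hk' : ∑ p, k p = q.2 := (mem_piAntidiag.1 hk).1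
    have hDk : ∑ s, D s + ∑ p, k p = n := by omega
    rw [sum_piAntidiag_sum, sum_eq_single q, sum_eq_single D, mul_sum, sum_div]
    · refine sum_congr rfl fun m hm => ?_
      have hm' : ∑ p, m p = q.2 := (mem_piAntidiag.1 hm).1
      rw [pair_summand D D k m hDk (by omega)]
      simp only [true_and]
      by_cases h : rowSum k = rowSum m ∧ colSum k = colSum m
      · rw [if_pos h, if_pos h]
      · rw [if_neg h, if_neg h, mul_zero, zero_div]
    · intro D' hD1 hD2
      refine sum_eq_zero fun m hm => ?_
      have hm' : ∑ p, m p = q.2 := (mem_piAntidiag.1 hm).1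
      have hD1' : ∑ s, D' s = q.1 := (mem_piAntidiag.1 hD1).1
      rw [pair_summand D D' k m hDk (by omega), if_neg fun h => hD2 h.1.symm]
    · exact fun h => absurd hD h
    · intro q' hq1 hq2
      refine sum_eq_zero fun D' hD1 => sum_eq_zero fun m hm => ?_
      have hm' : ∑ p, m p = q'.2 := (mem_piAntidiag.1 hm).1
      have hD1' : ∑ s, D' s = q'.1 := (mem_piAntidiag.1 hD1).1
      have hq1' := HasAntidiagonal.mem_antidiagonal.1 hq1
      rw [pair_summand D D' k m hDk (by omega), if_neg]
      rintro ⟨rfl, -⟩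
      refine hq2 ?_
      ext <;> omega
    · exact fun h => absurd hq h
  rw [sum_congr rfl fun D hD => sum_congr rfl fun k hk => hterm D hD k hk]
  -- The numbers `restSum` add up to `2 * q.1 + q.2 = n + q.1`. Under the Dirichlet integral their
  -- factorials split into a factor for `D` and a factor for the table.
  have hrest : ∀ D ∈ piAntidiag (univ : Finset (Fin 3)) q.1,
      ∀ k ∈ piAntidiag (univ : Finset (Fin 3 × Fin 3)) q.2,
      (if ZeroDiag k then ∏ e, ((restSum D k e).factorial : ℝ) else 0) =
      (n + q.1 + 2).factorial * ∫ p in simplex, (∏ e, (bary p (e + 1) * bary p (e + 2)) ^ D e) *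
        ∏ s : Fin 3 × Fin 3, thirdMat (bary p) s.1 s.2 ^ k s := by
    intro D hD k hk
    split_ifs with hz
    · rw [prod_factorial_eq_integral, sum_restSum D hz, (mem_piAntidiag.1 hD).1,
        (mem_piAntidiag.1 hk).1, show 2 * q.1 + q.2 = n + q.1 by omega]
      simp_rw [prod_pow_restSum _ D hz]
    · simp only [ZeroDiag, not_forall] at hz
      obtain ⟨e, he⟩ := hz
      have : ∀ p, ∏ s : Fin 3 × Fin 3, thirdMat (bary p) s.1 s.2 ^ k s = 0 := fun p =>
        prod_eq_zero (mem_univ (e, e)) (by simp [thirdMat, he])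
      simp [this]
  have hcont : ∀ s t, Continuous fun p => thirdMat (bary p) s t := fun s t => by
    simp only [thirdMat, Matrix.of_apply]
    split_ifs <;> fun_prop
  -- The multinomial expansion of `esymmTwo p ^ q.1` and the table formula for the trace reproduce
  -- these summands term by term.
  have hexp : ∀ p, esymmTwo p ^ q.1 * (symPow q.2 (thirdMat (bary p) * offDiag)).trace =
      ∑ D ∈ piAntidiag (univ : Finset (Fin 3)) q.1,
      ∑ k ∈ piAntidiag (univ : Finset (Fin 3 × Fin 3)) q.2,
      ∑ m ∈ piAntidiag (univ : Finset (Fin 3 × Fin 3)) q.2,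
      (if rowSum k = rowSum m ∧ colSum k = colSum m then
          (q.1.factorial / ∏ e, ((D e).factorial : ℝ)) *
          ((∏ s, ((rowSum k s).factorial : ℝ)) / (∏ p, ((k p).factorial : ℝ))) *
          ((∏ s, ((colSum k s).factorial : ℝ)) / (∏ p, ((m p).factorial : ℝ)) *
            ∏ p, offDiag p.1 p.2 ^ m p) else 0) *
        ((∏ e, (bary p (e + 1) * bary p (e + 2)) ^ D e) *
        ∏ s : Fin 3 × Fin 3, thirdMat (bary p) s.1 s.2 ^ k s) := fun p => by
    rw [trace_symPow_mul_symPow _ _ _ offDiag_isSymm]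
    have he : esymmTwo p = ∑ e, bary p (e + 1) * bary p (e + 2) := by
      rw [Fin.sum_univ_three]
      have e3 : (2 + 1 : Fin 3) = 0 := by decide
      have e4 : (1 + 2 : Fin 3) = 0 := by decide
      have e5 : (2 + 2 : Fin 3) = 1 := by decide
      have e6 : (1 + 1 : Fin 3) = 2 := by decide
      simp only [esymmTwo, zero_add, e3, e4, e5, e6]
      ring
    rw [he, sum_pow_eq_sum_piAntidiag, sum_mul]
    refine sum_congr rfl fun D hD => ?_
    have h2 := Nat.multinomial_spec univ D
    rw [(mem_piAntidiag.1 hD).1] at h2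
    have h3 : (∏ s, ((D s).factorial : ℝ)) ≠ 0 := prod_ne_zero_iff.2 fun e _ => by positivity
    rw [mul_sum]
    refine sum_congr rfl fun k _ => ?_
    rw [mul_sum]
    refine sum_congr rfl fun m _ => ?_
    split_ifs
    · rw [← h2]
      push_cast
      field_simp
    · simp
  simp_rw [hexp]
  have hc2 : ∀ (D : Fin 3 → ℕ) (k : Fin 3 × Fin 3 → ℕ), Continuous fun p =>
      (∏ e, (bary p (e + 1) * bary p (e + 2)) ^ D e) *
        ∏ s : Fin 3 × Fin 3, thirdMat (bary p) s.1 s.2 ^ k s := fun D k =>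
    (continuous_finsetProd _ fun e _ => by fun_prop).mul
      (continuous_finsetProd _ fun s _ => (hcont _ _).pow _)
  rw [integral_simplex_sum₃ _ _ _ _ hc2, mul_sum, mul_sum]
  refine sum_congr rfl fun D hD => ?_
  rw [mul_sum, mul_sum]
  refine sum_congr rfl fun k hk => ?_
  rw [mul_div_assoc, sum_div, mul_sum, mul_sum, mul_sum]
  refine sum_congr rfl fun m _ => ?_
  rw [hrest D hD k hk]
  split_ifs
  · have : (q.1.factorial : ℝ) ≠ 0 := by positivity
    field_simp
  · simp

end RandomLift

/-! ### Traces of symmetric powers in terms of eigenvalues. -/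

namespace SymmetricPower

open Finset

/-- The trace of a symmetric power of a square of a real symmetric matrix, by eigenvalues. -/
lemma exists_eigenvalues {C : Matrix (Fin 3) (Fin 3) ℝ} (hC : C.IsHermitian) :
    ∃ β : Fin 3 → ℝ, (∀ s, β s ^ 2 ≤ β 0 ^ 2) ∧ ∑ s, β s = C.trace ∧
      ∑ s, β s ^ 2 = (C * C).trace ∧ ∏ s, β s = C.det ∧
      ∀ N, (symPow N (C * C)).trace =
        ∑ r ∈ piAntidiag (univ : Finset (Fin 3)) N, ∏ s, (β s ^ 2) ^ r s := by
  set U : Matrix (Fin 3) (Fin 3) ℝ := hC.eigenvectorUnitary.1 with hU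
  set γ := hC.eigenvalues with hγ
  have hUU : star U * U = 1 := by
    rw [hU]; exact Unitary.coe_star_mul_self hC.eigenvectorUnitary
  have hUU' : U * star U = 1 := mul_eq_one_comm.1 hUU
  have hspec : C = U * Matrix.diagonal γ * star U := by
    have := hC.spectral_theorem
    rw [Unitary.conjStarAlgAut_apply] at this
    simpa using this
  have hsq : star U * (C * C) = Matrix.diagonal (fun s => γ s ^ 2) * star U := by
    have h2 : Matrix.diagonal (fun s => γ s ^ 2) = Matrix.diagonal γ * Matrix.diagonal γ := by
      rw [Matrix.diagonal_mul_diagonal]; simp only [sq]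
    rw [h2]
    conv_lhs => rw [hspec]
    calc star U * (U * Matrix.diagonal γ * star U * (U * Matrix.diagonal γ * star U))
        = (star U * U) * Matrix.diagonal γ * (star U * U) * Matrix.diagonal γ * star U := by
          simp only [mul_assoc]
      _ = _ := by rw [hUU]; simp only [one_mul, mul_one, mul_assoc]
  -- The eigenvalues are permuted so that index `0` carries the largest square.
  obtain ⟨i, -, hi⟩ := exists_max_image univ (fun s => γ s ^ 2) ⟨0, mem_univ _⟩
  let π : Equiv.Perm (Fin 3) := Equiv.swap 0 i
  refine ⟨fun s => γ (π s), fun s => ?_, ?_, ?_, ?_, fun N => ?_⟩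
  · have : π 0 = i := by simp [π]
    simp only [this]
    exact hi _ (mem_univ _)
  · rw [Equiv.sum_comp π γ, hC.trace_eq_sum_eigenvalues]; simp [hγ]
  · rw [Equiv.sum_comp π fun s => γ s ^ 2]
    have : C * C = U * (Matrix.diagonal (fun s => γ s ^ 2) * star U) := by
      rw [← hsq, ← mul_assoc, hUU', one_mul]
    rw [this, Matrix.trace_mul_comm, mul_assoc, hUU, mul_one, Matrix.trace_diagonal]
  · rw [Equiv.prod_comp π γ, hC.det_eq_prod_eigenvalues]; simp [hγ]
  · rw [trace_symPow_eq_of_mul_eq N hUU hsq, trace_symPow_diagonal]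
    refine sum_nbij' (fun r s => r (π s)) (fun r s => r (π.symm s)) ?_ ?_ ?_ ?_ ?_
    · intro r hr
      rw [mem_piAntidiag] at hr ⊢
      exact ⟨by rw [← hr.1]; exact Equiv.sum_comp π r, by simp⟩
    · intro r hr
      rw [mem_piAntidiag] at hr ⊢
      exact ⟨by rw [← hr.1]; exact Equiv.sum_comp π.symm r, by simp⟩
    · intro r _; simp
    · intro r _; simp
    · intro r _
      exact (Equiv.prod_comp π fun s => (γ s ^ 2) ^ r s).symm

lemma card_piAntidiag_le (N : ℕ) : (piAntidiag (univ : Finset (Fin 3)) N).card ≤ (N + 1) ^ 2 := by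
  rw [sq, ← card_range (N + 1), ← card_product]
  refine card_le_card_of_injOn (fun r => (r 1, r 2)) ?_ ?_
  · intro r hr
    have := (mem_piAntidiag.1 hr).1
    rw [Fin.sum_univ_three] at this
    simp only [coe_product, Set.mem_prod, mem_coe, mem_range]
    simp
    omega
  · intro r hr r' hr' h
    have h1 := (mem_piAntidiag.1 hr).1
    have h2 := (mem_piAntidiag.1 hr').1
    rw [Fin.sum_univ_three] at h1 h2
    simp only [Prod.mk.injEq] at h
    ext s
    fin_cases s <;> simp <;> omega

/-- A crude bound that needs no spectral gap. Its polynomial loss is harmless away from the centre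
of the triangle, where the integrand is exponentially small. -/
lemma sum_piAntidiag_le (N : ℕ) (γ : Fin 3 → ℝ) (h0 : ∀ s, 0 ≤ γ s) (h : ∀ s, γ s ≤ γ 0) :
    ∑ r ∈ piAntidiag (univ : Finset (Fin 3)) N, ∏ s, γ s ^ r s ≤ (N + 1) ^ 2 * γ 0 ^ N := by
  calc _ ≤ ∑ r ∈ piAntidiag (univ : Finset (Fin 3)) N, γ 0 ^ N := by
        refine sum_le_sum fun r hr => ?_
        rw [← (mem_piAntidiag.1 hr).1, ← prod_pow_eq_pow_sum]
        exact prod_le_prod (fun s _ => pow_nonneg (h0 s) _)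
          fun s _ => pow_le_pow_left₀ (h0 s) (h s) _
    _ ≤ _ := by
        rw [sum_const, nsmul_eq_mul]
        refine mul_le_mul_of_nonneg_right ?_ (pow_nonneg (h0 0) _)
        exact_mod_cast card_piAntidiag_le N

lemma geom_sum_le_inv {u : ℝ} (h1 : u < 1) (h0 : 0 ≤ u) (N : ℕ) :
    ∑ i ∈ range N, u ^ i ≤ (1 - u)⁻¹ := by
  rw [← one_div, le_div_iff₀ (by linarith), geom_sum_mul_neg]
  linarith [pow_nonneg h0 N]

/-- With a spectral gap the sum is at most its leading term times two geometric series. This is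
sharp to leading order, as the exact constant of the second moment requires. -/
lemma sum_piAntidiag_le' (N : ℕ) (γ : Fin 3 → ℝ) (h0 : ∀ s, 0 ≤ γ s) (h1 : γ 1 < γ 0)
    (h2 : γ 2 < γ 0) :
    ∑ r ∈ piAntidiag (univ : Finset (Fin 3)) N, ∏ s, γ s ^ r s ≤
      γ 0 ^ N * ((1 - γ 1 / γ 0)⁻¹ * (1 - γ 2 / γ 0)⁻¹) := by
  have hpos : 0 < γ 0 := (h0 1).trans_lt h1
  have hu : γ 1 / γ 0 < 1 := (div_lt_one hpos).2 h1
  have hv : γ 2 / γ 0 < 1 := (div_lt_one hpos).2 h2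
  have hu0 : 0 ≤ γ 1 / γ 0 := div_nonneg (h0 1) hpos.le
  have hv0 : 0 ≤ γ 2 / γ 0 := div_nonneg (h0 2) hpos.le
  calc _ = γ 0 ^ N * ∑ r ∈ piAntidiag (univ : Finset (Fin 3)) N,
        (γ 1 / γ 0) ^ r 1 * (γ 2 / γ 0) ^ r 2 := by
        rw [mul_sum]
        refine sum_congr rfl fun r hr => ?_
        rw [← (mem_piAntidiag.1 hr).1, Fin.prod_univ_three, Fin.sum_univ_three, pow_add, pow_add,
          div_pow, div_pow]
        field_simp
    _ ≤ γ 0 ^ N * ∑ q ∈ range (N + 1) ×ˢ range (N + 1),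
        (γ 1 / γ 0) ^ q.1 * (γ 2 / γ 0) ^ q.2 := by
        refine mul_le_mul_of_nonneg_left ?_ (pow_nonneg hpos.le _)
        have hinj : Set.InjOn (fun r : Fin 3 → ℕ => (r 1, r 2))
            (piAntidiag (univ : Finset (Fin 3)) N : Set (Fin 3 → ℕ)) := by
          intro r hr r' hr' h
          have h1 := (mem_piAntidiag.1 hr).1
          have h2 := (mem_piAntidiag.1 hr').1
          rw [Fin.sum_univ_three] at h1 h2
          simp only [Prod.mk.injEq] at h
          ext s
          fin_cases s <;> simp <;> omega
        rw [← sum_image (f := fun q : ℕ × ℕ => (γ 1 / γ 0) ^ q.1 * (γ 2 / γ 0) ^ q.2) hinj]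
        refine sum_le_sum_of_subset_of_nonneg ?_ fun q _ _ =>
          mul_nonneg (pow_nonneg hu0 _) (pow_nonneg hv0 _)
        intro q hq
        obtain ⟨r, hr, rfl⟩ := mem_image.1 hq
        have := (mem_piAntidiag.1 hr).1
        rw [Fin.sum_univ_three] at this
        simp only [mem_product, mem_range]
        omega
    _ ≤ _ := by
        rw [sum_product, ← sum_mul_sum]
        refine mul_le_mul_of_nonneg_left ?_ (pow_nonneg hpos.le _)
        exact mul_le_mul (geom_sum_le_inv hu hu0 _) (geom_sum_le_inv hv hv0 _)
          (sum_nonneg fun i _ => pow_nonneg hv0 _) (inv_nonneg.2 (by linarith))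

end SymmetricPower

/-! ### The eigenvalues of the second moment matrix. -/

namespace RandomLift

open Finset SymmetricPower

/-- The symmetric square root that is similar to `thirdMat (bary p) * offDiag`. -/
lemma exists_eigenvalues_thirdMat {x : Fin 3 → ℝ} (hx : ∀ e, 0 < x e) (hsum : ∑ e, x e = 1) :
    ∃ β : Fin 3 → ℝ, (∀ s, β s ^ 2 ≤ β 0 ^ 2) ∧ ∑ s, β s = 0 ∧ ∑ s, β s ^ 2 = 2 ∧
      (∏ s, β s) ^ 2 = 4 * ∏ e, x e ∧
      ∀ N, (symPow N (thirdMat x * offDiag)).trace =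
        ∑ r ∈ piAntidiag (univ : Finset (Fin 3)) N, ∏ s, (β s ^ 2) ^ r s := by
  let a := √(x 0)
  let b := √(x 1)
  let c := √(x 2)
  have ha : a ^ 2 = x 0 := Real.sq_sqrt (hx 0).le
  have hb : b ^ 2 = x 1 := Real.sq_sqrt (hx 1).le
  have hc : c ^ 2 = x 2 := Real.sq_sqrt (hx 2).le
  have ha0 : a ≠ 0 := (Real.sqrt_pos.2 (hx 0)).ne'
  have hb0 : b ≠ 0 := (Real.sqrt_pos.2 (hx 1)).ne'
  have hc0 : c ≠ 0 := (Real.sqrt_pos.2 (hx 2)).ne'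
  -- Off the diagonal, `thirdMat x s t` is `x 0 * x 1 * x 2 / (x s * x t)`. So conjugation by the
  -- diagonal matrix of the square roots turns `thirdMat x * offDiag` into `C * C`, where the
  -- entries of `C` are the square roots of the third coordinates.
  let C : Matrix (Fin 3) (Fin 3) ℝ := !![0, c, b; c, 0, a; b, a, 0]
  let D : Matrix (Fin 3) (Fin 3) ℝ := !![a, 0, 0; 0, b, 0; 0, 0, c]
  let D' : Matrix (Fin 3) (Fin 3) ℝ := !![a⁻¹, 0, 0; 0, b⁻¹, 0; 0, 0, c⁻¹]
  have hC : C.IsHermitian := by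
    ext i j
    fin_cases i <;> fin_cases j <;> simp [C]
  have hthird : thirdMat x = !![0, c ^ 2, b ^ 2; c ^ 2, 0, a ^ 2; b ^ 2, a ^ 2, 0] := by
    rw [ha, hb, hc]
    ext i j
    fin_cases i <;> fin_cases j <;> simp [thirdMat] <;> rfl
  have hoff : offDiag = !![0, 1, 1; 1, 0, 1; 1, 1, 0] := by
    ext i j
    fin_cases i <;> fin_cases j <;> simp [offDiag]
  have hDD' : D * D' = 1 := by
    ext i j
    fin_cases i <;> fin_cases j <;> simp [D, D', Matrix.mul_apply, Fin.sum_univ_three, *]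
  have hsim : D * (thirdMat x * offDiag) = C * C * D := by
    rw [hthird, hoff]
    ext i j
    fin_cases i <;> fin_cases j <;>
      simp [D, C, Matrix.mul_apply, Fin.sum_univ_three] <;> ring
  obtain ⟨β, h1, h2, h3, h4, h5⟩ := exists_eigenvalues hC
  refine ⟨β, h1, ?_, ?_, ?_, fun N => ?_⟩
  · rw [h2]; simp [C, Matrix.trace, Fin.sum_univ_three]
  · rw [h3]
    rw [Fin.sum_univ_three] at hsum
    simp only [C, Matrix.trace, Matrix.diag_apply, Matrix.mul_apply, Fin.sum_univ_three]
    simp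
    linear_combination 2 * hsum + 2 * ha + 2 * hb + 2 * hc
  · rw [h4, Matrix.det_fin_three, Fin.prod_univ_three, ← ha, ← hb, ← hc]
    simp [C]
    ring
  · rw [trace_symPow_eq_of_mul_eq N hDD' hsim, h5]

/-- The third elementary symmetric polynomial of the barycentric coordinates. -/
def esymmThree (p : ℝ × ℝ) : ℝ := bary p 0 * bary p 1 * bary p 2

/-- With `ρ = β 0 ^ 2` the characteristic equation of the square root reads `ρ (ρ - 1)² = 4 *
esymmThree p`. The largest root lies in `[1, 4/3]` and equals `4/3` only for `esymmThree p = 1/27`,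
at the centre. The first bound ignores the spectral gap; the second uses it, and its prefactor is
`16/9` at the centre. -/
lemma trace_symPow_bounds {p : ℝ × ℝ} (hp : ∀ e, 0 < bary p e) (N : ℕ) :
    (symPow N (thirdMat (bary p) * offDiag)).trace ≤
        (N + 1) ^ 2 * ((4 / 3) ^ N * Real.exp (3 * N * (esymmThree p - 1 / 27))) ∧
    (symPow N (thirdMat (bary p) * offDiag)).trace ≤
        16 / 9 / ((2 + 3 * √(3 * esymmThree p)) * √(3 * esymmThree p)) *
          ((4 / 3) ^ N * Real.exp (3 * N * (esymmThree p - 1 / 27))) := by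
  have hsum : ∑ e, bary p e = 1 := by simp [Fin.sum_univ_three]
  have he3 : 0 < esymmThree p := mul_pos (mul_pos (hp 0) (hp 1)) (hp 2)
  obtain ⟨β, h1, h2, h3, h4, h5⟩ := exists_eigenvalues_thirdMat hp hsum
  rw [Fin.prod_univ_three, Fin.prod_univ_three] at h4
  rw [Fin.sum_univ_three] at h2 h3
  change _ = 4 * esymmThree p at h4
  set e3 := esymmThree p with he3def
  have hb1 := h1 1
  have hb2 := h1 2
  set x := β 0
  set y := β 1
  set z := β 2
  have hyz : y * z = x ^ 2 - 1 := by
    have : y + z = -x := by linarith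
    have h6 : (y + z) ^ 2 = x ^ 2 := by rw [this]; ring
    linarith [h6, h3, sq_nonneg (y + z), show (y + z) ^ 2 = y ^ 2 + z ^ 2 + 2 * (y * z) by ring]
  have hcub : x ^ 2 * (x ^ 2 - 1) ^ 2 = 4 * e3 := by
    rw [← h4, ← hyz]; ring
  have hle : x ^ 2 ≤ 4 / 3 := by
    have := sq_nonneg (y - z)
    nlinarith
  -- If all squares were below `1`, the three pairwise products would be negative, although their
  -- product is the square of `x * y * z`.
  have hge : 1 ≤ x ^ 2 := by
    by_contra! hlt
    have hxz : x * z = y ^ 2 - 1 := by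
      have h6 : x + z = -y := by linarith
      have h7 : (x + z) ^ 2 = y ^ 2 := by rw [h6]; ring
      linarith [show (x + z) ^ 2 = x ^ 2 + z ^ 2 + 2 * (x * z) by ring]
    have hxy : x * y = z ^ 2 - 1 := by
      have h6 : x + y = -z := by linarith
      have h7 : (x + y) ^ 2 = z ^ 2 := by rw [h6]; ring
      linarith [show (x + y) ^ 2 = x ^ 2 + y ^ 2 + 2 * (x * y) by ring]
    have a1 : y * z < 0 := by linarith
    have a2 : x * z < 0 := by linarith
    have a3 : x * y < 0 := by linarith
    have a4 : (y * z) * (x * z) * (x * y) < 0 := mul_neg_of_pos_of_neg (mul_pos_of_neg_of_neg a1 a2) a3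
    nlinarith [sq_nonneg (x * y * z)]
  -- The tangent at `ρ = 4/3`, where `ρ (ρ - 1)²` has slope `1`; the remainder is `(ρ - 4/3)² (ρ +
  -- 2/3)`.
  have hrho : x ^ 2 ≤ 4 / 3 * (1 + 3 * (e3 - 1 / 27)) := by
    nlinarith [mul_nonneg (sq_nonneg (x ^ 2 - 4 / 3)) (by positivity : 0 ≤ x ^ 2 + 2 / 3)]
  have hpow : (x ^ 2) ^ N ≤ (4 / 3) ^ N * Real.exp (3 * N * (e3 - 1 / 27)) := by
    calc (x ^ 2) ^ N ≤ (4 / 3 * Real.exp (3 * (e3 - 1 / 27))) ^ N := by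
          refine pow_le_pow_left₀ (sq_nonneg x) (hrho.trans ?_) N
          have := Real.add_one_le_exp (3 * (e3 - 1 / 27))
          linarith
      _ = _ := by
          rw [mul_pow, ← Real.exp_nat_mul]
          congr 2
          ring
  constructor
  · rw [h5]
    refine (sum_piAntidiag_le N _ (fun s => sq_nonneg _) h1).trans ?_
    exact mul_le_mul_of_nonneg_left hpow (by positivity)
  · have hs0 : 0 < √(3 * e3) := Real.sqrt_pos.2 (by positivity)
    -- From `ρ ≤ 4/3`: `3 * e3 = (3/4) ρ (ρ - 1)² ≤ (ρ - 1)²`.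
    have hs : √(3 * e3) ≤ x ^ 2 - 1 := by
      rw [Real.sqrt_le_left (by linarith)]
      nlinarith [mul_nonneg (sub_nonneg.2 hle) (sq_nonneg (x ^ 2 - 1))]
    have hgt : 1 < x ^ 2 := by linarith
    have hprod : (x ^ 2 - y ^ 2) * (x ^ 2 - z ^ 2) = (3 * x ^ 2 - 1) * (x ^ 2 - 1) := by
      have : (y * z) ^ 2 = (x ^ 2 - 1) ^ 2 := by rw [hyz]
      nlinarith
    have hprod0 : 0 < (x ^ 2 - y ^ 2) * (x ^ 2 - z ^ 2) := by
      rw [hprod]; exact mul_pos (by linarith) (by linarith)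
    have hy : y ^ 2 < x ^ 2 := by
      refine lt_of_le_of_ne hb1 fun h => ?_
      rw [h, sub_self, zero_mul] at hprod0
      exact lt_irrefl _ hprod0
    have hz : z ^ 2 < x ^ 2 := by
      refine lt_of_le_of_ne hb2 fun h => ?_
      rw [h, sub_self, mul_zero] at hprod0
      exact lt_irrefl _ hprod0
    rw [h5]
    refine (sum_piAntidiag_le' N _ (fun s => sq_nonneg _) hy hz).trans ?_
    rw [mul_comm]
    refine mul_le_mul ?_ hpow (by positivity) (by positivity)
    change (1 - y ^ 2 / x ^ 2)⁻¹ * (1 - z ^ 2 / x ^ 2)⁻¹ ≤ _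
    have hx0 : x ^ 2 ≠ 0 := by positivity
    rw [one_sub_div hx0, one_sub_div hx0, inv_div, inv_div, div_mul_div_comm, hprod]
    refine div_le_div₀ (by norm_num) (by nlinarith) (by positivity) ?_
    exact mul_le_mul (by linarith) hs hs0.le (by linarith)

end RandomLift

/-! ### Laplace's method on the triangle. -/

namespace RandomLift

open SymmetricPower

/-- Half the squared distance of the barycentric coordinates from the centre. -/
noncomputable def quad (p : ℝ × ℝ) : ℝ :=
  (p.1 - 1 / 3) ^ 2 + (p.1 - 1 / 3) * (p.2 - 1 / 3) + (p.2 - 1 / 3) ^ 2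

lemma quad_eq (p : ℝ × ℝ) :
    quad p = (p.2 - 1 / 3 + (p.1 - 1 / 3) / 2) ^ 2 + 3 / 4 * (p.1 - 1 / 3) ^ 2 := by
  rw [quad]; ring

lemma quad_nonneg (p : ℝ × ℝ) : 0 ≤ quad p := by rw [quad_eq]; positivity

@[fun_prop] lemma continuous_quad : Continuous quad := by unfold quad; fun_prop

lemma esymmTwo_eq (p : ℝ × ℝ) : esymmTwo p = 1 / 3 - quad p := by
  simp [esymmTwo, quad]; ring

lemma esymmThree_eq (p : ℝ × ℝ) : esymmThree p - 1 / 27 = -(quad p / 3) +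
    (bary p 0 - 1 / 3) * (bary p 1 - 1 / 3) * (bary p 2 - 1 / 3) := by
  simp [esymmThree, quad]; ring

@[fun_prop] lemma continuous_esymmTwo : Continuous esymmTwo := by unfold esymmTwo; fun_prop
@[fun_prop] lemma continuous_esymmThree : Continuous esymmThree := by unfold esymmThree; fun_prop

section Gaussian

variable {A : ℝ}

lemma integral_exp_quad_right (hA : 0 < A) (x : ℝ) :
    Integrable (fun y => Real.exp (-(A * quad (x, y)))) ∧
    ∫ y, Real.exp (-(A * quad (x, y))) =
      Real.exp (-(3 / 4 * A) * (x - 1 / 3) ^ 2) * √(Real.pi / A) := by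
  have h : ∀ y, Real.exp (-(A * quad (x, y))) = Real.exp (-(3 / 4 * A) * (x - 1 / 3) ^ 2) *
      Real.exp (-A * (y + (-(1 / 3) + (x - 1 / 3) / 2)) ^ 2) := fun y => by
    rw [← Real.exp_add, quad_eq]
    congr 1
    ring
  simp_rw [h]
  refine ⟨((integrable_exp_neg_mul_sq hA).comp_add_right _).const_mul _, ?_⟩
  rw [integral_const_mul, integral_add_right_eq_self (fun y => Real.exp (-A * y ^ 2)),
    integral_gaussian]

lemma integrable_exp_quad (hA : 0 < A) : Integrable fun p => Real.exp (-(A * quad p)) := by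
  rw [Measure.volume_eq_prod, integrable_prod_iff (by fun_prop)]
  refine ⟨Eventually.of_forall fun x => (integral_exp_quad_right hA x).1, ?_⟩
  simp_rw [Real.norm_eq_abs, Real.abs_exp, (integral_exp_quad_right hA _).2]
  exact (((integrable_exp_neg_mul_sq (by positivity)).comp_sub_right _)).mul_const _

/-- The quadratic form `quad` has determinant `3/4`, whence the factor `2 / √3`. -/
lemma integral_exp_quad (hA : 0 < A) :
    ∫ p, Real.exp (-(A * quad p)) = 2 * Real.pi / (√3 * A) := by
  rw [Measure.volume_eq_prod, integral_prod _ (integrable_exp_quad hA)]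
  simp_rw [(integral_exp_quad_right hA _).2]
  rw [integral_mul_const, integral_sub_right_eq_self (fun x => Real.exp (-(3 / 4 * A) * x ^ 2)),
    integral_gaussian, ← Real.sqrt_mul (by positivity),
    show Real.pi / (3 / 4 * A) * (Real.pi / A) = (2 * Real.pi / A) ^ 2 / 3 by field_simp; norm_num,
    Real.sqrt_div (by positivity), Real.sqrt_sq (by positivity)]
  field_simp

end Gaussian

/-- The barycentric coordinates are close to `1/3` near the centre. -/
lemma abs_bary_sub_le {p : ℝ × ℝ} {δ : ℝ} (hδ : 0 ≤ δ) (h : quad p ≤ δ ^ 2) (e : Fin 3) :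
    |bary p e - 1 / 3| ≤ 2 * δ := by
  refine abs_le_of_sq_le_sq ?_ (by positivity)
  have h' := h
  rw [quad] at h'
  fin_cases e
  · simp; nlinarith [sq_nonneg (p.2 - 1 / 3 + (p.1 - 1 / 3) / 2)]
  · simp; nlinarith [sq_nonneg (p.1 - 1 / 3 + (p.2 - 1 / 3) / 2)]
  · simp; nlinarith [sq_nonneg (p.1 - p.2)]

lemma abs_cubic_le {p : ℝ × ℝ} {δ : ℝ} (hδ : 0 ≤ δ) (h : quad p ≤ δ ^ 2) :
    |(bary p 0 - 1 / 3) * (bary p 1 - 1 / 3) * (bary p 2 - 1 / 3)| ≤ 2 * δ * quad p := by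
  have h0 := abs_bary_sub_le hδ h 0
  rw [mul_assoc, abs_mul]
  refine mul_le_mul h0 ?_ (abs_nonneg _) (by positivity)
  rw [quad_eq]
  simp only [bary_one, bary_two]
  rw [abs_le]
  constructor <;> nlinarith [sq_nonneg (p.2 - 1 / 3 + (p.1 - 1 / 3) / 2), sq_nonneg (p.1 - 1 / 3),
    sq_nonneg (p.2 - 1 / 3), sq_nonneg (p.1 - 1 / 3 + (p.2 - 1 / 3))]

lemma cubic_le_aux {u v w : ℝ} (hs : u + v + w = 0) (hv : v ≤ 0) (hw : w ≤ 0) (hv' : -(1 / 3) ≤ v)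
    (hw' : -(1 / 3) ≤ w) : 3 * (u * v * w) ≤ 2 / 3 * -(u * v + v * w + u * w) := by
  have hu : u = -v - w := by linarith
  have h1 : 0 ≤ v * w := mul_nonneg_of_nonpos_of_nonpos hv hw
  have h2 : u * (v * w) ≤ 2 / 3 * (v * w) := mul_le_mul_of_nonneg_right (by linarith) h1
  have h3 : -(u * v + v * w + u * w) = v ^ 2 + v * w + w ^ 2 := by rw [hu]; ring
  rw [h3]
  nlinarith [sq_nonneg (v - w)]

/-- A positive product of three numbers with sum `0` requires two negative ones; as these are at
least `-1/3`, the third is at most `2/3`. The bound is weaker than the local one near the centre,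
but it holds on the whole triangle. -/
lemma cubic_le {u v w : ℝ} (hs : u + v + w = 0) (hu : -(1 / 3) ≤ u) (hv : -(1 / 3) ≤ v)
    (hw : -(1 / 3) ≤ w) : 3 * (u * v * w) ≤ 2 / 3 * -(u * v + v * w + u * w) := by
  have hq : 0 ≤ -(u * v + v * w + u * w) := by
    nlinarith [sq_nonneg u, sq_nonneg v, sq_nonneg w, sq_nonneg (u + v + w)]
  rcases le_total 0 (u * v * w) with h | h
  · rcases le_total u 0 with hu0 | hu0
    · rcases le_total v 0 with hv0 | hv0
      · have := cubic_le_aux (u := w) (v := u) (w := v) (by linarith) hu0 hv0 hu hv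
        linarith
      · rcases le_total w 0 with hw0 | hw0
        · have := cubic_le_aux (u := v) (v := u) (w := w) (by linarith) hu0 hw0 hu hw
          linarith
        · have : u * v * w ≤ 0 :=
            mul_nonpos_of_nonpos_of_nonneg (mul_nonpos_of_nonpos_of_nonneg hu0 hv0) hw0
          linarith
    · rcases le_total v 0 with hv0 | hv0
      · rcases le_total w 0 with hw0 | hw0
        · exact cubic_le_aux hs hv0 hw0 hv hw
        · have : u * v * w ≤ 0 :=
            mul_nonpos_of_nonpos_of_nonneg (mul_nonpos_of_nonneg_of_nonpos hu0 hv0) hw0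
          linarith
      · rcases le_total w 0 with hw0 | hw0
        · have : u * v * w ≤ 0 :=
            mul_nonpos_of_nonneg_of_nonpos (mul_nonneg hu0 hv0) hw0
          linarith
        · have h1 : u = 0 := by linarith
          subst h1
          nlinarith
  · linarith

lemma esymmThree_le {p : ℝ × ℝ} (hp : p ∈ simplex) :
    3 * (esymmThree p - 1 / 27) ≤ -(quad p / 3) := by
  have h := cubic_le (u := bary p 0 - 1 / 3) (v := bary p 1 - 1 / 3) (w := bary p 2 - 1 / 3)
    (by simp; ring) (by linarith [bary_nonneg hp 0]) (by linarith [bary_nonneg hp 1])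
    (by linarith [bary_nonneg hp 2])
  have h2 : -((bary p 0 - 1 / 3) * (bary p 1 - 1 / 3) + (bary p 1 - 1 / 3) * (bary p 2 - 1 / 3) +
    (bary p 0 - 1 / 3) * (bary p 2 - 1 / 3)) = quad p := by simp [quad]; ring
  rw [h2] at h
  rw [esymmThree_eq]
  linarith

lemma continuous_trace_symPow (N : ℕ) :
    Continuous fun p => (symPow N (thirdMat (bary p) * offDiag)).trace := by
  simp_rw [trace_symPow_mul_symPow _ _ _ offDiag_isSymm]
  have hcont : ∀ s t, Continuous fun p => thirdMat (bary p) s t := fun s t => by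
    simp only [thirdMat, Matrix.of_apply]
    split_ifs <;> fun_prop
  refine continuous_finsetSum _ fun k _ => continuous_finsetSum _ fun m _ => ?_
  split_ifs
  · exact (continuous_const.mul (continuous_finsetProd _ fun s _ => (hcont _ _).pow _)).mul
      continuous_const
  · exact continuous_const

/-- The eigenvalue bound needs positive coordinates. Boundary points are limits of interior points
along the segment to the centre, and both sides are continuous. -/
lemma trace_symPow_le {p : ℝ × ℝ} (hp : p ∈ simplex) (N : ℕ) :
    (symPow N (thirdMat (bary p) * offDiag)).trace ≤
        (N + 1) ^ 2 * ((4 / 3) ^ N * Real.exp (3 * N * (esymmThree p - 1 / 27))) := by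
  let γ : ℝ → ℝ × ℝ := fun s => ((1 - s) * p.1 + s / 3, (1 - s) * p.2 + s / 3)
  have hγ : Continuous γ := by fun_prop
  have hγ0 : γ 0 = p := by simp [γ]
  have h1 := ((continuous_trace_symPow N).comp hγ).tendsto 0
  have h2 : Continuous fun p => ((N : ℝ) + 1) ^ 2 * ((4 / 3) ^ N * Real.exp (3 * N *
    (esymmThree p - 1 / 27))) := by fun_prop
  have h3 := (h2.comp hγ).tendsto 0
  simp only [Function.comp_def, hγ0] at h1 h3
  refine le_of_tendsto_of_tendsto (h1.mono_left nhdsWithin_le_nhds)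
    (h3.mono_left (nhdsWithin_le_nhds (s := Set.Ioi 0))) ?_
  filter_upwards [Ioo_mem_nhdsGT (zero_lt_one' ℝ)] with s hs
  refine (trace_symPow_bounds (fun e => ?_) N).1
  have hb : bary (γ s) e = (1 - s) * bary p e + s / 3 := by
    fin_cases e <;> (simp [γ]; try ring)
  rw [hb]
  have := mul_nonneg (by linarith [hs.2] : 0 ≤ 1 - s) (bary_nonneg hp e)
  linarith [hs.1]

lemma esymmTwo_pow_le {p : ℝ × ℝ} (hp : p ∈ simplex) (d : ℕ) :
    0 ≤ esymmTwo p ^ d ∧ esymmTwo p ^ d ≤ (1 / 3) ^ d * Real.exp (-(3 * d * quad p)) := by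
  have h0 : 0 ≤ esymmTwo p := by
    have := bary_nonneg hp
    unfold esymmTwo
    have h0 := this 0
    have h1 := this 1
    have h2 := this 2
    positivity
  refine ⟨pow_nonneg h0 d, ?_⟩
  calc esymmTwo p ^ d ≤ (1 / 3 * Real.exp (-(3 * quad p))) ^ d := by
        refine pow_le_pow_left₀ h0 ?_ d
        rw [esymmTwo_eq]
        have := Real.add_one_le_exp (-(3 * quad p))
        linarith
    _ = _ := by
        rw [mul_pow, ← Real.exp_nat_mul]
        congr 2
        ring

lemma integral_simplex_one : ∫ _ in simplex, (1 : ℝ) = 1 / 2 := by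
  have := prod_factorial_eq_integral 0
  simp [-integral_const, Nat.factorial] at this
  linarith

/-- The Laplace method for the summands of the second moment. -/
lemma integral_secondMoment_le {ε : ℝ} (hε : 0 < ε) (hε1 : ε < 1) :
    ∃ c > 0, ∀ d N : ℕ, 0 < d + N →
      ∫ p in simplex, esymmTwo p ^ d * (symPow N (thirdMat (bary p) * offDiag)).trace ≤
        (1 / 3) ^ d * (4 / 3) ^ N * (16 / 9 * (1 + ε) * (2 * Real.pi /
          (√3 * ((1 - ε) * (3 * d + N)))) + (N + 1) ^ 2 * Real.exp (-(c * (3 * d + N)))) := by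
  have hφ : ContinuousAt (fun x : ℝ => 16 / 9 / ((2 + 3 * √(3 * x)) * √(3 * x))) (1 / 27) := by
    refine ContinuousAt.div continuousAt_const (by fun_prop) ?_
    have : 0 < √(3 * (1 / 27)) := Real.sqrt_pos.2 (by norm_num)
    positivity
  have hφ1 : 16 / 9 / ((2 + 3 * √(3 * (1 / 27 : ℝ))) * √(3 * (1 / 27))) = 16 / 9 := by
    rw [show (3 * (1 / 27) : ℝ) = (1 / 3) ^ 2 by norm_num, Real.sqrt_sq (by norm_num)]
    norm_num
  obtain ⟨η, hη, hηφ⟩ := Metric.continuousAt_iff.1 hφ (16 / 9 * ε) (by positivity)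
  rw [hφ1] at hηφ
  -- `6 * δ ≤ ε` absorbs the cubic term of `esymmThree`, `δ < 1 / 6` keeps the coordinates positive,
  -- and `δ ^ 2 < η` keeps `esymmThree` where the prefactor is below `16 / 9 * (1 + ε)`.
  obtain ⟨δ, hδ0, hδ1, hδ2, hδ3⟩ : ∃ δ : ℝ, 0 < δ ∧ 6 * δ ≤ ε ∧ δ < 1 / 6 ∧ δ ^ 2 < η := by
    refine ⟨min (min (ε / 6) (1 / 12)) (min (η / 2) (1 / 12)), by positivity, ?_, ?_, ?_⟩
    · have := min_le_left (min (ε / 6) (1 / 12)) (min (η / 2) (1 / 12))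
      have := min_le_left (ε / 6) (1 / 12)
      linarith
    · have := min_le_left (min (ε / 6) (1 / 12)) (min (η / 2) (1 / 12))
      have := min_le_right (ε / 6) (1 / 12)
      linarith
    · set δ := min (min (ε / 6) (1 / 12)) (min (η / 2) (1 / 12))
      have h1 : δ ≤ η / 2 := (min_le_right _ _).trans (min_le_left _ _)
      have h2 : δ ≤ 1 / 12 := (min_le_right _ _).trans (min_le_right _ _)
      have h3 : 0 < δ := by positivity
      nlinarith
  refine ⟨δ ^ 2 / 3, by positivity, fun d N hdN => ?_⟩
  -- The Gaussian rate at the centre: `3 * d` from the power of `esymmTwo` and `N` from the trace.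
  set B : ℝ := 3 * d + N with hB
  have hB0 : 0 < B := by
    have : (0 : ℝ) < d + N := by exact_mod_cast hdN
    have : (0 : ℝ) ≤ d := by positivity
    linarith
  have hA : 0 < (1 - ε) * B := mul_pos (by linarith) hB0
  have hpt : ∀ p ∈ simplex, esymmTwo p ^ d * (symPow N (thirdMat (bary p) * offDiag)).trace ≤
      (1 / 3) ^ d * (4 / 3) ^ N * (16 / 9 * (1 + ε) * Real.exp (-((1 - ε) * B * quad p)) +
        (N + 1) ^ 2 * Real.exp (-(δ ^ 2 / 3 * B))) := by
    intro p hp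
    obtain ⟨he0, he1⟩ := esymmTwo_pow_le hp d
    have hq := quad_nonneg p
    -- Near the centre the sharp bound gives a Gaussian. Far from it the crude bound, with a third
    -- of the rate in the trace, still gives exponential decay.
    rcases le_total (quad p) (δ ^ 2) with hnear | hfar
    · have hcub := abs_cubic_le hδ0.le hnear
      have hb := abs_bary_sub_le hδ0.le hnear
      have hpos : ∀ e, 0 < bary p e := fun e => by
        have := (abs_le.1 (hb e)).1
        linarith
      have he3 : dist (esymmThree p) (1 / 27) < η := by
        rw [Real.dist_eq, esymmThree_eq, abs_lt]
        have := abs_le.1 hcub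
        constructor <;> nlinarith
      have hκ := (abs_lt.1 (hηφ he3)).2
      have hH := (trace_symPow_bounds hpos N).2
      have hexp : 3 * N * (esymmThree p - 1 / 27) ≤ -((1 - ε) * N * quad p) := by
        rw [esymmThree_eq]
        have h1 := (abs_le.1 hcub).2
        have h2 : 3 * ((bary p 0 - 1 / 3) * (bary p 1 - 1 / 3) * (bary p 2 - 1 / 3)) ≤
            ε * quad p := by nlinarith
        have h3 : (0 : ℝ) ≤ N := by positivity
        nlinarith
      calc _ ≤ esymmTwo p ^ d * (16 / 9 * (1 + ε) * ((4 / 3) ^ N *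
            Real.exp (-((1 - ε) * N * quad p)))) := by
            refine mul_le_mul_of_nonneg_left (hH.trans ?_) he0
            exact mul_le_mul (by linarith) (by gcongr) (by positivity) (by positivity)
        _ ≤ ((1 / 3) ^ d * Real.exp (-(3 * d * quad p))) * (16 / 9 * (1 + ε) * ((4 / 3) ^ N *
            Real.exp (-((1 - ε) * N * quad p)))) :=
            mul_le_mul_of_nonneg_right he1 (by positivity)
        _ = (1 / 3) ^ d * (4 / 3) ^ N * (16 / 9 * (1 + ε) *
            Real.exp (-(3 * d * quad p) + -((1 - ε) * N * quad p))) := by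
            rw [Real.exp_add]; ring
        _ ≤ _ := by
            refine mul_le_mul_of_nonneg_left ?_ (by positivity)
            refine le_add_of_le_of_nonneg ?_ (by positivity)
            refine mul_le_mul_of_nonneg_left (Real.exp_le_exp.2 ?_) (by positivity)
            rw [hB]
            have : 0 ≤ ε * (3 * d * quad p) := by positivity
            linarith
    · have hH := trace_symPow_le hp N
      have hexp : 3 * N * (esymmThree p - 1 / 27) ≤ -(N * quad p / 3) := by
        have h1 := esymmThree_le hp
        have h3 : (0 : ℝ) ≤ N := by positivity
        nlinarith
      calc _ ≤ esymmTwo p ^ d * ((N + 1) ^ 2 * ((4 / 3) ^ N *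
            Real.exp (-(N * quad p / 3)))) := by
            refine mul_le_mul_of_nonneg_left (hH.trans ?_) he0
            gcongr
        _ ≤ ((1 / 3) ^ d * Real.exp (-(3 * d * quad p))) * ((N + 1) ^ 2 * ((4 / 3) ^ N *
            Real.exp (-(N * quad p / 3)))) :=
            mul_le_mul_of_nonneg_right he1 (by positivity)
        _ = (1 / 3) ^ d * (4 / 3) ^ N * ((N + 1) ^ 2 *
            Real.exp (-(3 * d * quad p) + -(N * quad p / 3))) := by
            rw [Real.exp_add]; ring
        _ ≤ _ := by
            refine mul_le_mul_of_nonneg_left ?_ (by positivity)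
            refine le_add_of_nonneg_of_le (by positivity) ?_
            refine mul_le_mul_of_nonneg_left (Real.exp_le_exp.2 ?_) (by positivity)
            rw [hB]
            have h3 : (0 : ℝ) ≤ N := by positivity
            have h4 : (0 : ℝ) ≤ d := by positivity
            nlinarith [mul_nonneg h4 hq, mul_le_mul_of_nonneg_left hfar h3,
              mul_le_mul_of_nonneg_left hfar h4]
  have hint : IntegrableOn (fun p => Real.exp (-((1 - ε) * B * quad p))) simplex :=
    (integrable_exp_quad hA).integrableOn
  calc _ ≤ ∫ p in simplex, (1 / 3) ^ d * (4 / 3) ^ N * (16 / 9 * (1 + ε) *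
        Real.exp (-((1 - ε) * B * quad p)) + (N + 1) ^ 2 * Real.exp (-(δ ^ 2 / 3 * B))) := by
        refine setIntegral_mono_on ?_ ?_ measurableSet_simplex hpt
        · exact integrableOn_simplex ((continuous_esymmTwo.pow d).mul (continuous_trace_symPow N))
        · exact integrableOn_simplex (by fun_prop)
    _ = (1 / 3) ^ d * (4 / 3) ^ N * (16 / 9 * (1 + ε) * (∫ p in simplex,
        Real.exp (-((1 - ε) * B * quad p))) + (N + 1) ^ 2 * Real.exp (-(δ ^ 2 / 3 * B)) *
          (1 / 2)) := by
        have hconst : ∀ K : ℝ, ∫ _ in simplex, K = K * (1 / 2) := fun K => by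
          rw [← integral_simplex_one, ← integral_const_mul]
          simp only [mul_one]
        rw [integral_const_mul, integral_add (integrableOn_simplex (by fun_prop))
          (integrableOn_simplex (by fun_prop)), integral_const_mul, hconst]
    _ ≤ _ := by
        refine mul_le_mul_of_nonneg_left (add_le_add ?_ ?_) (by positivity)
        · refine mul_le_mul_of_nonneg_left ?_ (by positivity)
          rw [← integral_exp_quad hA]
          exact setIntegral_le_integral (integrable_exp_quad hA)
            (Eventually.of_forall fun p => (Real.exp_pos _).le)
        · have : 0 ≤ ((N : ℝ) + 1) ^ 2 * Real.exp (-(δ ^ 2 / 3 * B)) := by positivity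
          linarith

/-- The Laplace method for the first moment. -/
lemma le_integral_firstMoment {ε : ℝ} (hε : 0 < ε) :
    ∃ c > 0, ∀ n : ℕ, 0 < n →
      (1 / 3) ^ n * (2 * Real.pi / (√3 * (3 * (1 + ε) * n)) * (1 - 2 * Real.exp (-(c * n)))) ≤
        ∫ p in simplex, esymmTwo p ^ n := by
  -- The inequality is used with `x = 3 * quad p`; it holds for `x ≤ ε / (1 + ε)`, which the choice
  -- of `δ` guarantees.
  obtain ⟨δ, hδ0, hδ1, hδ2⟩ : ∃ δ : ℝ, 0 < δ ∧ δ < 1 / 6 ∧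
      ∀ x, 0 ≤ x → x ≤ 3 * δ ^ 2 → Real.exp (-((1 + ε) * x)) ≤ 1 - x := by
    refine ⟨min (1 / 12) (ε / (1 + ε) / 6), by positivity, ?_, ?_⟩
    · have := min_le_left (1 / 12) (ε / (1 + ε) / 6)
      linarith
    · intro x hx0 hx1
      set δ := min (1 / 12) (ε / (1 + ε) / 6)
      have h1 : δ ≤ 1 / 12 := min_le_left _ _
      have h2 : δ ≤ ε / (1 + ε) / 6 := min_le_right _ _
      have h0 : 0 < δ := by positivity
      have hx2 : x ≤ ε / (1 + ε) := by
        have : 0 < ε / (1 + ε) := by positivity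
        nlinarith
      rw [le_div_iff₀ (by positivity)] at hx2
      have hx3 : x < 1 := by nlinarith
      rw [Real.exp_neg, inv_le_comm₀ (Real.exp_pos _) (by linarith)]
      refine le_trans ?_ (Real.add_one_le_exp _)
      rw [← one_div, div_le_iff₀ (by linarith)]
      nlinarith
  refine ⟨3 * (1 + ε) / 2 * δ ^ 2, by positivity, fun n hn => ?_⟩
  have hn0 : (0 : ℝ) < n := by exact_mod_cast hn
  have hA : 0 < 3 * (1 + ε) * n := by positivity
  set s : Set (ℝ × ℝ) := {p | quad p ≤ δ ^ 2} with hs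
  have hsm : MeasurableSet s := (isClosed_le continuous_quad continuous_const).measurableSet
  have hsub : s ⊆ simplex := by
    intro p hp
    have hb := abs_bary_sub_le hδ0.le hp
    have hpos : ∀ e, 0 < bary p e := fun e => by
      have := (abs_le.1 (hb e)).1
      linarith
    have h0 := hpos 0
    have h1 := hpos 1
    have h2 := hpos 2
    simp only [bary_zero, bary_one, bary_two] at h0 h1 h2
    exact ⟨h0.le, h1.le, by linarith⟩
  have hint := integrable_exp_quad hA
  have hint2 := integrable_exp_quad (half_pos hA)
  -- Half of the exponent is spent on the factor `exp (-(c * n))`. The other half is integrated over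
  -- the plane, which doubles the Gaussian mass; hence the `2` in the statement.
  have htail : ∫ p in sᶜ, Real.exp (-(3 * (1 + ε) * n * quad p)) ≤
      Real.exp (-(3 * (1 + ε) / 2 * δ ^ 2 * n)) * (2 * Real.pi / (√3 * (3 * (1 + ε) * n / 2))) := by
    rw [← integral_exp_quad (half_pos hA), ← integral_const_mul]
    refine le_trans (setIntegral_mono_on hint.integrableOn (hint2.const_mul _).integrableOn
      hsm.compl fun p hp => ?_) (setIntegral_le_integral (hint2.const_mul _)
      (Eventually.of_forall fun p => by positivity))
    · rw [← Real.exp_add]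
      refine Real.exp_le_exp.2 ?_
      have : δ ^ 2 ≤ quad p := le_of_lt (not_le.1 hp)
      nlinarith
  have hsplit := integral_add_compl hsm hint
  rw [integral_exp_quad hA] at hsplit
  have hmain : ∫ p in s, (1 / 3) ^ n * Real.exp (-(3 * (1 + ε) * n * quad p)) ≤
      ∫ p in simplex, esymmTwo p ^ n := by
    refine le_trans (setIntegral_mono_on (hint.const_mul _).integrableOn
      ((integrableOn_simplex (continuous_esymmTwo.pow n)).mono_set hsub) hsm fun p hp => ?_)
      (setIntegral_mono_set (integrableOn_simplex (continuous_esymmTwo.pow n)) ?_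
        hsub.eventuallyLE)
    · have h1 := hδ2 (3 * quad p) (by linarith [quad_nonneg p]) (by
        have : quad p ≤ δ ^ 2 := hp
        linarith)
      calc _ = (1 / 3 * Real.exp (-((1 + ε) * (3 * quad p)))) ^ n := by
            rw [mul_pow, ← Real.exp_nat_mul]
            congr 2
            ring
        _ ≤ _ := by
            refine pow_le_pow_left₀ (by positivity) ?_ n
            rw [esymmTwo_eq]
            linarith
    · refine (ae_restrict_iff' measurableSet_simplex).2 (Eventually.of_forall fun p hp => ?_)
      exact (esymmTwo_pow_le hp n).1
  refine le_trans ?_ hmain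
  rw [integral_const_mul]
  refine mul_le_mul_of_nonneg_left ?_ (by positivity)
  have : 2 * Real.pi / (√3 * (3 * (1 + ε) * n / 2)) =
    2 * (2 * Real.pi / (√3 * (3 * (1 + ε) * n))) := by field_simp
  rw [this] at htail
  linarith

end RandomLift

/-! ### The moments as expectations, and the concentration of the colour counts. -/

namespace RandomLift

open SymmetricPower Finset Topology

/-- The number of pairs of a lift and a perfect matching. -/
def pairCount (n : ℕ) : ℝ := ∑ τ : Vert n → Fin 3, ((model (cover τ)).card : ℝ)

/-- The expected number of perfect matchings. -/
noncomputable def firstMoment (n : ℕ) : ℝ :=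
  (2 * n + 2).factorial / (n.factorial : ℝ) ^ 2 * ∫ p in simplex, esymmTwo p ^ n

/-- The second moment of the number of perfect matchings. -/
noncomputable def secondMoment (n : ℕ) : ℝ :=
  (∑ q ∈ antidiagonal n, ((n + q.1 + 2).factorial : ℝ) / q.1.factorial *
    ∫ p in simplex, esymmTwo p ^ q.1 *
      (symPow q.2 (thirdMat (bary p) * offDiag)).trace) / n.factorial

lemma sum_X (n : ℕ) : ∑ σ, X K23 n σ = pairCount n := by
  simp_rw [X_K23]
  rw [sum_comm]
  simp [pairCount]

lemma pairCount_eq (n : ℕ) : pairCount n =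
    n.factorial * ((2 * n + 2).factorial * ∫ p in simplex, esymmTwo p ^ n) := by
  have h := sum_card_model_cover (n := n) fun _ => 1
  have h2 := sum_prod_factorial_div n fun _ => 1
  simp only [one_mul, one_pow, prod_const_one] at h h2
  rw [pairCount, h, h2]
  change _ * (_ * ∫ p in simplex, esymmTwo p ^ n) = _
  have : (n.factorial : ℝ) ≠ 0 := by positivity
  field_simp

lemma firstMoment_eq (n : ℕ) : firstMoment n = pairCount n / (n.factorial : ℝ) ^ 3 := by
  rw [pairCount_eq, firstMoment]
  have : (n.factorial : ℝ) ≠ 0 := by positivity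
  field_simp

lemma integral_X (n : ℕ) : ∫ σ, X K23 n σ ∂liftMeasure (Fin 3) n = firstMoment n := by
  rw [integral_liftMeasure, sum_X, firstMoment_eq]

lemma integral_X_sq (n : ℕ) : ∫ σ, X K23 n σ ^ 2 ∂liftMeasure (Fin 3) n = secondMoment n := by
  have h : ∀ (τ τ' : Vert n → Fin 3) (σ : Fin 3 → Equiv.Perm (Fin n)),
      (if σ ∈ model (cover τ) then (1 : ℝ) else 0) * (if σ ∈ model (cover τ') then 1 else 0) =
        if σ ∈ model (cover₂ τ τ') then 1 else 0 := fun τ τ' σ => by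
    rw [mul_ite, mul_one, mul_zero, ← ite_and]
    refine if_congr ?_ rfl rfl
    rw [and_comm]
    simp only [mem_model, cover, cover₂, Prod.mk.injEq]
    exact ⟨fun h e v => ⟨h.1 e v, h.2 e v⟩, fun h => ⟨fun e v => (h e v).1, fun e v => (h e v).2⟩⟩
  have h2 : ∑ σ, X K23 n σ ^ 2 =
      ∑ τ : Vert n → Fin 3, ∑ τ' : Vert n → Fin 3, ((model (cover₂ τ τ')).card : ℝ) := by
    simp_rw [X_K23, sq, sum_mul_sum, h]
    rw [sum_comm]
    refine sum_congr rfl fun τ _ => ?_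
    rw [sum_comm]
    simp
  rw [integral_liftMeasure, h2, sum_card_model_cover₂, secondMoment]
  have : (n.factorial : ℝ) ≠ 0 := by positivity
  field_simp

/-- An exponential bound for the lower tail. -/
lemma exists_tilt {ε : ℝ} (hε : 0 < ε) (hε1 : ε < 1 / 3) :
    ∃ y r : ℝ, 0 < y ∧ y < 1 ∧ 0 < r ∧ r < 1 ∧
      ∀ n d : ℕ, (d : ℝ) ≤ (1 / 3 - ε) * n → 1 ≤ r ^ n * ((4 - y) / 3) ^ n * y ^ d := by
  -- A Chernoff bound with tilt `y = 1 - ε`. The power `(3 / (4 - y)) ^ n` is the generating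
  -- function of the negative binomial law of parameter `1/4`, with mean `n / 3`. The same bound
  -- serves for the colour counts and for the number of common edges of two matchings.
  have hy0 : 0 < 1 - ε := by linarith
  set y := 1 - ε with hy
  have h4 : 0 < 4 - y := by linarith
  refine ⟨y, 3 / (4 - y) * y ^ (-(1 / 3 - ε)), hy0, by linarith, by positivity, ?_, ?_⟩
  · rw [← Real.log_neg_iff (by positivity), Real.log_mul (by positivity) (by positivity),
      Real.log_rpow hy0, Real.log_div (by norm_num) h4.ne']
    have h1 := Real.one_sub_inv_le_log_of_pos (show 0 < (4 - y) / 3 by positivity)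
    rw [Real.log_div h4.ne' (by norm_num)] at h1
    have h2 := Real.one_sub_inv_le_log_of_pos hy0
    have h3 : -(1 / 3 - ε) * Real.log y ≤ -(1 / 3 - ε) * (1 - y⁻¹) :=
      mul_le_mul_of_nonpos_left h2 (by linarith)
    have h5 : -(1 / 3 - ε) * (1 - y⁻¹) < 1 - ((4 - y) / 3)⁻¹ := by
      rw [inv_div, hy, one_sub_div (by linarith), ← one_div, one_sub_div hy0.ne', mul_div_assoc',
        div_lt_div_iff₀ hy0 (by linarith)]
      nlinarith [sq_nonneg ε, mul_pos hε hε, mul_pos (mul_pos hε hε) hε]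
    linarith
  · intro n d hd
    rw [mul_pow, ← Real.rpow_natCast (y ^ _), ← Real.rpow_mul hy0.le, ← Real.rpow_natCast y d]
    have h1 : (3 / (4 - y)) ^ n * ((4 - y) / 3) ^ n = 1 := by
      rw [← mul_pow]
      have : 3 / (4 - y) * ((4 - y) / 3) = 1 := by field_simp
      rw [this, one_pow]
    have h2 : 1 ≤ y ^ (-(1 / 3 - ε) * n) * y ^ (d : ℝ) := by
      rw [← Real.rpow_add hy0]
      exact Real.one_le_rpow_of_pos_of_le_one_of_nonpos hy0 (by linarith) (by linarith)
    calc (1 : ℝ) ≤ 1 * (y ^ (-(1 / 3 - ε) * n) * y ^ (d : ℝ)) := by rw [one_mul]; exact h2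
      _ = _ := by rw [← h1]; ring

lemma sum_choose_mul_pow_le (n : ℕ) {x : ℝ} (h0 : 0 ≤ x) (h1 : x < 1) (s : Finset ℕ) :
    ∑ d ∈ s, ((n + 2 + d).choose d : ℝ) * x ^ d ≤ (1 / (1 - x)) ^ (n + 3) := by
  have h := hasSum_choose_mul_geometric_of_norm_lt_one (n + 2) (r := x)
    (by rwa [Real.norm_of_nonneg h0])
  have h2 := sum_le_hasSum s (fun d _ => by positivity) h
  rw [one_div_pow]
  refine le_trans (le_of_eq (sum_congr rfl fun d _ => ?_)) h2
  rw [Nat.choose_symm_of_eq_add (show d + (n + 2) = d + (n + 2) from rfl) |>.symm, add_comm d]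

/-- Weighting one product by `y` changes the maximum of `esymmTwo` from `1/3` to `1 / (4 - y)`: if
`b`, `c` are the coordinates in the weighted product and `s = b + c`, then `b c ≤ s² / 4` leaves the
quadratic `s - (1 - y / 4) s²`. -/
lemma esymm_tilt_le {p : ℝ × ℝ} (hp : p ∈ simplex) {y : ℝ} (h0 : 0 < y) (h1 : y < 1)
    (e : Fin 3) :
    0 ≤ (fun i => if i = e then y else 1 : Fin 3 → ℝ) 0 * (bary p 1 * bary p 2) +
      (fun i => if i = e then y else 1 : Fin 3 → ℝ) 1 * (bary p 0 * bary p 2) +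
      (fun i => if i = e then y else 1 : Fin 3 → ℝ) 2 * (bary p 0 * bary p 1) ∧
    (fun i => if i = e then y else 1 : Fin 3 → ℝ) 0 * (bary p 1 * bary p 2) +
      (fun i => if i = e then y else 1 : Fin 3 → ℝ) 1 * (bary p 0 * bary p 2) +
      (fun i => if i = e then y else 1 : Fin 3 → ℝ) 2 * (bary p 0 * bary p 1) ≤ 1 / (4 - y) := by
  have b0 := bary_nonneg hp 0
  have b1 := bary_nonneg hp 1
  have b2 := bary_nonneg hp 2
  have hs : bary p 0 + bary p 1 + bary p 2 = 1 := by simp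
  have key : ∀ a b c : ℝ, a + b + c = 1 → y * (b * c) + a * c + a * b ≤ 1 / (4 - y) := by
    intro a b c h
    have ha : a = 1 - (b + c) := by linarith
    rw [le_div_iff₀ (by linarith), ha]
    nlinarith [sq_nonneg ((4 - y) * (b + c) - 2), mul_nonneg (mul_nonneg h0.le
      (by linarith : 0 ≤ 4 - y)) (sq_nonneg (b - c))]
  fin_cases e
  · refine ⟨by simp only [Fin.zero_eta]; simp; positivity, ?_⟩
    have := key _ _ _ hs
    simp only [Fin.zero_eta]; simp at this ⊢; linarith
  · refine ⟨by simp; positivity, ?_⟩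
    have := key (bary p 1) (bary p 0) (bary p 2) (by linarith)
    simp at this ⊢; linarith
  · refine ⟨by simp; positivity, ?_⟩
    have := key (bary p 2) (bary p 0) (bary p 1) (by linarith)
    simp at this ⊢; linarith

/-- The lower tail of the number of matching edges of a colour. -/
lemma sum_tail_le {ε : ℝ} (hε : 0 < ε) (hε1 : ε < 1 / 3) : ∃ r : ℝ, 0 < r ∧ r < 1 ∧
    ∀ (n : ℕ) (e : Fin 3), (∑ k ∈ piAntidiag (univ : Finset (Fin 3)) n,
      (if (k e : ℝ) ≤ (1 / 3 - ε) * n then 1 else 0) *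
        ∏ e, ((n - k e).factorial : ℝ) / (k e).factorial) ≤
      (2 * n + 2).factorial / n.factorial * (r * (1 / 3)) ^ n := by
  obtain ⟨y, r, hy0, hy1, hr0, hr1, hyr⟩ := exists_tilt hε hε1
  refine ⟨r, hr0, hr1, fun n e => ?_⟩
  have h4 : 0 < 4 - y := by linarith
  have hint : ∫ p in simplex, ((fun i => if i = e then y else 1 : Fin 3 → ℝ) 0 *
      (bary p 1 * bary p 2) + (fun i => if i = e then y else 1 : Fin 3 → ℝ) 1 *
      (bary p 0 * bary p 2) + (fun i => if i = e then y else 1 : Fin 3 → ℝ) 2 *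
      (bary p 0 * bary p 1)) ^ n ≤ (1 / (4 - y)) ^ n := by
    calc _ ≤ ∫ p in simplex, (1 / (4 - y)) ^ n * (1 : ℝ) := by
          refine setIntegral_mono_on (integrableOn_simplex (by fun_prop))
            (integrableOn_simplex (by fun_prop)) measurableSet_simplex fun p hp => ?_
          rw [mul_one]
          obtain ⟨h1, h2⟩ := esymm_tilt_le hp hy0 hy1 e
          exact pow_le_pow_left₀ h1 h2 n
      _ = (1 / (4 - y)) ^ n * (1 / 2) := by rw [integral_const_mul, integral_simplex_one]
      _ ≤ _ := by
          have : 0 < (1 / (4 - y)) ^ n := by positivity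
          linarith
  calc _ ≤ ∑ k ∈ piAntidiag (univ : Finset (Fin 3)) n, r ^ n * ((4 - y) / 3) ^ n *
        ((∏ i, (fun i => if i = e then y else 1 : Fin 3 → ℝ) i ^ k i) *
        ∏ e, ((n - k e).factorial : ℝ) / (k e).factorial) := by
        refine sum_le_sum fun k _ => ?_
        rw [← mul_assoc]
        refine mul_le_mul_of_nonneg_right ?_ (by positivity)
        have hprod : ∏ i, (fun i => if i = e then y else 1 : Fin 3 → ℝ) i ^ k i = y ^ k e := by
          rw [prod_eq_single e]
          · simp
          · intro i _ hi; simp [hi]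
          · simp
        rw [hprod]
        split_ifs with h
        · exact hyr n (k e) h
        · positivity
    _ = r ^ n * ((4 - y) / 3) ^ n * ((2 * n + 2).factorial / n.factorial * _) := by
        rw [← mul_sum, sum_prod_factorial_div]
    _ ≤ r ^ n * ((4 - y) / 3) ^ n * ((2 * n + 2).factorial / n.factorial * (1 / (4 - y)) ^ n) := by
        gcongr
    _ = _ := by
        have : r ^ n * ((4 - y) / 3) ^ n * (1 / (4 - y)) ^ n = (r * (1 / 3)) ^ n := by
          rw [← mul_pow, ← mul_pow]
          congr 1
          field_simp
        rw [← this]; ring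

/-- The constant is not optimal, but it suffices against exponentially small tails. -/
lemma exists_integral_ge : ∃ K > 0, ∀ᶠ n : ℕ in atTop,
    (1 / 3) ^ n / (K * n) ≤ ∫ p in simplex, esymmTwo p ^ n := by
  obtain ⟨c, hc, h⟩ := le_integral_firstMoment one_pos
  have ht : Tendsto (fun n : ℕ => Real.exp (-(c * n))) atTop (𝓝 0) :=
    Real.tendsto_exp_neg_atTop_nhds_zero.comp
      (tendsto_natCast_atTop_atTop.const_mul_atTop hc)
  have hK : 0 < √3 * (3 * (1 + 1)) / Real.pi := by positivity
  refine ⟨√3 * (3 * (1 + 1)) / Real.pi, hK, ?_⟩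
  filter_upwards [ht.eventually (gt_mem_nhds (show (0 : ℝ) < 1 / 4 by norm_num)),
    eventually_gt_atTop 0] with n hn hn0
  have hn1 : (0 : ℝ) < n := by exact_mod_cast hn0
  refine le_trans ?_ (h n hn0)
  rw [div_eq_mul_inv]
  refine mul_le_mul_of_nonneg_left ?_ (by positivity)
  calc (√3 * (3 * (1 + 1)) / Real.pi * n)⁻¹ =
        2 * Real.pi / (√3 * (3 * (1 + 1) * n)) * (1 / 2) := by field_simp
    _ ≤ _ := by
        refine mul_le_mul_of_nonneg_left ?_ (by positivity)
        linarith

/-- In a random lift with a random perfect matching the colours of the matching edges are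
equidistributed. -/
lemma tendsto_unbalanced {ε : ℝ} (hε : 0 < ε) (hε1 : ε < 1 / 3) :
    Tendsto (fun n : ℕ => (∑ τ : Vert n → Fin 3,
      if ∃ e, (counts (fun x => τ (false, x)) e : ℝ) ≤ (1 / 3 - ε) * n then
        ((model (cover τ)).card : ℝ) else 0) / pairCount n) atTop (𝓝 0) := by
  obtain ⟨r, hr0, hr1, hr⟩ := sum_tail_le hε hε1
  obtain ⟨K, hK, hI⟩ := exists_integral_ge
  have hlim : Tendsto (fun n : ℕ => 3 * K * (n * r ^ n)) atTop (𝓝 0) := by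
    have := (tendsto_self_mul_const_pow_of_lt_one hr0.le hr1).const_mul (3 * K)
    simpa using this
  have hpc0 : ∀ n, 0 ≤ pairCount n := fun n => sum_nonneg fun τ _ => by positivity
  refine squeeze_zero' (Eventually.of_forall fun n => ?_) ?_ hlim
  · exact div_nonneg (sum_nonneg fun τ _ => by split_ifs <;> positivity) (hpc0 n)
  · filter_upwards [hI, eventually_gt_atTop 0] with n hn hn0
    have hn1 : (0 : ℝ) < n := by exact_mod_cast hn0
    have hI0 : 0 < (1 / 3 : ℝ) ^ n / (K * n) := by positivity
    have hpos : 0 < pairCount n := by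
      rw [pairCount_eq]
      have := hI0.trans_le hn
      positivity
    rw [div_le_iff₀ hpos]
    have hb : ∀ e : Fin 3, ∑ τ : Vert n → Fin 3,
        (if (counts (fun x => τ (false, x)) e : ℝ) ≤ (1 / 3 - ε) * n then 1 else 0) *
        ((model (cover τ)).card : ℝ) ≤
        n.factorial * ((2 * n + 2).factorial * (r * (1 / 3)) ^ n) := fun e => by
      have h1 := sum_card_model_cover (n := n)
        fun k => if (k e : ℝ) ≤ (1 / 3 - ε) * n then 1 else 0
      rw [h1]
      calc _ ≤ (n.factorial : ℝ) ^ 2 * ((2 * n + 2).factorial / n.factorial *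
            (r * (1 / 3)) ^ n) := mul_le_mul_of_nonneg_left (hr n e) (by positivity)
        _ = _ := by
            have : (n.factorial : ℝ) ≠ 0 := by positivity
            field_simp
    calc _ ≤ ∑ τ : Vert n → Fin 3, ∑ e : Fin 3,
          (if (counts (fun x => τ (false, x)) e : ℝ) ≤ (1 / 3 - ε) * n then 1 else 0) *
          ((model (cover τ)).card : ℝ) := by
          refine sum_le_sum fun τ _ => ?_
          split_ifs with h
          · obtain ⟨e, he⟩ := h
            refine le_trans ?_ (single_le_sum (fun i _ => ?_) (mem_univ e))
            · rw [if_pos he, one_mul]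
            · split_ifs <;> positivity
          · exact sum_nonneg fun i _ => by split_ifs <;> positivity
      _ ≤ ∑ e : Fin 3, n.factorial * ((2 * n + 2).factorial * (r * (1 / 3)) ^ n) := by
          rw [sum_comm]
          exact sum_le_sum fun e _ => hb e
      _ = 3 * K * (n * r ^ n) * (n.factorial * ((2 * n + 2).factorial *
            ((1 / 3) ^ n / (K * n)))) := by
          rw [sum_const, mul_pow]
          simp
          field_simp
      _ ≤ _ := by
          rw [pairCount_eq]
          gcongr

end RandomLift

/-! ### The ratio of the second moment to the squared first moment. -/

namespace RandomLift

open SymmetricPower Finset Topology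

/-- Let `d` be the number of common edges. After the Laplace bound the main weight of `d` is `C(n +
2 + d, d) / 4 ^ d`, a negative binomial law concentrated at `d ≈ n / 3`. There the Gaussian rate `3
d + (n - d) = n + 2 d` is about `5 n / 3`, whence `(5 / 3 - 2 * ε)⁻¹`. Larger `d` only decrease the
term, and smaller ones are absorbed by the tilt into `r ^ n`. -/
lemma secondMoment_le {ε : ℝ} (hε : 0 < ε) (hε1 : ε < 1 / 3) :
    ∃ c r : ℝ, 0 < c ∧ 0 < r ∧ r < 1 ∧ ∀ n : ℕ, 0 < n → secondMoment n ≤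
      (n + 1) * (n + 2) * (4 / 3) ^ (2 * n + 3) / n *
        (16 / 9 * (1 + ε) * (2 * Real.pi / (√3 * (1 - ε))) * ((5 / 3 - 2 * ε)⁻¹ + r ^ n) +
          n * (n + 1) ^ 2 * Real.exp (-(c * n))) := by
  obtain ⟨c, hc, h⟩ := integral_secondMoment_le hε (by linarith)
  obtain ⟨y, r, hy0, hy1, hr0, hr1, hyr⟩ := exists_tilt hε hε1
  refine ⟨c, r, hc, hr0, hr1, fun n hn => ?_⟩
  have hn1 : (0 : ℝ) < n := by exact_mod_cast hn
  have h1ε : 0 < 1 - ε := by linarith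
  have h5 : 0 < 5 / 3 - 2 * ε := by linarith
  have h4 : 0 < 4 - y := by linarith
  set A := 16 / 9 * (1 + ε) * (2 * Real.pi / (√3 * (1 - ε))) with hA
  have hA0 : 0 < A := by positivity
  set E := (n + 1 : ℝ) ^ 2 * Real.exp (-(c * n)) with hE
  set B := r ^ n * ((4 - y) / 3) ^ n with hB
  have hB0 : 0 < B := by positivity
  have hterm : ∀ d ∈ range (n + 1), ((n + d + 2).factorial : ℝ) / d.factorial *
      (∫ p in simplex, esymmTwo p ^ d * (symPow (n - d) (thirdMat (bary p) * offDiag)).trace) /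
        n.factorial ≤ (n + 1) * (n + 2) * (4 / 3) ^ n *
          ((A / n * (5 / 3 - 2 * ε)⁻¹ + E) * (((n + 2 + d).choose d : ℝ) * (1 / 4) ^ d) +
          A / n * B * (((n + 2 + d).choose d : ℝ) * (y / 4) ^ d)) := by
    intro d hd
    have hdn : d ≤ n := by simpa [Nat.lt_succ_iff] using hd
    have hfac : ((n + d + 2).factorial : ℝ) / d.factorial / n.factorial =
        (n + 1) * (n + 2) * ((n + 2 + d).choose d : ℝ) := by
      have h1 := Nat.add_choose_mul_factorial_mul_factorial (n + 2) d
      have h2 : (n + 2).factorial = (n + 2) * ((n + 1) * n.factorial) := by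
        rw [Nat.factorial_succ, Nat.factorial_succ]
      rw [h2, mul_right_comm] at h1
      have h3 : ((n + d + 2).factorial : ℝ) = ((n + 2 + d).choose d : ℝ) * d.factorial *
          ((n + 2) * ((n + 1) * n.factorial)) := by
        rw [show n + d + 2 = n + 2 + d by ring]; exact_mod_cast h1.symm
      rw [h3]
      have h4 : (n.factorial : ℝ) ≠ 0 := by positivity
      have h5 : (d.factorial : ℝ) ≠ 0 := by positivity
      field_simp
    have hI := h d (n - d) (by omega)
    rw [Nat.cast_sub hdn] at hI
    have hden : 3 * (d : ℝ) + (n - d) = n + 2 * d := by ring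
    rw [hden] at hI
    have hpow : (1 / 3 : ℝ) ^ d * (4 / 3) ^ (n - d) = (4 / 3) ^ n * (1 / 4) ^ d := by
      have : (4 / 3 : ℝ) ^ n = (4 / 3) ^ (n - d) * (4 / 3) ^ d := by
        rw [← pow_add, Nat.sub_add_cancel hdn]
      rw [this, mul_assoc, ← mul_pow, mul_comm]
      norm_num
    have hbr : 16 / 9 * (1 + ε) * (2 * Real.pi / (√3 * ((1 - ε) * (n + 2 * d)))) +
        ((n : ℝ) - d + 1) ^ 2 * Real.exp (-(c * (n + 2 * d))) ≤
        (A / n * (5 / 3 - 2 * ε)⁻¹ + E) + A / n * B * y ^ d := by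
      have e1 : 16 / 9 * (1 + ε) * (2 * Real.pi / (√3 * ((1 - ε) * (n + 2 * d)))) =
          A / (n + 2 * d) := by
        rw [hA]; field_simp
      have e2 : ((n : ℝ) - d + 1) ^ 2 * Real.exp (-(c * (n + 2 * d))) ≤ E := by
        have : (d : ℝ) ≤ n := by exact_mod_cast hdn
        have hd0 : (0 : ℝ) ≤ d := by positivity
        refine mul_le_mul (pow_le_pow_left₀ (by linarith) (by linarith) 2)
          (Real.exp_le_exp.2 ?_) (by positivity) (by positivity)
        have : 0 ≤ c * (2 * d) := by positivity
        linarith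
      have e3 : A / (n + 2 * d) ≤ A / n * (5 / 3 - 2 * ε)⁻¹ + A / n * B * y ^ d := by
        by_cases hdd : (d : ℝ) ≤ (1 / 3 - ε) * n
        · have := hyr n d hdd
          have h3 : A / (n + 2 * d) ≤ A / n * 1 := by
            rw [mul_one]
            exact div_le_div_of_nonneg_left hA0.le hn1 (by
              have : (0 : ℝ) ≤ d := by positivity
              linarith)
          have h6 : A / n * 1 ≤ A / n * (B * y ^ d) :=
            mul_le_mul_of_nonneg_left this (by positivity)
          have h7 : 0 ≤ A / n * (5 / 3 - 2 * ε)⁻¹ := by positivity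
          rw [mul_assoc (A / n) B]
          linarith
        · have h3 : A / (n + 2 * d) ≤ A / n * (5 / 3 - 2 * ε)⁻¹ := by
            rw [← div_eq_mul_inv, div_div]
            refine div_le_div_of_nonneg_left hA0.le (by positivity) ?_
            push Not at hdd
            nlinarith
          have h7 : 0 ≤ A / n * B * y ^ d := by positivity
          linarith
      linarith
    calc _ = (n + 1) * (n + 2) * ((n + 2 + d).choose d : ℝ) * ∫ p in simplex, esymmTwo p ^ d *
          (symPow (n - d) (thirdMat (bary p) * offDiag)).trace := by
          rw [← hfac]; ring
      _ ≤ (n + 1) * (n + 2) * ((n + 2 + d).choose d : ℝ) * ((4 / 3) ^ n * (1 / 4) ^ d *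
          ((A / n * (5 / 3 - 2 * ε)⁻¹ + E) + A / n * B * y ^ d)) := by
          rw [← hpow]
          refine mul_le_mul_of_nonneg_left (hI.trans ?_) (by positivity)
          exact mul_le_mul_of_nonneg_left hbr (by positivity)
      _ = _ := by
          rw [div_pow y, div_pow 1, one_pow]; ring
  have hs1 := sum_choose_mul_pow_le n (x := 1 / 4) (by norm_num) (by norm_num) (range (n + 1))
  have hs2 := sum_choose_mul_pow_le n (x := y / 4) (by positivity) (by linarith) (range (n + 1))
  have hs1' : (1 / (1 - 1 / 4) : ℝ) ^ (n + 3) = (4 / 3) ^ (n + 3) := by norm_num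
  have hs2' : B * (1 / (1 - y / 4)) ^ (n + 3) ≤ r ^ n * (4 / 3) ^ (n + 3) := by
    have e1 : 1 / (1 - y / 4) = 4 / (4 - y) := by
      field_simp
    have e2 : ((4 - y) / 3) ^ n * (4 / (4 - y)) ^ n = (4 / 3) ^ n := by
      rw [← mul_pow]; congr 1; field_simp
    have e3 : 4 / (4 - y) ≤ 4 / 3 := div_le_div_of_nonneg_left (by norm_num) (by norm_num)
      (by linarith)
    calc _ = r ^ n * (4 / 3) ^ n * (4 / (4 - y)) ^ 3 := by rw [e1, hB, pow_add, ← e2]; ring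
      _ ≤ r ^ n * (4 / 3) ^ n * (4 / 3) ^ 3 := by gcongr
      _ = _ := by ring
  rw [hs1'] at hs1
  calc secondMoment n = ∑ d ∈ range (n + 1), ((n + d + 2).factorial : ℝ) / d.factorial *
      (∫ p in simplex, esymmTwo p ^ d * (symPow (n - d) (thirdMat (bary p) * offDiag)).trace) /
        n.factorial := by
        rw [secondMoment, Nat.sum_antidiagonal_eq_sum_range_succ_mk, sum_div]
    _ ≤ _ := sum_le_sum hterm
    _ = (n + 1) * (n + 2) * (4 / 3) ^ n * ((A / n * (5 / 3 - 2 * ε)⁻¹ + E) *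
          ∑ d ∈ range (n + 1), (((n + 2 + d).choose d : ℝ) * (1 / 4) ^ d) +
          A / n * B * ∑ d ∈ range (n + 1), (((n + 2 + d).choose d : ℝ) * (y / 4) ^ d)) := by
        rw [← mul_sum, sum_add_distrib, mul_sum, mul_sum]
    _ ≤ (n + 1) * (n + 2) * (4 / 3) ^ n * ((A / n * (5 / 3 - 2 * ε)⁻¹ + E) * (4 / 3) ^ (n + 3) +
          A / n * (r ^ n * (4 / 3) ^ (n + 3))) := by
        refine mul_le_mul_of_nonneg_left (add_le_add
          (mul_le_mul_of_nonneg_left hs1 (by positivity)) ?_) (by positivity)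
        rw [mul_assoc]
        refine mul_le_mul_of_nonneg_left (le_trans ?_ hs2') (by positivity)
        exact mul_le_mul_of_nonneg_left hs2 hB0.le
    _ = _ := by
        rw [hE]
        field_simp
        ring

lemma firstMoment_ge {ε : ℝ} (hε : 0 < ε) : ∃ c > 0, ∀ n : ℕ, 0 < n →
    (2 * n + 1) * (2 * n + 2) * (n.centralBinom : ℝ) * ((1 / 3) ^ n *
      (2 * Real.pi / (√3 * (3 * (1 + ε) * n)) * (1 - 2 * Real.exp (-(c * n))))) ≤
        firstMoment n := by
  obtain ⟨c, hc, h⟩ := le_integral_firstMoment hε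
  refine ⟨c, hc, fun n hn => ?_⟩
  have hfac : ((2 * n + 2).factorial : ℝ) / (n.factorial : ℝ) ^ 2 =
      (2 * n + 1) * (2 * n + 2) * (n.centralBinom : ℝ) := by
    have h1 := Nat.add_choose_mul_factorial_mul_factorial n n
    rw [← two_mul, ← Nat.centralBinom_eq_two_mul_choose] at h1
    rw [Nat.factorial_succ, Nat.factorial_succ, ← h1]
    have h4 : (n.factorial : ℝ) ≠ 0 := by positivity
    push_cast
    field_simp
    ring
  rw [firstMoment, hfac]
  exact mul_le_mul_of_nonneg_left (h n hn) (by positivity)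

/-- The first moment enters squared, so only the square of the central binomial coefficient must be
compared with `16 ^ n`. The Wallis product does this directly. -/
lemma wallis_centralBinom (n : ℕ) :
    (16 : ℝ) ^ n = (n.centralBinom : ℝ) ^ 2 * ((2 * n + 1) * Real.Wallis.W n) := by
  have h1 := Nat.add_choose_mul_factorial_mul_factorial n n
  rw [← two_mul, ← Nat.centralBinom_eq_two_mul_choose] at h1
  have h4 : (n.factorial : ℝ) ≠ 0 := by positivity
  have h5 : (n.centralBinom : ℝ) ≠ 0 := by exact_mod_cast n.centralBinom_ne_zero
  rw [Real.Wallis.W_eq_factorial_ratio, ← h1, pow_mul]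
  push_cast
  field_simp
  norm_num

lemma eventually_firstMoment_pos : ∀ᶠ n in atTop, 0 < firstMoment n := by
  obtain ⟨K, hK, h⟩ := exists_integral_ge
  filter_upwards [h, eventually_gt_atTop 0] with n hn hn0
  have hn1 : (0 : ℝ) < n := by exact_mod_cast hn0
  have := lt_of_lt_of_le (by positivity) hn
  rw [firstMoment]
  positivity

/-- The second moment of the number of perfect matchings is asymptotically at most a constant
times the square of the first moment. -/
lemma eventually_secondMoment_le {η : ℝ} (hη : 0 < η) :
    ∀ᶠ n : ℕ in atTop, secondMoment n ≤ (32 / (15 * √3) + η) * firstMoment n ^ 2 := by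
  -- For `ε → 0` the constant tends to `32 / (9 √3) * (3 / 5) = 32 / (15 √3)`.
  obtain ⟨ε, hε, hε1, hL⟩ : ∃ ε : ℝ, 0 < ε ∧ ε < 1 / 3 ∧
      32 / (9 * √3) * (1 + ε) ^ 3 / (1 - ε) * (5 / 3 - 2 * ε)⁻¹ < 32 / (15 * √3) + η := by
    have hc : ContinuousAt (fun ε : ℝ =>
        32 / (9 * √3) * (1 + ε) ^ 3 / (1 - ε) * (5 / 3 - 2 * ε)⁻¹) 0 := by
      refine ContinuousAt.mul (ContinuousAt.div (by fun_prop) (by fun_prop) (by norm_num))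
        (ContinuousAt.inv₀ (by fun_prop) (by norm_num))
    have h0 : 32 / (9 * √3) * (1 + 0) ^ 3 / (1 - 0) * (5 / 3 - 2 * 0)⁻¹ < 32 / (15 * √3) + η := by
      have : 32 / (9 * √3) * (1 + 0) ^ 3 / (1 - 0) * (5 / 3 - 2 * 0)⁻¹ = 32 / (15 * √3) := by
        field_simp
        norm_num
      linarith
    have h1 := hc.eventually (gt_mem_nhds h0)
    have h2 : ∀ᶠ ε : ℝ in 𝓝[>] 0, ε < 1 / 3 :=
      eventually_nhdsWithin_of_eventually_nhds (gt_mem_nhds (by norm_num))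
    obtain ⟨ε, ⟨h3, h4⟩, h5⟩ := ((eventually_nhdsWithin_of_eventually_nhds h1).and
      h2 |>.and self_mem_nhdsWithin).exists
    exact ⟨ε, h5, h4, h3⟩
  obtain ⟨c, r, hc, hr0, hr1, hS⟩ := secondMoment_le hε hε1
  obtain ⟨b, hb, hF⟩ := firstMoment_ge hε
  have h1ε : 0 < 1 - ε := by linarith
  have h5 : 0 < 5 / 3 - 2 * ε := by linarith
  set A := 16 / 9 * (1 + ε) * (2 * Real.pi / (√3 * (1 - ε))) with hA
  have hexp : ∀ a : ℝ, 0 < a → Tendsto (fun n : ℕ => Real.exp (-(a * n))) atTop (𝓝 0) :=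
    fun a ha => Real.tendsto_exp_neg_atTop_nhds_zero.comp
      (tendsto_natCast_atTop_atTop.const_mul_atTop ha)
  set Q : ℕ → ℝ := fun n => A * ((5 / 3 - 2 * ε)⁻¹ + r ^ n) +
          n * (n + 1) ^ 2 * Real.exp (-(c * n)) with hQ
  have hQlim : Tendsto Q atTop (𝓝 (A * (5 / 3 - 2 * ε)⁻¹)) := by
    have h1 : Tendsto (fun n : ℕ => A * ((5 / 3 - 2 * ε)⁻¹ + r ^ n)) atTop
        (𝓝 (A * ((5 / 3 - 2 * ε)⁻¹ + 0))) :=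
      (tendsto_const_nhds.add (tendsto_pow_atTop_nhds_zero_of_lt_one hr0.le hr1)).const_mul _
    have hq : Real.exp (-c) < 1 := by rw [Real.exp_lt_one_iff]; linarith
    have hp : ∀ k : ℕ, Tendsto (fun n : ℕ => (n : ℝ) ^ k * Real.exp (-c) ^ n) atTop (𝓝 0) :=
      fun k => tendsto_pow_const_mul_const_pow_of_lt_one k (Real.exp_pos _).le hq
    have h2 : Tendsto (fun n : ℕ => (n : ℝ) * (n + 1) ^ 2 * Real.exp (-(c * n))) atTop (𝓝 0) := by
      have := ((hp 3).add ((hp 2).const_mul 2)).add (hp 1)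
      simp only [mul_zero, add_zero] at this
      refine this.congr fun n => ?_
      rw [← Real.exp_nat_mul, show (n : ℝ) * -c = -(c * n) by ring]
      ring
    simpa using h1.add h2
  have he : Tendsto (fun n : ℕ => 1 - 2 * Real.exp (-(b * n))) atTop (𝓝 1) := by
    simpa using ((hexp b hb).const_mul 2).const_sub 1
  have hrat : Tendsto (fun n : ℕ => (n : ℝ) * (n + 2) / (4 * (n + 1) * (2 * n + 1))) atTop
      (𝓝 (1 / 8)) := by
    have h1 : Tendsto (fun n : ℕ => (n : ℝ)⁻¹) atTop (𝓝 0) := tendsto_inv_atTop_nhds_zero_nat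
    have h2 : Tendsto (fun n : ℕ => (1 + 2 * (n : ℝ)⁻¹) / (4 * (1 + (n : ℝ)⁻¹) *
        (2 + (n : ℝ)⁻¹))) atTop (𝓝 ((1 + 2 * 0) / (4 * (1 + 0) * (2 + 0)))) :=
      ((h1.const_mul 2).const_add 1).div (((h1.const_add 1).const_mul 4).mul (h1.const_add 2))
        (by norm_num)
    have h3 : (1 + 2 * 0) / (4 * (1 + 0) * (2 + 0)) = (1 / 8 : ℝ) := by norm_num
    rw [h3] at h2
    refine h2.congr' ?_
    filter_upwards [eventually_gt_atTop 0] with n hn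
    have hn1 : (0 : ℝ) < n := by exact_mod_cast hn
    field_simp
  set B := 2 * Real.pi / (√3 * (3 * (1 + ε))) with hB
  have hB0 : 0 < B := by positivity
  -- This is the quotient of the upper bound for the second moment by the square of the lower bound
  -- for the first.
  have hU : Tendsto (fun n : ℕ => (n : ℝ) * (n + 2) / (4 * (n + 1) * (2 * n + 1)) *
      Real.Wallis.W n * (64 / 27 / B ^ 2) * Q n / (1 - 2 * Real.exp (-(b * n))) ^ 2) atTop
      (𝓝 (1 / 8 * (Real.pi / 2) * (64 / 27 / B ^ 2) * (A * (5 / 3 - 2 * ε)⁻¹) / 1 ^ 2)) :=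
    (((hrat.mul Real.Wallis.tendsto_W_nhds_pi_div_two).mul_const _).mul hQlim).div (he.pow 2)
      (by norm_num)
  have hlim : 1 / 8 * (Real.pi / 2) * (64 / 27 / B ^ 2) * (A * (5 / 3 - 2 * ε)⁻¹) / 1 ^ 2 =
      32 / (9 * √3) * (1 + ε) ^ 3 / (1 - ε) * (5 / 3 - 2 * ε)⁻¹ := by
    have h3 : √3 ^ 2 = 3 := Real.sq_sqrt (by norm_num)
    rw [hA, hB]
    field_simp
    rw [h3]
    norm_num
  rw [hlim] at hU
  filter_upwards [hU.eventually (gt_mem_nhds hL), eventually_gt_atTop 0,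
    he.eventually (lt_mem_nhds (show (0 : ℝ) < 1 by norm_num))] with n hn hn0 hen
  have hn1 : (0 : ℝ) < n := by exact_mod_cast hn0
  have hcb : 0 < (n.centralBinom : ℝ) := by exact_mod_cast n.centralBinom_pos
  have hF2 := hF n hn0
  set e := 1 - 2 * Real.exp (-(b * n)) with hedef
  set F := (2 * n + 1) * (2 * n + 2) * (n.centralBinom : ℝ) * ((1 / 3) ^ n *
      (2 * Real.pi / (√3 * (3 * (1 + ε) * n)) * e)) with hFdef
  have hF0 : 0 < F := by positivity
  have hW := Real.Wallis.W_pos n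
  calc secondMoment n ≤ _ := hS n hn0
    _ = (n : ℝ) * (n + 2) / (4 * (n + 1) * (2 * n + 1)) *
      Real.Wallis.W n * (64 / 27 / B ^ 2) * Q n / e ^ 2 * F ^ 2 := by
        have h1 : F = (2 * n + 1) * (2 * n + 2) * (n.centralBinom : ℝ) * (1 / 3) ^ n * B / n * e :=
          by rw [hFdef, hB]; field_simp
        have h2 : (4 / 3 : ℝ) ^ (2 * n + 3) = (n.centralBinom : ℝ) ^ 2 *
            ((2 * n + 1) * Real.Wallis.W n) * ((1 / 3) ^ n) ^ 2 * (64 / 27) := by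
          rw [← wallis_centralBinom, pow_add, pow_mul, ← pow_mul (1 / 3 : ℝ), mul_comm n 2,
            pow_mul (1 / 3 : ℝ), ← mul_pow]
          norm_num
        change (n + 1) * (n + 2) * (4 / 3) ^ (2 * n + 3) / n * Q n = _
        rw [h1, h2]
        field_simp
        ring
    _ ≤ (32 / (15 * √3) + η) * F ^ 2 := by gcongr
    _ ≤ _ := by
        have : F ^ 2 ≤ firstMoment n ^ 2 := pow_le_pow_left₀ hF0.le hF2 2
        exact mul_le_mul_of_nonneg_left this (by positivity)

end RandomLift

/-! ### How a switching changes the short cycles. -/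

namespace ColouredWalk

variable {I V : Type*}

/-- A cycle of length `k`, with starting point and direction, in a graph that is given by the
neighbours `s e v` of the vertices `v` along the edges of colour `e`. -/
def IsCycle (s : I → V → V) (k : ℕ) (c : ZMod k → I) (b : ZMod k → V) : Prop :=
  (∀ j, s (c j) (b j) = b (j + 1)) ∧ (∀ j, c j ≠ c (j + 1)) ∧ Function.Injective b

/-- No nonempty reduced walk of length at most `L` leads from `U` to `U`. -/
def Avoids (s : I → V → V) (L : ℕ) (U : Set V) : Prop :=
  ∀ w : List I, w ≠ [] → w.IsChain (· ≠ ·) → w.length ≤ L → ∀ u ∈ U, w.foldr s u ∉ U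

/-- The word of the first `t` colours after the position `p`, the last one first. -/
def walkWord {k : ℕ} (c : ZMod k → I) (p : ZMod k) : ℕ → List I
  | 0 => []
  | t + 1 => c (p + t) :: walkWord c p t

lemma length_walkWord {k : ℕ} (c : ZMod k → I) (p : ZMod k) (t : ℕ) :
    (walkWord c p t).length = t := by
  induction t with
  | zero => rfl
  | succ t ih => simp [walkWord, ih]

lemma isChain_walkWord {k : ℕ} {c : ZMod k → I} (hc : ∀ j, c j ≠ c (j + 1)) (p : ZMod k)
    (t : ℕ) : (walkWord c p t).IsChain (· ≠ ·) := by
  induction t with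
  | zero => exact List.IsChain.nil
  | succ t ih =>
    cases t with
    | zero => simp [walkWord]
    | succ t =>
      have h := hc (p + t)
      rw [walkWord] at ih ⊢
      rw [walkWord]
      refine List.isChain_cons_cons.2 ⟨?_, ih⟩
      push_cast
      rw [← add_assoc]
      exact h.symm

lemma foldr_walkWord {k : ℕ} {s : I → V → V} {c : ZMod k → I} {b : ZMod k → V}
    (hb : ∀ j, s (c j) (b j) = b (j + 1)) (p : ZMod k) (t : ℕ) :
    (walkWord c p t).foldr s (b p) = b (p + t) := by
  induction t with
  | zero => simp [walkWord]
  | succ t ih => simp [walkWord, ih, hb, add_assoc]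

/-- Going once around a cycle is a nonempty reduced walk from each of its vertices to itself. -/
lemma IsCycle.notMem {s : I → V → V} {L : ℕ} {U : Set V} (hU : Avoids s L U) {k : ℕ}
    {c : ZMod k → I} {b : ZMod k → V} (h : IsCycle s k c b) (hk : k ≠ 0) (hkL : k ≤ L)
    (p : ZMod k) : b p ∉ U := fun hp => by
  have h1 := foldr_walkWord h.1 p k
  rw [CharP.cast_eq_zero, add_zero] at h1
  refine hU (walkWord c p k) ?_ (isChain_walkWord h.2.1 p k) (by rwa [length_walkWord]) _ hp
    (h1.symm ▸ hp)
  rw [← List.length_pos_iff, length_walkWord]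
  omega

/-- The graph `s'` is obtained from `s` by inserting edges with half-edges `H`. -/
structure IsSwitch (s s' : I → V → V) (H : I → V → Prop) (U : Set V) : Prop where
  invol : ∀ e v, s e (s e v) = v
  invol' : ∀ e v, s' e (s' e v) = v
  mem : ∀ e v, H e v → v ∈ U
  closed : ∀ e v, H e v → H e (s' e v)
  eq_of : ∀ e v, ¬ H e v → ¬ H e (s e v) → s' e v = s e v

/-- An edge of `s'` that is neither inserted nor an edge of `s` arises by exchange: both of its ends
have lost their old edge of this colour, and the other end of that old edge is in `U`. -/
lemma IsSwitch.mem_of_ne {s s' : I → V → V} {H : I → V → Prop} {U : Set V}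
    (h : IsSwitch s s' H U) {e : I} {v : V} (hv : ¬ H e v) (hne : s' e v ≠ s e v) :
    s e v ∈ U ∧ s e (s' e v) ∈ U := by
  refine ⟨h.mem e _ (by_contra fun h1 => hne (h.eq_of e v hv h1)), ?_⟩
  refine h.mem e _ (by_contra fun h1 => ?_)
  have h2 : ¬ H e (s' e v) := fun h3 => hv (by simpa [h.invol'] using h.closed _ _ h3)
  have h3 := h.eq_of e _ h2 h1
  rw [h.invol'] at h3
  exact hne (by rw [h3, h.invol, ← h3])

/-- After a walk of unchanged edges that starts in `U`, the next edge is unchanged. -/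
lemma IsSwitch.run {s s' : I → V → V} {H : I → V → Prop} {U : Set V} {L : ℕ}
    (h : IsSwitch s s' H U) (hU : Avoids s L U) {k : ℕ} {c : ZMod k → I} {b : ZMod k → V}
    (hcyc : IsCycle s' k c b) {p : ZMod k} {u : V} (hu : u ∈ U) (hup : s (c p) u = b (p + 1))
    (t : ℕ) (ht : t + 2 ≤ L) :
    (walkWord c p (t + 1)).foldr s u = b (p + 1 + t) ∧
      ¬ H (c (p + 1 + t)) (b (p + 1 + t)) ∧
      s' (c (p + 1 + t)) (b (p + 1 + t)) = s (c (p + 1 + t)) (b (p + 1 + t)) := by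
  -- The vertex reached and its next neighbour in `s` are ends of reduced walks from `u ∈ U` with at
  -- most `L` letters, so neither lies in `U`. Hence the next edge is neither inserted nor
  -- exchanged.
  have key : ∀ t : ℕ, t + 2 ≤ L → (walkWord c p (t + 1)).foldr s u = b (p + 1 + t) →
      ¬ H (c (p + 1 + t)) (b (p + 1 + t)) ∧
      s' (c (p + 1 + t)) (b (p + 1 + t)) = s (c (p + 1 + t)) (b (p + 1 + t)) := by
    intro t ht h1
    have h2 := hU (walkWord c p (t + 1)) (by simp [walkWord]) (isChain_walkWord hcyc.2.1 p _)
      (by rw [length_walkWord]; omega) u hu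
    have h3 := hU (walkWord c p (t + 1 + 1)) (by simp [walkWord]) (isChain_walkWord hcyc.2.1 p _)
      (by rw [length_walkWord]; omega) u hu
    rw [walkWord, List.foldr_cons, h1, show p + ((t + 1 : ℕ) : ZMod k) = p + 1 + t by
      push_cast; ring] at h3
    rw [h1] at h2
    have h4 : ¬ H (c (p + 1 + t)) (b (p + 1 + t)) := fun h5 => h2 (h.mem _ _ h5)
    exact ⟨h4, by_contra fun h5 => h3 (h.mem_of_ne h4 h5).1⟩
  suffices h1 : ∀ t : ℕ, t + 2 ≤ L → (walkWord c p (t + 1)).foldr s u = b (p + 1 + t) from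
    ⟨h1 t ht, key t ht (h1 t ht)⟩
  intro t
  induction t with
  | zero => intro _; simp [walkWord, hup]
  | succ t ih =>
    intro ht
    have h1 := ih (by omega)
    have h2 := (key t (by omega) h1).2
    rw [hcyc.1] at h2
    rw [walkWord, List.foldr_cons, h1, show p + ((t + 1 : ℕ) : ZMod k) = p + 1 + t by
      push_cast; ring, ← h2]
    congr 1
    push_cast
    ring

/-- A short cycle of `s'` cannot mix old and new edges. An exchanged edge ends in an `s`-neighbour
of `U`, and from there `run` follows unchanged edges around the cycle back to that very edge. A
passage from an inserted edge to one that is not inserted also starts such a run. Going round takes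
`k + 1` letters, hence `k + 1 ≤ L`. -/
lemma IsSwitch.dichotomy {s s' : I → V → V} {H : I → V → Prop} {U : Set V} {L : ℕ}
    (h : IsSwitch s s' H U) (hU : Avoids s L U) {k : ℕ} [NeZero k] (hk : k + 1 ≤ L)
    {c : ZMod k → I} {b : ZMod k → V} (hcyc : IsCycle s' k c b) :
    (∀ q, H (c q) (b q)) ∨
      ∀ q, ¬ H (c q) (b q) ∧ s' (c q) (b q) = s (c q) (b q) := by
  have run : ∀ (p : ZMod k) (u : V), u ∈ U → s (c p) u = b (p + 1) →
      ∀ q, ¬ H (c q) (b q) ∧ s' (c q) (b q) = s (c q) (b q) := by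
    intro p u hu hup q
    have hlt := ZMod.val_lt (q - (p + 1))
    have := (h.run hU hcyc hu hup (q - (p + 1)).val (by omega)).2
    rwa [ZMod.natCast_zmod_val, add_sub_cancel] at this
  by_cases hsc : ∃ p, ¬ H (c p) (b p) ∧ s' (c p) (b p) ≠ s (c p) (b p)
  · obtain ⟨p, hp, hp'⟩ := hsc
    have h2 := (h.mem_of_ne hp hp').2
    rw [hcyc.1] at h2
    exact absurd (run p _ h2 (h.invol _ _) p).2 hp'
  push Not at hsc
  by_cases hall : ∀ q, H (c q) (b q)
  · exact Or.inl hall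
  suffices hH : ∀ q, ¬ H (c q) (b q) from Or.inr fun q => ⟨hH q, hsc q (hH q)⟩
  intro q
  push Not at hall
  obtain ⟨q0, hq0⟩ := hall
  -- The induction goes backwards along the cycle: the first inserted edge met would end at a vertex
  -- of `U` and start a run that reaches this edge again.
  suffices h1 : ∀ t : ℕ, ¬ H (c (q0 - t)) (b (q0 - t)) by
    have := h1 (q0 - q).val
    rwa [ZMod.natCast_zmod_val, sub_sub_cancel] at this
  intro t
  induction t with
  | zero => simpa using hq0
  | succ t ih =>
    intro h2
    have h3 := h.mem _ _ (h.closed _ _ h2)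
    rw [hcyc.1] at h3
    have h4 : q0 - ((t + 1 : ℕ) : ZMod k) + 1 = q0 - t := by push_cast; ring
    rw [h4] at h3
    have h5 := hsc _ ih
    rw [hcyc.1] at h5
    exact (run _ _ h3 h5.symm _).1 h2

/-- The half-edges of a closed walk. -/
def halfEdges {k : ℕ} (c : ZMod k → I) (b : ZMod k → V) (e : I) (v : V) : Prop :=
  ∃ j, c j = e ∧ (b j = v ∨ b (j + 1) = v)

lemma IsCycle.reverse {s : I → V → V} (hs : ∀ e v, s e (s e v) = v) {k : ℕ} {c : ZMod k → I}
    {b : ZMod k → V} (h : IsCycle s k c b) :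
    IsCycle s k (fun t => c (-t - 1)) (fun t => b (-t)) := by
  refine ⟨fun t => ?_, fun t => ?_, fun t t' ht => neg_injective (h.2.2 ht)⟩
  · have := h.1 (-t - 1)
    rw [sub_add_cancel] at this
    change s (c (-t - 1)) (b (-t)) = b (-(t + 1))
    rw [← this, hs]
    congr 1
    ring
  · have := h.2.1 (-t - 1 - 1)
    rw [sub_add_cancel] at this
    change c (-t - 1) ≠ c (-(t + 1) - 1)
    rw [show -(t + 1) - 1 = -t - 1 - 1 by ring]
    exact this.symm

lemma IsCycle.rotate {s : I → V → V} {k : ℕ} {c : ZMod k → I}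
    {b : ZMod k → V} (h : IsCycle s k c b) (p : ZMod k) :
    IsCycle s k (fun t => c (p + t)) (fun t => b (p + t)) :=
  ⟨fun t => by simp [h.1, add_assoc], fun t => by simpa [add_assoc] using h.2.1 (p + t),
    fun t t' ht => add_left_cancel (h.2.2 ht)⟩

lemma halfEdges_reverse {k : ℕ} (c : ZMod k → I) (b : ZMod k → V) :
    halfEdges (fun t => c (-t - 1)) (fun t => b (-t)) = halfEdges c b := by
  ext e v
  constructor
  · rintro ⟨j, h1, h2⟩
    refine ⟨-j - 1, h1, ?_⟩
    rw [sub_add_cancel]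
    change b (-j) = v ∨ b (-(j + 1)) = v at h2
    rwa [neg_add', or_comm] at h2
  · rintro ⟨j, h1, h2⟩
    refine ⟨-j - 1, ?_, ?_⟩
    · simpa using h1
    · simpa [or_comm, add_comm] using h2

/-- A cycle that runs along the edges of another one cannot turn round, because consecutive colours
differ; it keeps the direction of its first edge. -/
lemma IsCycle.eq_rotate {s : I → V → V} {k : ℕ} {c : ZMod k → I} {b : ZMod k → V}
    (h : IsCycle s k c b) {j : ℕ} {c' : ZMod j → I} {b' : ZMod j → V} (h' : IsCycle s j c' b')
    (hH : ∀ q, halfEdges c b (c' q) (b' q)) {p : ZMod k} (hp : b' 0 = b p) (hc : c' 0 = c p)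
    (t : ℕ) : b' t = b (p + t) ∧ c' t = c (p + t) := by
  induction t with
  | zero => simp [hp, hc]
  | succ t ih =>
    have h1 : b' (t + 1) = b (p + t + 1) := by rw [← h'.1, ih.1, ih.2, h.1]
    push_cast
    rw [← add_assoc]
    refine ⟨h1, ?_⟩
    obtain ⟨i, hi, h2 | h2⟩ := hH (t + 1)
    · rw [h1] at h2
      rw [← hi, h.2.2 h2]
    · rw [h1] at h2
      have h3 := add_right_cancel (h.2.2 h2)
      rw [h3, ← ih.2] at hi
      exact absurd hi (h'.2.1 t)

lemma IsCycle.length_eq {s : I → V → V} {k : ℕ} {c : ZMod k → I} {b : ZMod k → V}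
    (h : IsCycle s k c b) {j : ℕ} {c' : ZMod j → I} {b' : ZMod j → V} (h' : IsCycle s j c' b')
    (hH : ∀ q, halfEdges c b (c' q) (b' q)) {p : ZMod k} (hp : b' 0 = b p) (hc : c' 0 = c p) :
    j = k := by
  have key := fun t => (h.eq_rotate h' hH hp hc t).1
  refine Nat.dvd_antisymm ?_ ?_
  · have := key k
    rw [CharP.cast_eq_zero (ZMod k) k, add_zero, ← hp] at this
    exact (ZMod.natCast_eq_zero_iff _ _).1 (h'.2.2 this)
  · have := key j
    rw [CharP.cast_eq_zero (ZMod j) j, hp] at this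
    have h2 := h.2.2 this
    exact (ZMod.natCast_eq_zero_iff _ _).1 (by simpa using h2.symm)

/-- The cycle `(c, b)` with another starting point and direction. -/
def rooting {k : ℕ} (c : ZMod k → I) (b : ZMod k → V) (x : ZMod k × Bool) :
    (ZMod k → I) × (ZMod k → V) :=
  if x.2 then (fun t => c (-(-x.1 + t) - 1), fun t => b (-(-x.1 + t)))
    else (fun t => c (x.1 + t), fun t => b (x.1 + t))

lemma IsCycle.rooting {s : I → V → V} (hs : ∀ e v, s e (s e v) = v) {k : ℕ} {c : ZMod k → I}
    {b : ZMod k → V} (h : IsCycle s k c b) (x : ZMod k × Bool) :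
    IsCycle s k (rooting c b x).1 (rooting c b x).2 := by
  unfold ColouredWalk.rooting
  split_ifs
  · exact (h.reverse hs).rotate (-x.1)
  · exact h.rotate x.1

lemma IsCycle.rooting_injective {s : I → V → V} {k : ℕ} {c : ZMod k → I}
    {b : ZMod k → V} (h : IsCycle s k c b) : Function.Injective (ColouredWalk.rooting c b) := by
  have h0 : ∀ x, (ColouredWalk.rooting c b x).2 0 = b x.1 := fun x => by
    unfold ColouredWalk.rooting; split_ifs <;> simp
  have h1 : ∀ x, (ColouredWalk.rooting c b x).1 0 = if x.2 then c (x.1 - 1) else c x.1 :=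
    fun x => by unfold ColouredWalk.rooting; split_ifs <;> simp
  rintro ⟨p, o⟩ ⟨p', o'⟩ hx
  have hp : p = p' := h.2.2 (by rw [← h0 (p, o), hx, h0])
  subst hp
  have h2 := h1 (p, o)
  rw [hx, h1] at h2
  have h3 := h.2.1 (p - 1)
  rw [sub_add_cancel] at h3
  cases o <;> cases o' <;> simp_all

lemma IsCycle.exists_rooting {s : I → V → V} (hs : ∀ e v, s e (s e v) = v) {k : ℕ}
    {c : ZMod k → I} {b : ZMod k → V}
    (h : IsCycle s k c b) {j : ℕ} [NeZero j] {c' : ZMod j → I} {b' : ZMod j → V}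
    (h' : IsCycle s j c' b') (hH : ∀ q, halfEdges c b (c' q) (b' q)) : j = k ∧
      ∃ x, ∀ t : ℕ, c' t = (ColouredWalk.rooting c b x).1 t ∧
        b' t = (ColouredWalk.rooting c b x).2 t := by
  obtain ⟨p, hp, h1 | h1⟩ := hH 0
  · refine ⟨h.length_eq h' hH h1.symm hp.symm, (p, false), fun t => ?_⟩
    exact (h.eq_rotate h' hH h1.symm hp.symm t).symm
  · have hH' := hH
    rw [← halfEdges_reverse] at hH'
    have h2 : b' 0 = (fun t => b (-t)) (-(p + 1)) := by simp [h1]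
    have h3 : c' 0 = (fun t => c (-t - 1)) (-(p + 1)) := by simp [hp]
    refine ⟨(h.reverse hs).length_eq h' hH' h2 h3, (p + 1, true), fun t => ?_⟩
    exact ((h.reverse hs).eq_rotate h' hH' h2 h3 t).symm

open Classical in
/-- The number of cycles of length `k`, with starting point and direction. -/
noncomputable def cycleCount [Fintype I] [Fintype V] (s : I → V → V) (k : ℕ) [NeZero k] : ℕ :=
  (Finset.univ.filter fun α : (ZMod k → I) × (ZMod k → V) => IsCycle s k α.1 α.2).card

/-- The cycles after the insertion of the edges of the cycle `(c, b)`. -/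
lemma IsSwitch.isCycle_iff {s s' : I → V → V} {L : ℕ} {k : ℕ} {c : ZMod k → I} {b : ZMod k → V}
    (h : IsSwitch s s' (halfEdges c b) (Set.range b)) (hU : Avoids s L (Set.range b))
    (hcb : IsCycle s' k c b) {j : ℕ} [NeZero j] (hj : j + 1 ≤ L) (c' : ZMod j → I)
    (b' : ZMod j → V) : IsCycle s' j c' b' ↔ IsCycle s j c' b' ∨ (j = k ∧
      ∃ x, ∀ t : ℕ, c' t = (rooting c b x).1 t ∧ b' t = (rooting c b x).2 t) := by
  constructor
  · intro h'
    rcases h.dichotomy hU hj h' with h1 | h1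
    · exact Or.inr (hcb.exists_rooting h.invol' h' h1)
    · exact Or.inl ⟨fun q => by rw [← (h1 q).2, h'.1], h'.2⟩
  · rintro (h' | ⟨rfl, x, hx⟩)
    · have h1 := h'.notMem hU (NeZero.ne j) (by omega)
      refine ⟨fun q => ?_, h'.2⟩
      rw [h.eq_of _ _ (fun h2 => h1 q (h.mem _ _ h2))
        (fun h2 => h1 (q + 1) (by rw [← h'.1]; exact h.mem _ _ h2)), h'.1]
    · have h1 : c' = (rooting c b x).1 := funext fun t => by
        have := (hx t.val).1; rwa [ZMod.natCast_zmod_val] at this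
      have h2 : b' = (rooting c b x).2 := funext fun t => by
        have := (hx t.val).2; rwa [ZMod.natCast_zmod_val] at this
      rw [h1, h2]
      exact hcb.rooting h.invol' x

/-- The new cycles are the rootings of the inserted one: `k` starting points and two directions,
which remain distinguishable for `k = 2` by the colours. -/
lemma IsSwitch.cycleCount_eq [Fintype I] [Fintype V] {s s' : I → V → V} {L : ℕ} {k : ℕ}
    [NeZero k] {c : ZMod k → I} {b : ZMod k → V}
    (h : IsSwitch s s' (halfEdges c b) (Set.range b)) (hU : Avoids s L (Set.range b))
    (hcb : IsCycle s' k c b) {j : ℕ} [NeZero j] (hj : j + 1 ≤ L) :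
    cycleCount s' j = cycleCount s j + if j = k then 2 * k else 0 := by
  classical
  unfold cycleCount
  split_ifs with hjk
  · subst hjk
    have h1 : (Finset.univ.filter fun α : (ZMod j → I) × (ZMod j → V) =>
        IsCycle s' j α.1 α.2) = (Finset.univ.filter fun α : (ZMod j → I) × (ZMod j → V) =>
        IsCycle s j α.1 α.2) ∪ Finset.univ.image (rooting c b) := by
      ext ⟨c', b'⟩
      simp only [Finset.mem_filter, Finset.mem_univ, true_and, Finset.mem_union,
        Finset.mem_image, h.isCycle_iff hU hcb hj]
      refine or_congr Iff.rfl (exists_congr fun x => ?_)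
      rw [Prod.ext_iff, funext_iff, funext_iff, ← forall_and]
      refine ⟨fun h1 t => ?_, fun h1 t => ⟨((h1 t).1).symm, ((h1 t).2).symm⟩⟩
      have := h1 t.val
      rw [ZMod.natCast_zmod_val] at this
      exact ⟨this.1.symm, this.2.symm⟩
    rw [h1, Finset.card_union_of_disjoint, Finset.card_image_of_injective _ hcb.rooting_injective]
    · simp [ZMod.card, mul_comm]
    · rw [Finset.disjoint_left]
      intro α hα hα'
      obtain ⟨x, -, rfl⟩ := Finset.mem_image.1 hα'
      refine ((Finset.mem_filter.1 hα).2).notMem hU (NeZero.ne j) (by omega) 0 ?_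
      unfold rooting
      split_ifs <;> simp
  · rw [add_zero]
    congr 1
    ext ⟨c', b'⟩
    simp [h.isCycle_iff hU hcb hj, hjk]

end ColouredWalk

/-! ### Inserting edges into a lift by transpositions. -/

namespace RandomLift

open Finset ColouredWalk

variable {n : ℕ} {T : Type*} [DecidableEq T]

/-- The lift `σ`, changed by a switching such that the edge `t` of colour `t.1` from `t.2.1` to
`t.2.2` is present. -/
def insertEdge (t : Fin 3 × Fin n × Fin n) (σ : Fin 3 → Equiv.Perm (Fin n)) :
    Fin 3 → Equiv.Perm (Fin n) :=
  Function.update σ t.1 (Equiv.swap (σ t.1 t.2.1) t.2.2 * σ t.1)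

/-- The lift `σ` after the successive insertion of edges. -/
def insertEdges (l : List (Fin 3 × Fin n × Fin n)) (σ : Fin 3 → Equiv.Perm (Fin n)) :
    Fin 3 → Equiv.Perm (Fin n) :=
  l.foldr insertEdge σ

/-- The lifts that respect the classes and contain given edges. -/
def modelWith (κ : Fin 3 → Vert n → T) (l : List (Fin 3 × Fin n × Fin n)) :
    Finset (Fin 3 → Equiv.Perm (Fin n)) :=
  (model κ).filter fun σ => ∀ t ∈ l, σ t.1 t.2.1 = t.2.2

/-- The edges `t` and `t'` do not share a half-edge. -/
def Separate (t t' : Fin 3 × Fin n × Fin n) : Prop :=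
  t.1 = t'.1 → t.2.1 ≠ t'.2.1 ∧ t.2.2 ≠ t'.2.2

open Classical in
/-- The possible endpoints of the edge at `t.2.1` when the edges `l` are given. -/
noncomputable def available (κ : Fin 3 → Vert n → T) (l : List (Fin 3 × Fin n × Fin n))
    (t : Fin 3 × Fin n × Fin n) : Finset (Fin n) :=
  univ.filter fun z => κ t.1 (true, z) = κ t.1 (true, t.2.2) ∧
    ∀ t' ∈ l, t'.1 = t.1 → t'.2.2 ≠ z

lemma mem_available {κ : Fin 3 → Vert n → T} {l : List (Fin 3 × Fin n × Fin n)}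
    {t : Fin 3 × Fin n × Fin n} {z : Fin n} : z ∈ available κ l t ↔
      κ t.1 (true, z) = κ t.1 (true, t.2.2) ∧ ∀ t' ∈ l, t'.1 = t.1 → t'.2.2 ≠ z := by
  simp [available]

lemma insertEdge_apply_of_ne {t : Fin 3 × Fin n × Fin n} {σ : Fin 3 → Equiv.Perm (Fin n)}
    {e : Fin 3} (h : e ≠ t.1) : insertEdge t σ e = σ e := by
  simp [insertEdge, h]

lemma insertEdge_apply_self (t : Fin 3 × Fin n × Fin n) (σ : Fin 3 → Equiv.Perm (Fin n)) :
    insertEdge t σ t.1 = Equiv.swap (σ t.1 t.2.1) t.2.2 * σ t.1 := by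
  simp [insertEdge]

lemma insertEdge_mem {κ : Fin 3 → Vert n → T} {l : List (Fin 3 × Fin n × Fin n)}
    {t : Fin 3 × Fin n × Fin n} (ht : κ t.1 (true, t.2.2) = κ t.1 (false, t.2.1))
    (hl : ∀ t' ∈ l, Separate t t') {σ : Fin 3 → Equiv.Perm (Fin n)}
    (hσ : σ ∈ modelWith κ l) : insertEdge t σ ∈ modelWith κ (t :: l) := by
  obtain ⟨h1, h2⟩ := mem_filter.1 hσ
  rw [mem_model_iff_comp] at h1
  refine mem_filter.2 ⟨mem_model_iff_comp.2 fun e x => ?_, fun t' ht' => ?_⟩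
  · by_cases he : e = t.1
    · subst he
      rw [insertEdge_apply_self, Equiv.Perm.mul_apply, Equiv.swap_apply_def]
      split_ifs with h3 h4
      · rw [(σ t.1).injective h3, ht]
      · rw [h1, ← ht, ← h4, h1]
      · exact h1 _ _
    · rw [insertEdge_apply_of_ne he, h1]
  · rcases List.mem_cons.1 ht' with rfl | ht'
    · rw [insertEdge_apply_self, Equiv.Perm.mul_apply, Equiv.swap_apply_left]
    · by_cases he : t'.1 = t.1
      · obtain ⟨h3, h4⟩ := hl t' ht' he.symm
        have h5 := h2 t' ht'
        rw [he] at h5 ⊢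
        rw [insertEdge_apply_self, Equiv.Perm.mul_apply, h5, Equiv.swap_apply_of_ne_of_ne]
        · rw [← h5]
          exact fun h6 => h3 ((σ t.1).injective h6).symm
        · exact h4.symm
      · rw [insertEdge_apply_of_ne he, h2 t' ht']

/-- All fibres of a switching have the same size. -/
lemma card_fiber_insertEdge {κ : Fin 3 → Vert n → T} {l : List (Fin 3 × Fin n × Fin n)}
    {t : Fin 3 × Fin n × Fin n} (ht : κ t.1 (true, t.2.2) = κ t.1 (false, t.2.1))
    (hl : ∀ t' ∈ l, Separate t t') {σ' : Fin 3 → Equiv.Perm (Fin n)}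
    (hσ' : σ' ∈ modelWith κ (t :: l)) :
    ((modelWith κ l).filter fun σ => insertEdge t σ = σ').card = (available κ l t).card := by
  obtain ⟨h1, h2⟩ := mem_filter.1 hσ'
  rw [mem_model_iff_comp] at h1
  have hxy := h2 t List.mem_cons_self
  -- A preimage is determined by the endpoint `z` that the edge at `t.2.1` had before the switching,
  -- and every available `z` occurs.
  refine card_nbij' (fun σ => σ t.1 t.2.1)
    (fun z => Function.update σ' t.1 (Equiv.swap z t.2.2 * σ' t.1)) ?_ ?_ ?_ ?_
  · intro σ hσ
    obtain ⟨h3, -⟩ := mem_filter.1 hσ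
    obtain ⟨h3, h5⟩ := mem_filter.1 h3
    rw [mem_model_iff_comp] at h3
    refine mem_coe.2 (mem_available.2 ⟨?_, fun t' ht' he h6 => ?_⟩)
    · rw [h3, ht]
    · have h7 := h5 t' ht'
      rw [he] at h7
      exact (hl t' ht' he.symm).1 ((σ t.1).injective (h7.trans h6)).symm
  · intro z hz
    obtain ⟨h3, h4⟩ := mem_available.1 (mem_coe.1 hz)
    beta_reduce
    refine mem_coe.2 (mem_filter.2 ⟨mem_filter.2 ⟨mem_model_iff_comp.2 fun e x => ?_,
      fun t' ht' => ?_⟩, ?_⟩)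
    · by_cases he : e = t.1
      · subst he
        rw [Function.update_self, Equiv.Perm.mul_apply, Equiv.swap_apply_def]
        split_ifs with h5 h6
        · rw [← h1, h5, h3]
        · rw [← h1, h6, h3]
        · exact h1 _ _
      · rw [Function.update_of_ne he, h1]
    · have h5 := h2 t' (List.mem_cons_of_mem _ ht')
      by_cases he : t'.1 = t.1
      · obtain ⟨-, h7⟩ := hl t' ht' he.symm
        rw [he] at h5 ⊢
        rw [Function.update_self, Equiv.Perm.mul_apply, h5, Equiv.swap_apply_of_ne_of_ne]
        · exact h4 t' ht' he
        · exact h7.symm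
      · rw [Function.update_of_ne he, h5]
    · rw [insertEdge, Function.update_self, Function.update_idem, Equiv.Perm.mul_apply, hxy,
        Equiv.swap_apply_right, ← mul_assoc, Equiv.swap_mul_self, one_mul,
        Function.update_eq_self]
  · intro σ hσ
    obtain ⟨-, rfl⟩ := mem_filter.1 (mem_coe.1 hσ)
    simp only
    rw [insertEdge_apply_self, insertEdge, Function.update_idem, ← mul_assoc,
      Equiv.swap_mul_self, one_mul, Function.update_eq_self]
  · intro z _
    simp [hxy]

/-- The number of lifts that are mapped to the same lift by the insertion of edges. -/
noncomputable def fiberCard (κ : Fin 3 → Vert n → T) : List (Fin 3 × Fin n × Fin n) → ℕ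
  | [] => 1
  | t :: l => (available κ l t).card * fiberCard κ l

/-- All fibres of a single insertion have the same size. So inserting the list into a uniform lift
of the model gives a uniform lift among those that contain the list. -/
lemma sum_insertEdges {κ : Fin 3 → Vert n → T} {l : List (Fin 3 × Fin n × Fin n)}
    (hκ : ∀ t ∈ l, κ t.1 (true, t.2.2) = κ t.1 (false, t.2.1)) (hl : l.Pairwise Separate)
    (F : (Fin 3 → Equiv.Perm (Fin n)) → ℝ) :
    ∑ σ ∈ model κ, F (insertEdges l σ) = fiberCard κ l * ∑ σ ∈ modelWith κ l, F σ := by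
  induction l generalizing F with
  | nil => simp [insertEdges, fiberCard, modelWith]
  | cons t l ih =>
    rw [List.pairwise_cons] at hl
    have h1 := ih (fun t' ht' => hκ t' (List.mem_cons_of_mem _ ht')) hl.2
      fun σ => F (insertEdge t σ)
    have h2 := fun σ (hσ : σ ∈ modelWith κ l) =>
      insertEdge_mem (hκ t List.mem_cons_self) hl.1 hσ
    calc _ = (fiberCard κ l : ℝ) * ∑ σ ∈ modelWith κ l, F (insertEdge t σ) := h1
      _ = (fiberCard κ l : ℝ) * ∑ σ' ∈ modelWith κ (t :: l), (available κ l t).card * F σ' := by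
          rw [← sum_fiberwise_of_maps_to h2]
          congr 1
          refine sum_congr rfl fun σ' hσ' => ?_
          rw [← card_fiber_insertEdge (hκ t List.mem_cons_self) hl.1 hσ', ← nsmul_eq_mul]
          refine sum_eq_card_nsmul fun σ hσ => ?_
          rw [(mem_filter.1 hσ).2]
      _ = _ := by
          rw [← mul_sum, fiberCard]
          push_cast
          ring

lemma insertEdges_mem {κ : Fin 3 → Vert n → T} {l : List (Fin 3 × Fin n × Fin n)}
    (hκ : ∀ t ∈ l, κ t.1 (true, t.2.2) = κ t.1 (false, t.2.1)) (hl : l.Pairwise Separate)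
    {σ : Fin 3 → Equiv.Perm (Fin n)} (hσ : σ ∈ model κ) : insertEdges l σ ∈ modelWith κ l := by
  induction l with
  | nil => simpa [insertEdges, modelWith] using hσ
  | cons t l ih =>
    rw [List.pairwise_cons] at hl
    exact insertEdge_mem (hκ t List.mem_cons_self) hl.1
      (ih (fun t' ht' => hκ t' (List.mem_cons_of_mem _ ht')) hl.2)

/-- The half-edges of a list of edges. -/
def ends (l : List (Fin 3 × Fin n × Fin n)) (e : Fin 3) (v : Vert n) : Prop :=
  ∃ t ∈ l, t.1 = e ∧ (v = (false, t.2.1) ∨ v = (true, t.2.2))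

lemma step_insertEdge {t : Fin 3 × Fin n × Fin n} {σ : Fin 3 → Equiv.Perm (Fin n)} {e : Fin 3}
    {v : Vert n} (h1 : t.1 = e → v ≠ (false, t.2.1) ∧ v ≠ (true, t.2.2))
    (h2 : t.1 = e → step σ e v ≠ (false, t.2.1) ∧ step σ e v ≠ (true, t.2.2)) :
    step (insertEdge t σ) e v = step σ e v := by
  by_cases he : e = t.1
  · subst he
    specialize h1 rfl
    specialize h2 rfl
    rcases v with ⟨_ | _, x⟩
    · have h3 : x ≠ t.2.1 := fun h => h1.1 (by rw [h])
      have h4 : σ t.1 x ≠ t.2.2 := fun h => h2.2 (by simp [h])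
      rw [step_false, step_false, insertEdge_apply_self, Equiv.Perm.mul_apply,
        Equiv.swap_apply_of_ne_of_ne (fun h => h3 ((σ t.1).injective h)) h4]
    · have h3 : x ≠ t.2.2 := fun h => h1.2 (by rw [h])
      have h4 : (σ t.1).symm x ≠ t.2.1 := fun h => h2.1 (by simp [h])
      rw [step_true, step_true, insertEdge_apply_self]
      congr 1
      rw [Equiv.symm_apply_eq, Equiv.Perm.mul_apply, Equiv.apply_symm_apply,
        Equiv.swap_apply_of_ne_of_ne (fun h => h4 (by rw [h, Equiv.symm_apply_apply])) h3]
  · rcases v with ⟨_ | _, x⟩ <;> simp [insertEdge_apply_of_ne he]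

lemma step_insertEdges {l : List (Fin 3 × Fin n × Fin n)} {σ : Fin 3 → Equiv.Perm (Fin n)}
    {e : Fin 3} {v : Vert n} (h1 : ¬ ends l e v) (h2 : ¬ ends l e (step σ e v)) :
    step (insertEdges l σ) e v = step σ e v := by
  induction l with
  | nil => rfl
  | cons t l ih =>
    have h3 : ∀ w, ¬ ends (t :: l) e w → ¬ ends l e w ∧
        (t.1 = e → w ≠ (false, t.2.1) ∧ w ≠ (true, t.2.2)) := fun w hw =>
      ⟨fun ⟨t', h, h'⟩ => hw ⟨t', List.mem_cons_of_mem _ h, h'⟩, fun he =>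
        ⟨fun h => hw ⟨t, List.mem_cons_self, he, Or.inl h⟩,
          fun h => hw ⟨t, List.mem_cons_self, he, Or.inr h⟩⟩⟩
    have h4 := ih (h3 _ h1).1 (h3 _ h2).1
    rw [insertEdges, List.foldr_cons, ← insertEdges, step_insertEdge (h3 _ h1).2, h4]
    rw [h4]
    exact (h3 _ h2).2

/-- The number of vertices that an edge of the colour and class of `t` can end in. -/
def classSize (κ : Fin 3 → Vert n → T) (t : Fin 3 × Fin n × Fin n) : ℕ :=
  (univ.filter fun z => κ t.1 (true, z) = κ t.1 (true, t.2.2)).card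

lemma card_available_le (κ : Fin 3 → Vert n → T) (l : List (Fin 3 × Fin n × Fin n))
    (t : Fin 3 × Fin n × Fin n) : (available κ l t).card ≤ classSize κ t :=
  card_le_card fun z hz => by
    have := (mem_available.1 hz).1
    simpa using this

lemma classSize_le (κ : Fin 3 → Vert n → T) (l : List (Fin 3 × Fin n × Fin n))
    (t : Fin 3 × Fin n × Fin n) : classSize κ t ≤ (available κ l t).card + l.length := by
  classical
  have h : (univ.filter fun z => κ t.1 (true, z) = κ t.1 (true, t.2.2)) ⊆
      available κ l t ∪ (l.map fun t' => t'.2.2).toFinset := by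
    intro z hz
    by_cases h1 : ∃ t' ∈ l, t'.2.2 = z
    · simp [h1]
    · push Not at h1
      exact mem_union_left _ (mem_available.2 ⟨(mem_filter.1 hz).2,
        fun t' ht' _ => h1 t' ht'⟩)
  refine (card_le_card h).trans ((card_union_le _ _).trans ?_)
  gcongr
  exact (List.toFinset_card_le _).trans (by simp)

end RandomLift

/-! ### The switching identity for cycle counts. -/

namespace RandomLift

open Finset ColouredWalk

variable {n : ℕ} {T : Type*} [DecidableEq T]

/-- The closed walks that may be cycles of a lift that respects the classes `κ`. -/
def Admissible (κ : Fin 3 → Vert n → T) {k : ℕ} (c : ZMod k → Fin 3) (b : ZMod k → Vert n) :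
    Prop :=
  (∀ j, (b (j + 1)).1 = !(b j).1) ∧ (∀ j, κ (c j) (b (j + 1)) = κ (c j) (b j)) ∧
    (∀ j, c j ≠ c (j + 1)) ∧ Function.Injective b

/-- The `j`-th edge of a closed walk. -/
def cycleEdge {k : ℕ} (c : ZMod k → Fin 3) (b : ZMod k → Vert n) (j : ZMod k) :
    Fin 3 × Fin n × Fin n :=
  if (b j).1 then (c j, (b (j + 1)).2, (b j).2) else (c j, (b j).2, (b (j + 1)).2)

/-- The edges of a closed walk. -/
noncomputable def cycleEdges {k : ℕ} [NeZero k] (c : ZMod k → Fin 3) (b : ZMod k → Vert n) :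
    List (Fin 3 × Fin n × Fin n) :=
  (univ : Finset (ZMod k)).toList.map (cycleEdge c b)

lemma step_ne (σ : Fin 3 → Equiv.Perm (Fin n)) (e : Fin 3) (v : Vert n) : step σ e v ≠ v :=
  fun h => by simpa using congrArg Prod.fst h

lemma mem_cycleEdges {k : ℕ} [NeZero k] {c : ZMod k → Fin 3} {b : ZMod k → Vert n}
    {t : Fin 3 × Fin n × Fin n} : t ∈ cycleEdges c b ↔ ∃ j, cycleEdge c b j = t := by
  simp [cycleEdges]

lemma length_cycleEdges {k : ℕ} [NeZero k] (c : ZMod k → Fin 3) (b : ZMod k → Vert n) :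
    (cycleEdges c b).length = k := by
  simp [cycleEdges, ZMod.card]

lemma cycleEdge_fst {k : ℕ} (c : ZMod k → Fin 3) (b : ZMod k → Vert n) (j : ZMod k) :
    (cycleEdge c b j).1 = c j := by
  unfold cycleEdge; split_ifs <;> rfl

lemma cycleEdge_ends {k : ℕ} {c : ZMod k → Fin 3} {b : ZMod k → Vert n}
    (hb : ∀ j, (b (j + 1)).1 = !(b j).1) (j : ZMod k) (v : Vert n) :
    (v = (false, (cycleEdge c b j).2.1) ∨ v = (true, (cycleEdge c b j).2.2)) ↔
      (b j = v ∨ b (j + 1) = v) := by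
  have h := hb j
  unfold cycleEdge
  rcases hj : b j with ⟨_ | _, x⟩ <;> rcases hj' : b (j + 1) with ⟨_ | _, y⟩ <;>
    simp_all [eq_comm, or_comm]

lemma cycleEdge_mem_iff {k : ℕ} {c : ZMod k → Fin 3} {b : ZMod k → Vert n}
    (hb : ∀ j, (b (j + 1)).1 = !(b j).1) (j : ZMod k) (σ : Fin 3 → Equiv.Perm (Fin n)) :
    σ (cycleEdge c b j).1 (cycleEdge c b j).2.1 = (cycleEdge c b j).2.2 ↔
      step σ (c j) (b j) = b (j + 1) := by
  have h := hb j
  unfold cycleEdge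
  rcases hj : b j with ⟨_ | _, x⟩ <;> rcases hj' : b (j + 1) with ⟨_ | _, y⟩ <;>
    simp_all [eq_comm]
  rw [Equiv.eq_symm_apply, eq_comm]

lemma ends_cycleEdges {k : ℕ} [NeZero k] {c : ZMod k → Fin 3} {b : ZMod k → Vert n}
    (hb : ∀ j, (b (j + 1)).1 = !(b j).1) : ends (cycleEdges c b) = halfEdges c b := by
  ext e v
  constructor
  · rintro ⟨t, ht, he, hv⟩
    obtain ⟨j, rfl⟩ := mem_cycleEdges.1 ht
    exact ⟨j, by rw [← he, cycleEdge_fst], (cycleEdge_ends hb j v).1 hv⟩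
  · rintro ⟨j, he, hv⟩
    exact ⟨_, mem_cycleEdges.2 ⟨j, rfl⟩, by rw [cycleEdge_fst, he], (cycleEdge_ends hb j v).2 hv⟩

lemma Admissible.edge_class {κ : Fin 3 → Vert n → T} {k : ℕ} [NeZero k] {c : ZMod k → Fin 3}
    {b : ZMod k → Vert n} (h : Admissible κ c b) (t : Fin 3 × Fin n × Fin n)
    (ht : t ∈ cycleEdges c b) : κ t.1 (true, t.2.2) = κ t.1 (false, t.2.1) := by
  obtain ⟨j, rfl⟩ := mem_cycleEdges.1 ht
  have h1 := h.1 j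
  have h2 := h.2.1 j
  unfold cycleEdge
  rcases hj : b j with ⟨_ | _, x⟩ <;> rcases hj' : b (j + 1) with ⟨_ | _, y⟩ <;> simp_all

/-- Two different edges of the closed walk that share a vertex are consecutive and therefore differ
in colour. -/
lemma Admissible.separate {κ : Fin 3 → Vert n → T} {k : ℕ} [NeZero k] {c : ZMod k → Fin 3}
    {b : ZMod k → Vert n} (h : Admissible κ c b) : (cycleEdges c b).Pairwise Separate := by
  unfold cycleEdges
  rw [List.pairwise_map]
  refine (nodup_toList univ).imp fun {i j} hij hc => ?_
  rw [cycleEdge_fst, cycleEdge_fst] at hc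
  have key : ∀ v : Vert n, (b i = v ∨ b (i + 1) = v) → ¬ (b j = v ∨ b (j + 1) = v) := by
    rintro v (h1 | h1) (h2 | h2)
    · exact hij (h.2.2.2 (h1.trans h2.symm))
    · have := h.2.2.2 (h1.trans h2.symm)
      exact h.2.2.1 j (by rw [← hc, this])
    · have := h.2.2.2 (h1.trans h2.symm)
      exact h.2.2.1 i (by rw [hc, this])
    · exact hij (add_right_cancel (h.2.2.2 (h1.trans h2.symm)))
  refine ⟨fun h1 => ?_, fun h1 => ?_⟩
  · exact key _ ((cycleEdge_ends h.1 i _).1 (Or.inl rfl))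
      ((cycleEdge_ends h.1 j _).1 (Or.inl (by rw [h1])))
  · exact key _ ((cycleEdge_ends h.1 i _).1 (Or.inr rfl))
      ((cycleEdge_ends h.1 j _).1 (Or.inr (by rw [h1])))

lemma admissible_of_isCycle {κ : Fin 3 → Vert n → T} {σ : Fin 3 → Equiv.Perm (Fin n)}
    (hσ : σ ∈ model κ) {k : ℕ} {c : ZMod k → Fin 3}
    {b : ZMod k → Vert n} (h : IsCycle (step σ) k c b) : Admissible κ c b :=
  ⟨fun j => by rw [← h.1, step_fst], fun j => by rw [← h.1, mem_model.1 hσ], h.2⟩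

lemma mem_modelWith_cycleEdges {κ : Fin 3 → Vert n → T} {k : ℕ} [NeZero k] {c : ZMod k → Fin 3}
    {b : ZMod k → Vert n} (h : Admissible κ c b) {σ : Fin 3 → Equiv.Perm (Fin n)} :
    σ ∈ modelWith κ (cycleEdges c b) ↔ σ ∈ model κ ∧ IsCycle (step σ) k c b := by
  rw [modelWith, mem_filter]
  refine and_congr_right fun _ => ?_
  constructor
  · intro h1
    exact ⟨fun j => (cycleEdge_mem_iff h.1 j σ).1 (h1 _ (mem_cycleEdges.2 ⟨j, rfl⟩)), h.2.2⟩
  · intro h1 t ht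
    obtain ⟨j, rfl⟩ := mem_cycleEdges.1 ht
    exact (cycleEdge_mem_iff h.1 j σ).2 (h1.1 j)

lemma isSwitch_insertEdges {κ : Fin 3 → Vert n → T} {k : ℕ} [NeZero k] {c : ZMod k → Fin 3}
    {b : ZMod k → Vert n} (h : Admissible κ c b) {σ : Fin 3 → Equiv.Perm (Fin n)}
    (hσ : σ ∈ model κ) : IsSwitch (step σ) (step (insertEdges (cycleEdges c b) σ))
      (halfEdges c b) (Set.range b) where
  invol := step_step σ
  invol' := step_step _
  mem := by
    rintro e v ⟨j, -, rfl | rfl⟩ <;> exact Set.mem_range_self _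
  closed := by
    have h1 := ((mem_modelWith_cycleEdges h).1 (insertEdges_mem h.edge_class h.separate hσ)).2.1
    rintro e v ⟨j, rfl, rfl | rfl⟩
    · exact ⟨j, rfl, Or.inr (h1 j).symm⟩
    · exact ⟨j, rfl, Or.inl (by rw [← h1, step_step])⟩
  eq_of := by
    intro e v h1 h2
    rw [← ends_cycleEdges h.1] at h1 h2
    exact step_insertEdges h1 h2

open Classical in
/-- The admissible closed walks of length `k`. -/
noncomputable def admissibles (κ : Fin 3 → Vert n → T) (k : ℕ) [NeZero k] :
    Finset ((ZMod k → Fin 3) × (ZMod k → Vert n)) :=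
  univ.filter fun α => Admissible κ α.1 α.2

lemma mem_admissibles {κ : Fin 3 → Vert n → T} {k : ℕ} [NeZero k]
    {α : (ZMod k → Fin 3) × (ZMod k → Vert n)} :
    α ∈ admissibles κ k ↔ Admissible κ α.1 α.2 := by
  simp [admissibles]

/-- The cycle count is a sum over closed walks `α`, and the lifts that contain `α` are sampled by
inserting `α` into an arbitrary lift of the model. So the weight by the cycle count turns into an
evaluation of `G` after an insertion. -/
lemma sum_cycleCount_mul (κ : Fin 3 → Vert n → T) (k : ℕ) [NeZero k]
    (hpos : ∀ α ∈ admissibles κ k, 0 < fiberCard κ (cycleEdges α.1 α.2))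
    (G : (Fin 3 → Equiv.Perm (Fin n)) → ℝ) :
    ∑ σ ∈ model κ, (cycleCount (step σ) k : ℝ) * G σ =
      ∑ α ∈ admissibles κ k, (fiberCard κ (cycleEdges α.1 α.2) : ℝ)⁻¹ *
        ∑ σ ∈ model κ, G (insertEdges (cycleEdges α.1 α.2) σ) := by
  classical
  have h1 : ∀ σ ∈ model κ, (cycleCount (step σ) k : ℝ) * G σ =
      ∑ α ∈ admissibles κ k, if σ ∈ modelWith κ (cycleEdges α.1 α.2) then G σ else 0 := by
    intro σ hσ
    rw [← sum_filter, sum_const, nsmul_eq_mul, cycleCount]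
    congr 3
    ext α
    simp only [mem_filter, mem_univ, true_and, mem_admissibles]
    constructor
    · intro h
      have h2 := admissible_of_isCycle hσ h
      exact ⟨h2, (mem_modelWith_cycleEdges h2).2 ⟨hσ, h⟩⟩
    · rintro ⟨h2, h⟩
      exact ((mem_modelWith_cycleEdges h2).1 h).2
  rw [sum_congr rfl h1, sum_comm]
  refine sum_congr rfl fun α hα => ?_
  have h2 := mem_admissibles.1 hα
  have h3 : (fiberCard κ (cycleEdges α.1 α.2) : ℝ) ≠ 0 := by
    exact_mod_cast (hpos α hα).ne'
  rw [sum_insertEdges h2.edge_class h2.separate G, inv_mul_cancel_left₀ h3, ← sum_filter]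
  congr 1
  ext σ
  simp only [mem_filter, modelWith]
  tauto

open Classical in
/-- The number of lifts in which short walks connect the vertices of the closed walk `α`. -/
noncomputable def badCard (κ : Fin 3 → Vert n → T) (L : ℕ) {k : ℕ} (b : ZMod k → Vert n) : ℕ :=
  ((model κ).filter fun σ => ¬ Avoids (step σ) L (Set.range b)).card

/-- The numbers of cycles of the even lengths `2, 4, …, 2 m`. -/
noncomputable def cycleVec (m : ℕ) (σ : Fin 3 → Equiv.Perm (Fin n)) (i : Fin m) : ℕ :=
  cycleCount (step σ) (2 * ((i : ℕ) + 1))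

/-- Cycles have length at most `2 * m` and the dichotomy needs one letter more, whence `2 * m + 1`.
The increment is twice the length because cycles are counted with starting point and direction. -/
lemma cycleVec_insertEdges {κ : Fin 3 → Vert n → T} {m : ℕ} (i : Fin m)
    {c : ZMod (2 * ((i : ℕ) + 1)) → Fin 3} {b : ZMod (2 * ((i : ℕ) + 1)) → Vert n}
    (h : Admissible κ c b) {σ : Fin 3 → Equiv.Perm (Fin n)}
    (hσ : σ ∈ model κ) (hgood : Avoids (step σ) (2 * m + 1) (Set.range b)) :
    cycleVec m (insertEdges (cycleEdges c b) σ) =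
      cycleVec m σ + Pi.single i (2 * (2 * ((i : ℕ) + 1))) := by
  ext j
  have h1 := ((mem_modelWith_cycleEdges h).1 (insertEdges_mem h.edge_class h.separate hσ)).2
  have h2 := (isSwitch_insertEdges h hσ).cycleCount_eq hgood h1 (j := 2 * ((j : ℕ) + 1))
    (by have := j.2; omega)
  rw [cycleVec, h2, Pi.add_apply, cycleVec, Pi.single_apply]
  congr 1
  refine if_congr ?_ rfl rfl
  rw [Fin.ext_iff]
  omega

/-- The switching identity, with an error term. -/
lemma abs_sum_cycleVec_mul_sub_le (κ : Fin 3 → Vert n → T) {m : ℕ} (i : Fin m)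
    (hpos : ∀ α ∈ admissibles κ (2 * ((i : ℕ) + 1)), 0 < fiberCard κ (cycleEdges α.1 α.2))
    (F : (Fin m → ℕ) → ℝ) (hF0 : ∀ r, 0 ≤ F r) (hF1 : ∀ r, F r ≤ 1) :
    |∑ σ ∈ model κ, (cycleVec m σ i : ℝ) * F (cycleVec m σ) -
      (∑ α ∈ admissibles κ (2 * ((i : ℕ) + 1)), (fiberCard κ (cycleEdges α.1 α.2) : ℝ)⁻¹) *
        ∑ σ ∈ model κ, F (cycleVec m σ + Pi.single i (2 * (2 * ((i : ℕ) + 1))))| ≤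
      ∑ α ∈ admissibles κ (2 * ((i : ℕ) + 1)), (fiberCard κ (cycleEdges α.1 α.2) : ℝ)⁻¹ *
        badCard κ (2 * m + 1) α.2 := by
  classical
  have h1 := sum_cycleCount_mul κ (2 * ((i : ℕ) + 1)) hpos fun σ => F (cycleVec m σ)
  change |∑ σ ∈ model κ, (cycleCount (step σ) (2 * ((i : ℕ) + 1)) : ℝ) * F (cycleVec m σ) - _| ≤ _
  rw [h1, sum_mul, ← sum_sub_distrib]
  refine (abs_sum_le_sum_abs _ _).trans (sum_le_sum fun α hα => ?_)
  rw [← mul_sub, abs_mul, abs_of_nonneg (by positivity), ← sum_sub_distrib]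
  refine mul_le_mul_of_nonneg_left ((abs_sum_le_sum_abs _ _).trans ?_) (by positivity)
  rw [badCard, card_filter]
  push_cast
  refine sum_le_sum fun σ hσ => ?_
  split_ifs with h2
  · rw [cycleVec_insertEdges i (mem_admissibles.1 hα) hσ h2, sub_self, abs_zero]
  · rw [abs_le]
    constructor <;> linarith [hF0 (cycleVec m (insertEdges (cycleEdges α.1 α.2) σ)),
      hF1 (cycleVec m (insertEdges (cycleEdges α.1 α.2) σ)),
      hF0 (cycleVec m σ + Pi.single i (2 * (2 * ((i : ℕ) + 1)))),
      hF1 (cycleVec m σ + Pi.single i (2 * (2 * ((i : ℕ) + 1))))]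

end RandomLift

/-! ### Fixed points of reduced words. -/

namespace ColouredWalk

variable {I V : Type*}

/-- A closed reduced walk contains a cycle. -/
lemma exists_isCycle {s : I → V → V} (hs : ∀ e v, s e (s e v) = v) (hs' : ∀ e v, s e v ≠ v)
    {l : ℕ} (hl : 0 < l) {a : ℕ → I} (ha : ∀ t, t + 1 < l → a t ≠ a (t + 1)) {v : ℕ → V}
    (hv : ∀ t, t < l → v (t + 1) = s (a t) (v t)) (hvl : v l = v 0) :
    ∃ i < l, ∃ k < l, IsCycle s (k + 2) (fun j => a (i + j.val)) (fun j => v (i + j.val)) := by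
  classical
  -- The cycle is a shortest return of the walk, from any starting index; minimality makes its
  -- vertices distinct.
  have hex : ∃ k, 0 < k ∧ ∃ i, i + k ≤ l ∧ v (i + k) = v i := ⟨l, hl, 0, by simp, by simpa using hvl⟩
  obtain ⟨hk0, i, hik, hvi⟩ := Nat.find_spec hex
  have hmin := fun k' (hk' : k' < Nat.find hex) => Nat.find_min hex hk'
  generalize Nat.find hex = k at *
  have hk1 : k ≠ 1 := by
    rintro rfl
    rw [hv i (by omega)] at hvi
    exact hs' _ _ hvi
  obtain ⟨k, rfl⟩ : ∃ k', k = k' + 2 := ⟨k - 2, by omega⟩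
  have hval : ∀ j : ZMod (k + 2), (j + 1).val = if j.val = k + 1 then 0 else j.val + 1 := by
    intro j
    have h1 := ZMod.val_lt j
    rw [ZMod.val_add, ZMod.val_one'' (by omega)]
    split_ifs with h
    · rw [h]; simp
    · exact Nat.mod_eq_of_lt (by omega)
  -- If the first and last colours agreed, dropping both edges would give a return shorter by two.
  -- For `k = 0` these two edges are consecutive in the word.
  have hne : a (i + (k + 1)) ≠ a i := by
    intro h
    rcases Nat.eq_zero_or_pos k with rfl | hk
    · exact ha i (by omega) h.symm
    · refine hmin k (by omega) ⟨hk, i + 1, by omega, ?_⟩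
      have h1 := hv (i + (k + 1)) (by omega)
      rw [h, show i + (k + 1) + 1 = i + (k + 2) by ring, hvi] at h1
      rw [hv i (by omega), h1, hs]
      congr 1
      ring
  refine ⟨i, by omega, k, by omega, fun j => ?_, fun j => ?_, fun j j' hjj => ?_⟩
  · have h1 := ZMod.val_lt j
    beta_reduce
    rw [hval, ← hv _ (by omega)]
    split_ifs with h
    · rw [h, add_zero, ← hvi]; rfl
    · rfl
  · have h1 := ZMod.val_lt j
    simp only [hval]
    split_ifs with h
    · rw [h]; exact hne
    · exact ha _ (by omega)
  · by_contra hne'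
    have key : ∀ j j' : ZMod (k + 2), v (i + j.val) = v (i + j'.val) → ¬ j.val < j'.val := by
      intro j j' h1 h2
      have h3 := ZMod.val_lt j'
      refine hmin (j'.val - j.val) (by omega) ⟨by omega, i + j.val, by omega, ?_⟩
      rw [h1]
      congr 1
      omega
    rcases lt_trichotomy j.val j'.val with h | h | h
    · exact key j j' hjj h
    · exact hne' (ZMod.val_injective _ h)
    · exact key j' j hjj.symm h

lemma foldr_injective {s : I → V → V} (hs : ∀ e v, s e (s e v) = v) (w : List I) :
    Function.Injective (fun u => w.foldr s u) := by
  induction w with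
  | nil => exact fun _ _ h => h
  | cons e w ih =>
    intro u u' h
    simp only [List.foldr_cons] at h
    apply ih
    simp only
    rw [← hs e (w.foldr s u), h, hs]

open Classical in
/-- The number of fixed points. -/
noncomputable def fixedCount [Fintype V] (g : V → V) : ℕ :=
  (Finset.univ.filter fun u => g u = u).card

open Classical in
/-- The number of fixed points of a reduced word is bounded by the numbers of cycles. -/
lemma card_fixed_le [Fintype I] [Fintype V] {s : I → V → V} (hs : ∀ e v, s e (s e v) = v)
    (hs' : ∀ e v, s e v ≠ v) {w : List I} (hw : w ≠ []) (hw' : w.IsChain (· ≠ ·)) :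
    fixedCount (fun u => w.foldr s u) ≤
      w.length * ∑ k ∈ Finset.range w.length, cycleCount s (k + 2) := by
  set l := w.length with hl
  have hl0 : 0 < l := List.length_pos_iff.2 hw
  -- `foldr` applies the last letter first, so step `t` uses the letter with index `l - 1 - t`. The
  -- default value is never reached for `t < l`.
  let a : ℕ → I := fun t => (w[l - 1 - t]?).getD (w.head hw)
  have haget : ∀ t (ht : t < l), a t = w[l - 1 - t]'(by omega) := fun t ht => by
    simp only [a]
    rw [List.getElem?_eq_getElem (by omega)]
    rfl
  let v : V → ℕ → V := fun u t => (w.drop (l - t)).foldr s u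
  have hv : ∀ u t, t < l → v u (t + 1) = s (a t) (v u t) := by
    intro u t ht
    simp only [v]
    rw [List.drop_eq_getElem_cons (i := l - (t + 1)) (by omega), List.foldr_cons, haget t ht]
    have h2 : l - (t + 1) = l - 1 - t := by omega
    have h3 : l - 1 - t + 1 = l - t := by omega
    simp only [h2, h3]
  have ha : ∀ t, t + 1 < l → a t ≠ a (t + 1) := by
    intro t ht
    rw [haget t (by omega), haget (t + 1) ht]
    have h1 := List.isChain_iff_getElem.1 hw' (l - 1 - (t + 1)) (by omega)
    have h2 : l - 1 - (t + 1) + 1 = l - 1 - t := by omega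
    simp only [h2] at h1
    exact h1.symm
  have hsub : (Finset.univ.filter fun u => w.foldr s u = u) ⊆
      (Finset.range l).biUnion fun i => (Finset.range l).biUnion fun k =>
        Finset.univ.filter fun u => IsCycle s (k + 2) (fun j => a (i + j.val))
          (fun j => v u (i + j.val)) := by
    intro u hu
    have hu' := (Finset.mem_filter.1 hu).2
    obtain ⟨i, hi, k, hk, h⟩ := exists_isCycle hs hs' hl0 ha (hv u)
      (by simp only [v]; rw [Nat.sub_self, Nat.sub_zero, List.drop_zero, hl, List.drop_length]
          exact hu')
    simp only [Finset.mem_biUnion, Finset.mem_range, Finset.mem_filter, Finset.mem_univ, true_and]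
    exact ⟨i, hi, k, hk, h⟩
  refine (Finset.card_le_card hsub).trans (Finset.card_biUnion_le.trans ?_)
  have hi : ∀ i ∈ Finset.range l, ((Finset.range l).biUnion fun k =>
        Finset.univ.filter fun u => IsCycle s (k + 2) (fun j => a (i + j.val))
          (fun j => v u (i + j.val))).card ≤ ∑ k ∈ Finset.range l, cycleCount s (k + 2) := by
    intro i _
    refine Finset.card_biUnion_le.trans (Finset.sum_le_sum fun k _ => ?_)
    unfold cycleCount
    refine Finset.card_le_card_of_injOn (fun u => (fun j => a (i + j.val),
      fun j => v u (i + j.val))) ?_ ?_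
    · intro u hu
      simpa using hu
    · intro u _ u' _ h
      have h1 := congrFun (congrArg Prod.snd h) 0
      exact foldr_injective hs _ h1
  exact (Finset.sum_le_card_nsmul _ _ _ hi).trans (by rw [Finset.card_range, smul_eq_mul])

end ColouredWalk

/-! ### The error term of the switching identity. -/

namespace RandomLift

open Finset ColouredWalk

variable {n : ℕ} {T : Type*} [DecidableEq T]

/-- Every class of vertices contains at least a proportion `δ` of all vertices. -/
def Spread (κ : Fin 3 → Vert n → T) (δ : ℝ) : Prop := ∀ t, δ * n ≤ classSize κ t

lemma le_fiberCard {κ : Fin 3 → Vert n → T} {δ : ℝ} (hδ : 0 < δ) (hκ : Spread κ δ)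
    (l : List (Fin 3 × Fin n × Fin n)) (hl : 2 * l.length ≤ δ * n) :
    (δ * n / 2) ^ l.length ≤ (fiberCard κ l : ℝ) := by
  induction l with
  | nil => simp [fiberCard]
  | cons t l ih =>
    rw [List.length_cons] at hl ⊢
    push_cast at hl
    have h1 := ih (by linarith)
    have h2 : (classSize κ t : ℝ) ≤ (available κ l t).card + l.length := by
      exact_mod_cast classSize_le κ l t
    have h3 := hκ t
    rw [fiberCard, pow_succ']
    push_cast
    refine mul_le_mul (by linarith) h1 (by positivity) (by positivity)

lemma inv_fiberCard_le {κ : Fin 3 → Vert n → T} {δ : ℝ} (hδ : 0 < δ) (hκ : Spread κ δ) {k : ℕ}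
    [NeZero k] (hk : 2 * k ≤ δ * n) (c : ZMod k → Fin 3) (b : ZMod k → Vert n) :
    0 < fiberCard κ (cycleEdges c b) ∧
      (fiberCard κ (cycleEdges c b) : ℝ)⁻¹ ≤ (2 / δ) ^ k * ((n : ℝ) ^ k)⁻¹ := by
  have h1 := le_fiberCard hδ hκ (cycleEdges c b) (by rwa [length_cycleEdges])
  rw [length_cycleEdges] at h1
  have hk0 : (0 : ℝ) < k := by exact_mod_cast NeZero.pos k
  have h0 : 0 < δ * n / 2 := by linarith
  have h2 : 0 < (δ * n / 2) ^ k := by positivity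
  refine ⟨by exact_mod_cast h2.trans_le h1, ?_⟩
  calc _ ≤ ((δ * n / 2) ^ k)⁻¹ := inv_anti₀ h2 h1
    _ = _ := by rw [← inv_pow, ← inv_pow, ← mul_pow]; congr 1; field_simp

lemma card_admissibles_le (κ : Fin 3 → Vert n → T) (k : ℕ) [NeZero k] :
    ((admissibles κ k).card : ℝ) ≤ 6 ^ k * (n : ℝ) ^ k := by
  have h : (admissibles κ k).card ≤ 6 ^ k * n ^ k := by
    refine (card_le_univ _).trans (le_of_eq ?_)
    simp only [Fintype.card_prod, Fintype.card_fun, ZMod.card, Fintype.card_fin, Fintype.card_bool]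
    rw [← mul_pow, ← mul_pow]
    congr 1
    ring
  exact_mod_cast h

/-- The expected number of cycles of length `k`. -/
noncomputable def meanCycles (κ : Fin 3 → Vert n → T) (k : ℕ) [NeZero k] : ℝ :=
  ∑ α ∈ admissibles κ k, (fiberCard κ (cycleEdges α.1 α.2) : ℝ)⁻¹

lemma meanCycles_le {κ : Fin 3 → Vert n → T} {δ : ℝ} (hδ : 0 < δ) (hκ : Spread κ δ) {k : ℕ}
    [NeZero k] (hk : 2 * k ≤ δ * n) : meanCycles κ k ≤ (12 / δ) ^ k := by
  have hk0 : (0 : ℝ) < k := by exact_mod_cast NeZero.pos k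
  have hn : 0 < (n : ℝ) := by
    by_contra h
    have : δ * n ≤ 0 := mul_nonpos_of_nonneg_of_nonpos hδ.le (not_lt.1 h)
    linarith
  calc meanCycles κ k ≤ ∑ α ∈ admissibles κ k, (2 / δ) ^ k * ((n : ℝ) ^ k)⁻¹ :=
        sum_le_sum fun α _ => (inv_fiberCard_le hδ hκ hk _ _).2
    _ = (admissibles κ k).card * ((2 / δ) ^ k * ((n : ℝ) ^ k)⁻¹) := by simp
    _ ≤ 6 ^ k * (n : ℝ) ^ k * ((2 / δ) ^ k * ((n : ℝ) ^ k)⁻¹) :=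
        mul_le_mul_of_nonneg_right (card_admissibles_le κ k) (by positivity)
    _ = (6 * (2 / δ)) ^ k := by rw [mul_pow]; field_simp
    _ = _ := by congr 1; ring

lemma sum_cycleCount {κ : Fin 3 → Vert n → T} {δ : ℝ} (hδ : 0 < δ) (hκ : Spread κ δ) {k : ℕ}
    [NeZero k] (hk : 2 * k ≤ δ * n) :
    ∑ σ ∈ model κ, (cycleCount (step σ) k : ℝ) = meanCycles κ k * (model κ).card := by
  have := sum_cycleCount_mul κ k (fun α _ => (inv_fiberCard_le hδ hκ hk _ _).1) fun _ => 1
  simpa [meanCycles, sum_mul] using this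

-- Fixed points of a reduced word come from cycles of length at most `w.length + 1`, whose mean
-- numbers are bounded uniformly in `n`.
open Classical in
lemma sum_card_fixed_le {κ : Fin 3 → Vert n → T} {δ : ℝ} (hδ : 0 < δ) (hκ : Spread κ δ)
    {w : List (Fin 3)} (hw : w ≠ []) (hw' : w.IsChain (· ≠ ·)) (hk : 2 * (w.length + 1) ≤ δ * n) :
    ∑ σ ∈ model κ, (fixedCount (fun u => w.foldr (step σ) u) : ℝ) ≤
      w.length * (∑ k ∈ range w.length, (12 / δ) ^ (k + 2)) * (model κ).card := by
  calc _ ≤ ∑ σ ∈ model κ, (w.length * ∑ k ∈ range w.length,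
        (cycleCount (step σ) (k + 2) : ℝ)) := by
        refine sum_le_sum fun σ _ => ?_
        exact_mod_cast card_fixed_le (step_step σ) (step_ne σ) hw hw'
    _ = w.length * ∑ k ∈ range w.length, meanCycles κ (k + 2) * (model κ).card := by
        rw [← mul_sum, sum_comm]
        congr 1
        refine sum_congr rfl fun k hk' => sum_cycleCount hδ hκ ?_
        have : (k : ℝ) + 1 ≤ w.length := by exact_mod_cast mem_range.1 hk'
        push_cast
        linarith
    _ ≤ w.length * ∑ k ∈ range w.length, (12 / δ) ^ (k + 2) * (model κ).card := by
        gcongr with k hk'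
        refine meanCycles_le hδ hκ ?_
        have : (k : ℝ) + 1 ≤ w.length := by exact_mod_cast mem_range.1 hk'
        push_cast
        linarith
    _ = _ := by rw [← sum_mul, mul_assoc]

open Classical in
lemma card_filter_apply_eq_le_of_ne {V : Type*} [Fintype V] {k : ℕ} (g : V → V)
    {i j : ZMod (k + 1)} (hij : i ≠ j) :
    (univ.filter fun b : ZMod (k + 1) → V => g (b i) = b j).card ≤ Fintype.card V ^ k := by
  have h : (univ.filter fun b : ZMod (k + 1) → V => g (b i) = b j).card ≤
      Fintype.card ({q : ZMod (k + 1) // q ≠ j} → V) := by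
    rw [← card_univ]
    refine card_le_card_of_injOn (fun b q => b q.1) (fun _ _ => by simp) ?_
    intro b hb b' hb' h
    have hb1 := (mem_filter.1 (mem_coe.1 hb)).2
    have hb2 := (mem_filter.1 (mem_coe.1 hb')).2
    have h1 : ∀ q, q ≠ j → b q = b' q := fun q hq => congrFun h ⟨q, hq⟩
    ext q
    by_cases hq : q = j
    · rw [hq, ← hb1, ← hb2, h1 i hij]
    · exact h1 q hq
  refine h.trans (le_of_eq ?_)
  rw [Fintype.card_fun, Fintype.card_subtype_compl, ZMod.card, Fintype.card_subtype_eq,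
    add_tsub_cancel_right]

-- For `i ≠ j` the condition determines `b j`; for `i = j` it confines `b i` to the fixed points of
-- `g`. In both cases one factor `Fintype.card V` is replaced by at most the number of fixed points
-- plus one.
open Classical in
lemma card_filter_apply_eq_le {V : Type*} [Fintype V] {k : ℕ} (g : V → V)
    (i j : ZMod (k + 1)) :
    (univ.filter fun b : ZMod (k + 1) → V => g (b i) = b j).card ≤
      Fintype.card V ^ k * (1 + fixedCount g) := by
  by_cases hij : i = j
  · subst hij
    have h : (univ.filter fun b : ZMod (k + 1) → V => g (b i) = b i) =
        Fintype.piFinset fun q => if q = i then univ.filter fun u => g u = u else univ := by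
      ext b
      simp only [mem_filter, mem_univ, true_and, Fintype.mem_piFinset]
      refine ⟨fun h q => ?_, fun h => by simpa using h i⟩
      split_ifs with hq
      · subst hq; simpa using h
      · simp
    rw [h, Fintype.card_piFinset]
    simp_rw [apply_ite card]
    rw [Fintype.prod_eq_mul_prod_compl i, if_pos rfl, prod_congr rfl fun q hq => if_neg (by
      simpa using hq), prod_const, card_compl, ZMod.card, card_singleton, card_univ, mul_comm]
    simp only [add_tsub_cancel_right]
    gcongr
    rw [fixedCount]
    omega
  · exact (card_filter_apply_eq_le_of_ne g hij).trans (Nat.le_mul_of_pos_right _ (by omega))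

open Classical in
/-- The nonempty reduced words of length at most `L`. -/
noncomputable def words (L : ℕ) : Finset (List (Fin 3)) :=
  (List.finite_length_le (Fin 3) L).toFinset.filter fun w => w ≠ [] ∧ w.IsChain (· ≠ ·)

lemma mem_words {L : ℕ} {w : List (Fin 3)} :
    w ∈ words L ↔ w.length ≤ L ∧ w ≠ [] ∧ w.IsChain (· ≠ ·) := by
  simp [words]

open Classical in
lemma card_not_avoids_le (σ : Fin 3 → Equiv.Perm (Fin n)) (L k : ℕ) :
    (univ.filter fun b : ZMod (k + 1) → Vert n => ¬ Avoids (step σ) L (Set.range b)).card ≤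
      (k + 1) ^ 2 * (2 * n) ^ k *
        ∑ w ∈ words L, (1 + fixedCount (fun u => w.foldr (step σ) u)) := by
  have h : (univ.filter fun b : ZMod (k + 1) → Vert n => ¬ Avoids (step σ) L (Set.range b)) ⊆
      (words L).biUnion fun w => (univ : Finset (ZMod (k + 1) × ZMod (k + 1))).biUnion fun x =>
        univ.filter fun b : ZMod (k + 1) → Vert n => w.foldr (step σ) (b x.1) = b x.2 := by
    intro b hb
    have hb := (mem_filter.1 hb).2
    unfold Avoids at hb
    push Not at hb
    obtain ⟨w, h1, h2, h3, u, ⟨i, rfl⟩, ⟨j, hj⟩⟩ := hb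
    simp only [mem_biUnion, mem_univ, true_and, mem_filter]
    exact ⟨w, mem_words.2 ⟨h3, h1, h2⟩, (i, j), hj.symm⟩
  refine (card_le_card h).trans (card_biUnion_le.trans ?_)
  rw [mul_sum]
  refine sum_le_sum fun w _ => card_biUnion_le.trans ?_
  refine (sum_le_card_nsmul _ _
    (Fintype.card (Vert n) ^ k * (1 + fixedCount fun u => w.foldr (step σ) u)) fun x _ => by
    convert! card_filter_apply_eq_le (fun u => w.foldr (step σ) u) x.1 x.2).trans (le_of_eq ?_)
  simp only [card_univ, Fintype.card_prod, ZMod.card, Fintype.card_bool, Fintype.card_fin,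
    smul_eq_mul]
  ring

-- After exchanging the sums the lift is fixed and the tuples `b` joined by a short reduced walk are
-- counted; up to the numbers of fixed points they are a fraction of order `1 / n` of all tuples.
open Classical in
lemma sum_badCard_le (κ : Fin 3 → Vert n → T) (L k : ℕ) :
    ∑ α ∈ admissibles κ (k + 1), badCard κ L α.2 ≤
      3 ^ (k + 1) * ((k + 1) ^ 2 * (2 * n) ^ k) * ∑ w ∈ words L, ((model κ).card +
        ∑ σ ∈ model κ, fixedCount (fun u => w.foldr (step σ) u)) := by
  calc _ ≤ ∑ α : (ZMod (k + 1) → Fin 3) × (ZMod (k + 1) → Vert n), badCard κ L α.2 :=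
        sum_le_sum_of_subset (subset_univ _)
    _ = 3 ^ (k + 1) * ∑ σ ∈ model κ, (univ.filter fun b : ZMod (k + 1) → Vert n =>
          ¬ Avoids (step σ) L (Set.range b)).card := by
        rw [Fintype.sum_prod_type]
        simp only [sum_const, card_univ, Fintype.card_fun, ZMod.card, Fintype.card_fin, smul_eq_mul]
        simp_rw [badCard, card_filter]
        rw [sum_comm]
    _ ≤ 3 ^ (k + 1) * ∑ σ ∈ model κ, ((k + 1) ^ 2 * (2 * n) ^ k *
        ∑ w ∈ words L, (1 + fixedCount (fun u => w.foldr (step σ) u))) := by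
        gcongr
        exact card_not_avoids_le _ _ _
    _ = _ := by
        rw [← mul_sum, sum_comm, mul_assoc]
        simp only [sum_add_distrib, sum_const, smul_eq_mul, mul_one]
        ring

/-- The switching identity: the numbers of cycles of the even lengths `2, 4, …, 2 m` satisfy the
recursion of independent Poisson variables asymptotically. -/
lemma exists_switching_error {δ : ℝ} (hδ : 0 < δ) {m : ℕ} (i : Fin m) : ∃ C : ℝ, ∃ n₀ : ℕ,
    ∀ n ≥ n₀, ∀ κ : Fin 3 → Vert n → Bool, Spread κ δ → ∀ F : (Fin m → ℕ) → ℝ,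
      (∀ r, 0 ≤ F r) → (∀ r, F r ≤ 1) →
      |∑ σ ∈ model κ, (cycleVec m σ i : ℝ) * F (cycleVec m σ) -
        meanCycles κ (2 * ((i : ℕ) + 1)) *
          ∑ σ ∈ model κ, F (cycleVec m σ + Pi.single i (2 * (2 * ((i : ℕ) + 1))))| ≤
        C / n * (model κ).card := by
  classical
  obtain ⟨k, hk⟩ : ∃ k, 2 * ((i : ℕ) + 1) = k + 1 := ⟨2 * i + 1, by ring⟩
  set L := 2 * m + 1 with hL
  refine ⟨(2 / δ) ^ (k + 1) * (3 ^ (k + 1) * ((k + 1) ^ 2 * 2 ^ k)) *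
    ∑ w ∈ words L, (1 + w.length * ∑ k ∈ range w.length, (12 / δ) ^ (k + 2)),
    ⌈2 * ((L : ℝ) + 1) / δ⌉₊ + 1, fun n hn κ hκ F hF0 hF1 => ?_⟩
  have hn1 : 1 ≤ n := by omega
  have hn0 : (0 : ℝ) < n := by exact_mod_cast hn1
  have hnL : 2 * ((L : ℝ) + 1) ≤ δ * n := by
    have h1 : 2 * ((L : ℝ) + 1) / δ ≤ n := (Nat.le_ceil _).trans (Nat.cast_le.2 (by omega))
    rw [div_le_iff₀ hδ] at h1
    linarith
  have him := i.2
  have hkL : 2 * ((2 * ((i : ℕ) + 1) : ℕ) : ℝ) ≤ δ * n := by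
    have : ((2 * ((i : ℕ) + 1) : ℕ) : ℝ) ≤ L := by exact_mod_cast (by omega)
    linarith
  refine (abs_sum_cycleVec_mul_sub_le κ i (fun α _ => (inv_fiberCard_le hδ hκ hkL _ _).1)
    F hF0 hF1).trans ?_
  calc _ ≤ ∑ α ∈ admissibles κ (2 * ((i : ℕ) + 1)), (2 / δ) ^ (k + 1) * ((n : ℝ) ^ (k + 1))⁻¹ *
        badCard κ L α.2 := by
        refine sum_le_sum fun α _ => mul_le_mul_of_nonneg_right ?_ (by positivity)
        rw [← hk]
        exact (inv_fiberCard_le hδ hκ hkL _ _).2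
    _ = (2 / δ) ^ (k + 1) * ((n : ℝ) ^ (k + 1))⁻¹ *
        ((∑ α ∈ admissibles κ (2 * ((i : ℕ) + 1)), badCard κ L α.2 : ℕ) : ℝ) := by
        rw [← mul_sum]; push_cast; rfl
    _ ≤ (2 / δ) ^ (k + 1) * ((n : ℝ) ^ (k + 1))⁻¹ *
        (3 ^ (k + 1) * ((k + 1) ^ 2 * (2 * n) ^ k) * ∑ w ∈ words L, ((model κ).card +
        ∑ σ ∈ model κ, (fixedCount (fun u => w.foldr (step σ) u) : ℝ))) := by
        refine mul_le_mul_of_nonneg_left ?_ (by positivity)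
        have h1 : ∑ α ∈ admissibles κ (2 * ((i : ℕ) + 1)), badCard κ L α.2 ≤
            3 ^ (k + 1) * ((k + 1) ^ 2 * (2 * n) ^ k) * ∑ w ∈ words L, ((model κ).card +
            ∑ σ ∈ model κ, fixedCount (fun u => w.foldr (step σ) u)) := by
          have := sum_badCard_le κ L (2 * (i : ℕ) + 1)
          obtain rfl : k = 2 * i + 1 := by omega
          exact this
        exact_mod_cast h1
    _ ≤ (2 / δ) ^ (k + 1) * ((n : ℝ) ^ (k + 1))⁻¹ *
        (3 ^ (k + 1) * ((k + 1) ^ 2 * (2 * n) ^ k) * ∑ w ∈ words L, ((model κ).card +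
        w.length * (∑ k ∈ range w.length, (12 / δ) ^ (k + 2)) * (model κ).card)) := by
        gcongr with w hw
        obtain ⟨h1, h2, h3⟩ := mem_words.1 hw
        refine sum_card_fixed_le hδ hκ h2 h3 ?_
        have : (w.length : ℝ) ≤ L := by exact_mod_cast h1
        linarith
    _ = _ := by
        have h1 : ∀ w : List (Fin 3), ((model κ).card : ℝ) +
            w.length * (∑ k ∈ range w.length, (12 / δ) ^ (k + 2)) * (model κ).card =
            (1 + w.length * (∑ k ∈ range w.length, (12 / δ) ^ (k + 2))) * (model κ).card :=
          fun w => by ring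
        simp_rw [h1]
        rw [← sum_mul, mul_pow 2 (n : ℝ), pow_succ (n : ℝ)]
        generalize ∑ w ∈ words L, (1 + w.length * ∑ k ∈ range w.length, (12 / δ) ^ (k + 2)) = S
        generalize (2 / δ) ^ (k + 1) = D
        have h2 : ((n : ℝ) ^ k * n)⁻¹ * (n : ℝ) ^ k = (n : ℝ)⁻¹ := by field_simp
        rw [div_eq_mul_inv, ← h2]
        ring

end RandomLift

/-! ### The mean number of cycles as a sum over closed walks. -/

namespace RandomLift

open Finset ColouredWalk

variable {n : ℕ} {T : Type*} [DecidableEq T]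

open Classical in
/-- The closed walks that respect the classes, with possible repetitions of vertices. -/
noncomputable def closedWalks (κ : Fin 3 → Vert n → T) (k : ℕ) [NeZero k] :
    Finset ((ZMod k → Fin 3) × (ZMod k → Vert n)) :=
  univ.filter fun α => (∀ j, (α.2 (j + 1)).1 = !(α.2 j).1) ∧
    (∀ j, κ (α.1 j) (α.2 (j + 1)) = κ (α.1 j) (α.2 j)) ∧ ∀ j, α.1 j ≠ α.1 (j + 1)

lemma mem_closedWalks {κ : Fin 3 → Vert n → T} {k : ℕ} [NeZero k]
    {α : (ZMod k → Fin 3) × (ZMod k → Vert n)} : α ∈ closedWalks κ k ↔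
      (∀ j, (α.2 (j + 1)).1 = !(α.2 j).1) ∧
      (∀ j, κ (α.1 j) (α.2 (j + 1)) = κ (α.1 j) (α.2 j)) ∧ ∀ j, α.1 j ≠ α.1 (j + 1) := by
  simp [closedWalks]

lemma admissibles_eq (κ : Fin 3 → Vert n → T) (k : ℕ) [NeZero k] :
    admissibles κ k = (closedWalks κ k).filter fun α => Function.Injective α.2 := by
  ext α
  rw [mem_admissibles, mem_filter, mem_closedWalks, Admissible]
  tauto

/-- The approximate weight of a closed walk. -/
noncomputable def walkWeight (κ : Fin 3 → Vert n → T) {k : ℕ} [NeZero k]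
    (α : (ZMod k → Fin 3) × (ZMod k → Vert n)) : ℝ :=
  ∏ j, (classSize κ (cycleEdge α.1 α.2 j) : ℝ)⁻¹

lemma fiberCard_le (κ : Fin 3 → Vert n → T) (l : List (Fin 3 × Fin n × Fin n)) :
    fiberCard κ l ≤ (l.map (classSize κ)).prod := by
  induction l with
  | nil => simp [fiberCard]
  | cons t l ih =>
    rw [fiberCard, List.map_cons, List.prod_cons]
    exact Nat.mul_le_mul (card_available_le κ l t) ih

lemma mul_le_fiberCard {κ : Fin 3 → Vert n → T} {x : ℝ} (hx1 : x ≤ 1) {k : ℕ}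
    (hκ : ∀ t, (k : ℝ) ≤ x * classSize κ t) (l : List (Fin 3 × Fin n × Fin n))
    (hl : l.length ≤ k) :
    (1 - x) ^ l.length * (l.map fun t => (classSize κ t : ℝ)).prod ≤ fiberCard κ l := by
  induction l with
  | nil => simp [fiberCard]
  | cons t l ih =>
    rw [List.length_cons] at hl
    rw [fiberCard, List.map_cons, List.prod_cons, List.length_cons, pow_succ']
    have h1 := ih (by omega)
    have h2 : (classSize κ t : ℝ) ≤ (available κ l t).card + l.length := by
      exact_mod_cast classSize_le κ l t
    have h3 := hκ t
    have h4 : (l.length : ℝ) ≤ k := by exact_mod_cast (by omega)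
    have h5 : 0 ≤ (1 - x) ^ l.length * (l.map fun t => (classSize κ t : ℝ)).prod :=
      mul_nonneg (pow_nonneg (by linarith) _) (List.prod_nonneg fun a ha => by
        obtain ⟨t', -, rfl⟩ := List.mem_map.1 ha
        positivity)
    push_cast
    calc _ = ((1 - x) * classSize κ t) *
          ((1 - x) ^ l.length * (l.map fun t => (classSize κ t : ℝ)).prod) := by ring
      _ ≤ _ := mul_le_mul (by linarith) h1 h5 (by positivity)

lemma prod_map_cycleEdges {k : ℕ} [NeZero k] (c : ZMod k → Fin 3) (b : ZMod k → Vert n)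
    {M : Type*} [CommMonoid M] (f : Fin 3 × Fin n × Fin n → M) :
    ((cycleEdges c b).map f).prod = ∏ j, f (cycleEdge c b j) := by
  rw [cycleEdges, List.map_map, ← prod_map_toList]
  rfl

/-- Each factor of the exact count falls short of its class size by at most `k`, while every class
has at least `δ * n` elements; Bernoulli's inequality collects the `k` factors. -/
lemma abs_inv_fiberCard_sub_le {κ : Fin 3 → Vert n → T} {δ : ℝ} (hδ : 0 < δ) (hκ : Spread κ δ)
    {k : ℕ} [NeZero k] (hk : 2 * k ≤ δ * n) (α : (ZMod k → Fin 3) × (ZMod k → Vert n)) :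
    |(fiberCard κ (cycleEdges α.1 α.2) : ℝ)⁻¹ - walkWeight κ α| ≤
      k ^ 2 / (δ * n) * (fiberCard κ (cycleEdges α.1 α.2) : ℝ)⁻¹ := by
  have hk0 : (0 : ℝ) < k := by exact_mod_cast NeZero.pos k
  have hδn : 0 < δ * n := by linarith
  set x := k / (δ * n) with hx
  have hx0 : 0 < x := by positivity
  have hx1 : x ≤ 1 := by rw [hx, div_le_one hδn]; linarith
  have hN := (inv_fiberCard_le hδ hκ hk α.1 α.2).1
  have h1 := mul_le_fiberCard (k := k) hx1 (fun t => by
    have h := hκ t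
    rw [hx, div_mul_eq_mul_div, le_div_iff₀ hδn]
    exact mul_le_mul_of_nonneg_left h hk0.le) (cycleEdges α.1 α.2) (length_cycleEdges _ _).le
  have h2 := fiberCard_le κ (cycleEdges α.1 α.2)
  rw [length_cycleEdges] at h1
  rw [prod_map_cycleEdges] at h1 h2
  have h3 : (fiberCard κ (cycleEdges α.1 α.2) : ℝ) ≤
      ∏ j, (classSize κ (cycleEdge α.1 α.2 j) : ℝ) := by exact_mod_cast h2
  have hw : walkWeight κ α = (∏ j, (classSize κ (cycleEdge α.1 α.2 j) : ℝ))⁻¹ := by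
    rw [walkWeight, prod_inv_distrib]
  rw [hw]
  generalize (∏ j, (classSize κ (cycleEdge α.1 α.2 j) : ℝ)) = P at *
  have hN' : (0 : ℝ) < fiberCard κ (cycleEdges α.1 α.2) := by exact_mod_cast hN
  generalize (fiberCard κ (cycleEdges α.1 α.2) : ℝ) = N at *
  have hP : 0 < P := hN'.trans_le h3
  have h4 : 1 - k * x ≤ (1 - x) ^ k := by
    have := one_add_mul_le_pow (a := -x) (by linarith) k
    rw [← sub_eq_add_neg] at this
    linarith
  have h5 : (k : ℝ) ^ 2 / (δ * n) = k * x := by rw [hx]; ring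
  rw [abs_of_nonneg (sub_nonneg.2 (inv_anti₀ hN' h3)), h5]
  have h6 : (1 - k * x) * P ≤ N := (mul_le_mul_of_nonneg_right h4 hP.le).trans h1
  have h7 : N⁻¹ - P⁻¹ = (1 - N * P⁻¹) * N⁻¹ := by field_simp
  rw [h7]
  refine mul_le_mul_of_nonneg_right ?_ (by positivity)
  rw [← div_eq_mul_inv, sub_le_comm, le_div_iff₀ hP]
  exact h6

lemma card_not_injective_le (κ : Fin 3 → Vert n → T) (k : ℕ) :
    ((closedWalks κ (k + 1)).filter fun α => ¬ Function.Injective α.2).card ≤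
      3 ^ (k + 1) * ((k + 1) ^ 2 * (2 * n) ^ k) := by
  classical
  have h : ((closedWalks κ (k + 1)).filter fun α => ¬ Function.Injective α.2) ⊆
      (univ : Finset (ZMod (k + 1) → Fin 3)) ×ˢ
        ((univ.filter fun x : ZMod (k + 1) × ZMod (k + 1) => x.1 ≠ x.2).biUnion fun x =>
          univ.filter fun b : ZMod (k + 1) → Vert n => id (b x.1) = b x.2) := by
    intro α hα
    have h1 := (mem_filter.1 hα).2
    unfold Function.Injective at h1
    push Not at h1
    obtain ⟨i, j, h2, h3⟩ := h1
    rw [mem_product]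
    refine ⟨mem_univ _, mem_biUnion.2 ⟨(i, j), by simpa using h3, by simpa using h2⟩⟩
  refine (card_le_card h).trans ?_
  rw [card_product]
  refine Nat.mul_le_mul (le_of_eq ?_) ?_
  · simp [ZMod.card]
  · refine card_biUnion_le.trans ?_
    refine (sum_le_card_nsmul _ _ (Fintype.card (Vert n) ^ k) fun x hx => by
      convert! card_filter_apply_eq_le_of_ne id (mem_filter.1 hx).2).trans ?_
    rw [smul_eq_mul, Fintype.card_prod, Fintype.card_bool, Fintype.card_fin]
    refine Nat.mul_le_mul_right _ ((card_le_univ _).trans (le_of_eq ?_))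
    simp [ZMod.card, sq]

/-- Replacing the exact weights by products and admitting repeated vertices each costs `O(1 / n)`.
The resulting sum factorises along the walk, so transfer matrices apply to it. -/
lemma abs_meanCycles_sub_le {κ : Fin 3 → Vert n → T} {δ : ℝ} (hδ : 0 < δ) (hκ : Spread κ δ)
    {k : ℕ} (hk : 2 * ((k + 1 : ℕ) : ℝ) ≤ δ * n) :
    |meanCycles κ (k + 1) - ∑ α ∈ closedWalks κ (k + 1), walkWeight κ α| ≤
      ((k + 1) ^ 2 / δ * (12 / δ) ^ (k + 1) +
        3 ^ (k + 1) * ((k + 1) ^ 2 * 2 ^ k) * (1 / δ) ^ (k + 1)) / n := by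
  classical
  have hk0 : (0 : ℝ) < ((k + 1 : ℕ) : ℝ) := by positivity
  have hδn : 0 < δ * n := by linarith
  have hn : (0 : ℝ) < n := by
    by_contra h
    have : δ * n ≤ 0 := mul_nonpos_of_nonneg_of_nonpos hδ.le (not_lt.1 h)
    linarith
  rw [← sum_filter_add_sum_filter_not (closedWalks κ (k + 1)) fun α => Function.Injective α.2]
  have e1 : (closedWalks κ (k + 1)).filter (fun α => Function.Injective α.2) =
      admissibles κ (k + 1) := by
    rw [admissibles_eq]
  rw [e1]
  have h1 : |meanCycles κ (k + 1) - ∑ α ∈ admissibles κ (k + 1), walkWeight κ α| ≤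
      (k + 1) ^ 2 / (δ * n) * (12 / δ) ^ (k + 1) := by
    rw [meanCycles, ← sum_sub_distrib]
    calc _ ≤ ∑ α ∈ admissibles κ (k + 1), ((k + 1 : ℕ) : ℝ) ^ 2 / (δ * n) *
          (fiberCard κ (cycleEdges α.1 α.2) : ℝ)⁻¹ := (abs_sum_le_sum_abs _ _).trans
            (sum_le_sum fun α _ => abs_inv_fiberCard_sub_le hδ hκ hk α)
      _ = ((k + 1 : ℕ) : ℝ) ^ 2 / (δ * n) * meanCycles κ (k + 1) := by
          rw [← mul_sum, meanCycles]
      _ ≤ _ := by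
          push_cast
          exact mul_le_mul_of_nonneg_left (meanCycles_le hδ hκ hk) (by positivity)
  have hw0 : ∀ α : (ZMod (k + 1) → Fin 3) × (ZMod (k + 1) → Vert n), 0 ≤ walkWeight κ α :=
    fun α => prod_nonneg fun j _ => by positivity
  have hw : ∀ α : (ZMod (k + 1) → Fin 3) × (ZMod (k + 1) → Vert n),
      walkWeight κ α ≤ ((δ * n)⁻¹) ^ (k + 1) := fun α => by
    calc walkWeight κ α ≤ ∏ j : ZMod (k + 1), (δ * n)⁻¹ :=
          prod_le_prod (fun j _ => by positivity) fun j _ => inv_anti₀ hδn (hκ _)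
      _ = _ := by simp [ZMod.card]
  have h2 : |∑ α ∈ (closedWalks κ (k + 1)).filter (fun α => ¬ Function.Injective α.2),
      walkWeight κ α| ≤ 3 ^ (k + 1) * ((k + 1) ^ 2 * (2 * n) ^ k) * ((δ * n)⁻¹) ^ (k + 1) := by
    rw [abs_of_nonneg (sum_nonneg fun α _ => hw0 α)]
    calc _ ≤ (((closedWalks κ (k + 1)).filter
          (fun α => ¬ Function.Injective α.2)).card : ℝ) * ((δ * n)⁻¹) ^ (k + 1) := by
          rw [← nsmul_eq_mul]
          exact sum_le_card_nsmul _ _ _ fun α _ => hw α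
      _ ≤ _ := by
          refine mul_le_mul_of_nonneg_right ?_ (by positivity)
          exact_mod_cast card_not_injective_le κ k
  rw [← sub_sub]
  refine (abs_sub _ _).trans ((add_le_add h1 h2).trans (le_of_eq ?_))
  rw [mul_inv, mul_pow 2 (n : ℝ), mul_pow δ⁻¹, pow_succ (n : ℝ)⁻¹, one_div, add_div]
  congr 1
  · field_simp
  · field_simp
    rw [one_div, ← mul_pow, mul_inv_cancel₀ hn.ne', one_pow]

end RandomLift

/-! ### Transfer matrices and the number of non-backtracking walks. -/

namespace RandomLift

open Finset ColouredWalk Topology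

/-- A cyclic transfer matrix computation: kernels that are sums of products. -/
lemma sum_prod_cyclic {S J : Type*} [Fintype S] [Fintype J] [DecidableEq J] {k : ℕ} [NeZero k]
    (f g : ZMod k → J → S → ℝ) (μ : ZMod k → J → ℝ)
    (h : ∀ j r r', ∑ u, f j r u * g (j - 1) r' u = if r = r' then μ j r else 0) :
    ∑ t : ZMod k → S, ∏ j, ∑ r, f j r (t j) * g j r (t (j + 1)) = ∑ r, ∏ j, μ j r := by
  classical
  -- Expanding the kernels and shifting the index of `g` collects the two factors that involve `t
  -- j`. Then the biorthogonality `h` forces the label `r` to be constant around the cycle.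
  have h1 : ∀ t : ZMod k → S, ∏ j, ∑ r, f j r (t j) * g j r (t (j + 1)) =
      ∑ r : ZMod k → J, ∏ j, f j (r j) (t j) * g (j - 1) (r (j - 1)) (t j) := fun t => by
    rw [prod_univ_sum, Fintype.piFinset_univ]
    refine sum_congr rfl fun r _ => ?_
    rw [prod_mul_distrib, prod_mul_distrib]
    congr 1
    refine Fintype.prod_equiv (Equiv.addRight 1) _ _ fun j => ?_
    simp
  simp_rw [h1]
  rw [sum_comm]
  have h2 : ∀ r : ZMod k → J, ∑ t : ZMod k → S, ∏ j, f j (r j) (t j) * g (j - 1) (r (j - 1)) (t j) =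
      ∏ j, if r j = r (j - 1) then μ j (r j) else 0 := fun r => by
    rw [← Fintype.piFinset_univ, ← prod_univ_sum (fun _ => univ)
      (fun j u => f j (r j) u * g (j - 1) (r (j - 1)) u)]
    exact prod_congr rfl fun j _ => h j _ _
  have h3 : ∀ r : ZMod k → J, (∏ j, if r j = r (j - 1) then μ j (r j) else 0) =
      if ∀ j, r j = r (j - 1) then ∏ j, μ j (r j) else 0 := fun r => by
    split_ifs with hr
    · exact prod_congr rfl fun j _ => if_pos (hr j)
    · push Not at hr
      obtain ⟨j, hj⟩ := hr
      exact prod_eq_zero (mem_univ j) (if_neg hj)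
  simp_rw [h2, h3]
  rw [← sum_filter]
  symm
  refine sum_bij (fun r _ _ => r) (fun r _ => by simp) (fun r _ r' _ hr => congrFun hr 0)
    (fun r hr => ⟨r 0, mem_univ _, ?_⟩) (fun r _ => rfl)
  have hr1 : ∀ j, r j = r (j - 1) := by simpa using hr
  have hr2 : ∀ t : ℕ, r t = r 0 := fun t => by
    induction t with
    | zero => simp
    | succ t ih =>
      rw [hr1, ← ih]
      congr 1
      push_cast
      ring
  ext j
  rw [← ZMod.natCast_zmod_val j, hr2]

/-- The non-backtracking closed walks of length `k` in `K_2^3`. -/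
def walkPairs (k : ℕ) [NeZero k] : Finset ((ZMod k → Fin 3) × (ZMod k → Bool)) :=
  univ.filter fun p => (∀ j, p.1 j ≠ p.1 (j + 1)) ∧ ∀ j, p.2 (j + 1) = !p.2 j

lemma walkCount_K23 (k : ℕ) [NeZero k] : walkCount K23 k = (walkPairs k).card := by
  rw [walkCount, ← Set.ncard_coe_finset]
  refine Set.ncard_congr (fun p _ => (p.2, fun j => finTwoEquiv (p.1 j))) ?_ ?_ ?_
  · rintro ⟨i, e⟩ h
    rw [mem_coe, walkPairs, mem_filter]
    refine ⟨mem_univ _, fun j => (h j).2, fun j => ?_⟩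
    have h1 := (h j).1
    simp only [K23, Graph.banana_isLink, Set.mem_univ, true_and] at h1
    rcases h1 with ⟨h1, h2⟩ | ⟨h1, h2⟩ <;> simp [h1, h2, finTwoEquiv]
  · rintro ⟨i, e⟩ ⟨i', e'⟩ _ _ h
    rw [Prod.mk.injEq] at h
    refine Prod.ext (funext fun j => finTwoEquiv.injective (congrFun h.2 j)) h.1
  · rintro ⟨c, s⟩ h
    rw [mem_coe, walkPairs, mem_filter] at h
    refine ⟨(fun j => finTwoEquiv.symm (s j), c), fun j => ⟨?_, h.2.1 j⟩, by simp⟩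
    have h1 := h.2.2 j
    simp only [K23, Graph.banana_isLink, Set.mem_univ, true_and]
    cases hs : s j <;> simp_all [finTwoEquiv]

/-- The number of non-backtracking closed walks of even length. -/
lemma walkCount_K23_even (i : ℕ) : walkCount K23 (2 * (i + 1)) = 2 * (4 ^ (i + 1) + 2) := by
  set k := 2 * (i + 1) with hk
  have h1 : (walkPairs k).card = (univ.filter fun c : ZMod k → Fin 3 => ∀ j, c j ≠ c (j + 1)).card *
      (univ.filter fun s : ZMod k → Bool => ∀ j, s (j + 1) = !s j).card := by
    rw [← card_product]
    congr 1
    ext p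
    simp [walkPairs]
  have hcard : ∀ {S : Type} [Fintype S] [DecidableEq S] (P : S → S → Prop) [DecidableRel P],
      ((univ.filter fun c : ZMod k → S => ∀ j, P (c j) (c (j + 1))).card : ℝ) =
        ∑ c : ZMod k → S, ∏ j, if P (c j) (c (j + 1)) then 1 else 0 := by
    intro S _ _ P _
    simp_rw [prod_ite_zero]
    simp
  -- Biorthogonal eigenvectors of the matrix of distinct colours, with eigenvalues `2, -1, -1`. The
  -- swap of the two sides, treated next, has eigenvalues `1` and `-1`.
  have h2 := sum_prod_cyclic (k := k) (J := Fin 3) (S := Fin 3)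
    (fun _ => ![![2 / 3, 2 / 3, 2 / 3], ![-1 / 2, 1 / 2, 0], ![-1 / 6, -1 / 6, 1 / 3]])
    (fun _ => ![![1, 1, 1], ![1, -1, 0], ![1, 1, -2]]) (fun _ => ![2, -1, -1]) (by
      intro j r r'
      fin_cases r <;> fin_cases r' <;> simp [Fin.sum_univ_three] <;> norm_num)
  have h3 := sum_prod_cyclic (k := k) (J := Fin 2) (S := Bool)
    (fun _ r s => ![1 / 2, if s then -1 / 2 else 1 / 2] r)
    (fun _ r s => ![1, if s then 1 else -1] r) (fun _ => ![1, -1]) (by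
      intro j r r'
      fin_cases r <;> fin_cases r' <;> simp <;> norm_num)
  have h4 : ∀ t t' : Fin 3, ∑ r : Fin 3, (![![2 / 3, 2 / 3, 2 / 3], ![-1 / 2, 1 / 2, 0],
      ![-1 / 6, -1 / 6, 1 / 3]] : Fin 3 → Fin 3 → ℝ) r t *
      (![![1, 1, 1], ![1, -1, 0], ![1, 1, -2]] : Fin 3 → Fin 3 → ℝ) r t' =
      if t ≠ t' then 1 else 0 := by
    intro t t'
    fin_cases t <;> fin_cases t' <;> simp [Fin.sum_univ_three] <;> norm_num
  have h5 : ∀ s s' : Bool, ∑ r : Fin 2, (![1 / 2, if s then -1 / 2 else 1 / 2] : Fin 2 → ℝ) r *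
      (![1, if s' then 1 else -1] : Fin 2 → ℝ) r = if s' = !s then 1 else 0 := by
    intro s s'
    cases s <;> cases s' <;> simp <;> norm_num
  simp_rw [h4] at h2
  simp_rw [h5] at h3
  rw [← hcard fun t t' => t ≠ t'] at h2
  rw [← hcard fun s s' => s' = !s] at h3
  have h6 : ((-1 : ℝ)) ^ k = 1 := by rw [hk, pow_mul]; simp
  have h7 : (2 : ℝ) ^ k = 4 ^ (i + 1) := by rw [hk, pow_mul]; norm_num
  simp [Fin.sum_univ_three, ZMod.card, h6, h7] at h2 h3
  have h8 : ((walkPairs k).card : ℝ) = ((2 * (4 ^ (i + 1) + 2) : ℕ) : ℝ) := by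
    rw [h1]
    push_cast
    simp only [ne_eq]
    rw [h2, h3]
    ring
  rw [walkCount_K23]
  exact_mod_cast h8

end RandomLift

/-! ### The mean cycle numbers with and without a planted matching. -/

namespace RandomLift

open Finset ColouredWalk Topology

variable {n : ℕ} {T : Type*} [DecidableEq T]

/-- The weight of a step from `v` to `w` along an edge of colour `e`. -/
noncomputable def stepWeight (κ : Fin 3 → Vert n → T) (e : Fin 3) (v w : Vert n) : ℝ :=
  if κ e w = κ e v then
    ((univ.filter fun z => κ e (true, z) = κ e v).card : ℝ)⁻¹ else 0

lemma classSize_cycleEdge {κ : Fin 3 → Vert n → T} {k : ℕ} {c : ZMod k → Fin 3}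
    {b : ZMod k → Vert n} (hb : ∀ j, (b (j + 1)).1 = !(b j).1) {j : ZMod k}
    (h : κ (c j) (b (j + 1)) = κ (c j) (b j)) : classSize κ (cycleEdge c b j) =
      (univ.filter fun z => κ (c j) (true, z) = κ (c j) (b j)).card := by
  have h1 := hb j
  unfold cycleEdge classSize
  rcases hj : b j with ⟨_ | _, x⟩ <;> rcases hj' : b (j + 1) with ⟨_ | _, y⟩ <;> simp_all

/-- The colours and sides of a closed walk in the lift form a closed walk in `K_2^3`, and the labels
are then summed freely. -/
lemma sum_walkWeight (κ : Fin 3 → Vert n → T) (k : ℕ) [NeZero k] :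
    ∑ α ∈ closedWalks κ k, walkWeight κ α = ∑ p ∈ walkPairs k, ∑ x : ZMod k → Fin n,
      ∏ j, stepWeight κ (p.1 j) (p.2 j, x j) (p.2 (j + 1), x (j + 1)) := by
  classical
  have h1 : closedWalks κ k = (univ.filter fun α : (ZMod k → Fin 3) × (ZMod k → Vert n) =>
      (∀ j, α.1 j ≠ α.1 (j + 1)) ∧ ∀ j, (α.2 (j + 1)).1 = !(α.2 j).1).filter fun α =>
        ∀ j, κ (α.1 j) (α.2 (j + 1)) = κ (α.1 j) (α.2 j) := by
    ext α
    simp only [mem_closedWalks, mem_filter, mem_univ, true_and]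
    tauto
  rw [h1, sum_filter, ← sum_product']
  refine sum_nbij' (fun α => ((α.1, fun j => (α.2 j).1), fun j => (α.2 j).2))
    (fun y => (y.1.1, fun j => (y.1.2 j, y.2 j))) ?_ ?_ (fun _ _ => rfl) (fun _ _ => rfl) ?_
  · intro α hα
    simpa [walkPairs] using hα
  · intro y hy
    simpa [walkPairs] using hy
  · intro α hα
    have hα := (mem_filter.1 hα).2
    simp only [stepWeight, Prod.mk.eta]
    split_ifs with h
    · refine prod_congr rfl fun j _ => ?_
      rw [if_pos (h j), classSize_cycleEdge hα.2 (h j)]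
    · push Not at h
      obtain ⟨j, hj⟩ := h
      exact (prod_eq_zero (mem_univ j) (if_neg hj)).symm

/-- The mean number of cycles in a uniform random lift. -/
lemma tendsto_meanCycles (k : ℕ) : Tendsto
    (fun n : ℕ => meanCycles (fun _ _ => true : Fin 3 → Vert n → Bool) (k + 1)) atTop
    (𝓝 (walkCount K23 (k + 1))) := by
  have hs : ∀ n, Spread (fun _ _ => true : Fin 3 → Vert n → Bool) 1 := fun n t => by
    simp [classSize]
  set C := (((k : ℝ) + 1) ^ 2 / 1 * (12 / 1) ^ (k + 1) +
        3 ^ (k + 1) * ((k + 1) ^ 2 * 2 ^ k) * (1 / 1) ^ (k + 1)) with hC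
  have h0 : Tendsto (fun n : ℕ => C / n) atTop (𝓝 0) := tendsto_const_div_atTop_nhds_zero_nat C
  rw [← tendsto_sub_nhds_zero_iff]
  refine squeeze_zero_norm' ?_ h0
  filter_upwards [eventually_ge_atTop (2 * (k + 1))] with n hn
  have hn0 : (n : ℝ) ≠ 0 := by
    have : 0 < n := by omega
    positivity
  have h1 := abs_meanCycles_sub_le one_pos (hs n) (k := k) (by rw [one_mul]; exact_mod_cast hn)
  rw [sum_walkWeight] at h1
  have h2 : ∀ p ∈ walkPairs (k + 1), ∑ x : ZMod (k + 1) → Fin n,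
      ∏ j, stepWeight (fun _ _ => true : Fin 3 → Vert n → Bool) (p.1 j) (p.2 j, x j)
        (p.2 (j + 1), x (j + 1)) = 1 := fun p _ => by
    simp [stepWeight, ZMod.card, hn0]
  rw [sum_congr rfl h2, sum_const, nsmul_eq_mul, mul_one, ← walkCount_K23] at h1
  exact h1

/-- A sum over labels of a function of the types of the vertices. -/
lemma sum_comp_types {S : Type*} [Fintype S] [DecidableEq S] {k : ℕ} [NeZero k]
    (τ : ZMod k → Fin n → S) (Φ : (ZMod k → S) → ℝ) :
    ∑ x : ZMod k → Fin n, Φ (fun j => τ j (x j)) =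
      ∑ t : ZMod k → S, (∏ j, (counts (τ j) (t j) : ℝ)) * Φ t := by
  have h1 : ∀ t : ZMod k → S, (∏ j, (counts (τ j) (t j) : ℝ)) =
      ∑ x : ZMod k → Fin n, if (fun j => τ j (x j)) = t then 1 else 0 := fun t => by
    have h2 : ∀ j, (counts (τ j) (t j) : ℝ) = ∑ x : Fin n, if τ j x = t j then 1 else 0 :=
      fun j => by simp [counts]
    simp_rw [h2, prod_univ_sum, Fintype.piFinset_univ, Fintype.prod_boole, funext_iff]
  simp_rw [h1, sum_mul]
  rw [sum_comm]
  refine sum_congr rfl fun x _ => ?_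
  simp

/-- The weight of a step between vertices with given matching colours, if the colours have
proportions `y`. -/
noncomputable def typeWeight (y : Fin 3 → ℝ) (e t t' : Fin 3) : ℝ :=
  if (t' = e ↔ t = e) then y t * (if t = e then y e else 1 - y e)⁻¹ else 0

/-- The approximate number of cycles if the matching colours have proportions `y`. -/
noncomputable def plantedMean (k : ℕ) [NeZero k] (y : Fin 3 → ℝ) : ℝ :=
  ∑ p ∈ walkPairs k, ∑ t : ZMod k → Fin 3, ∏ j, typeWeight y (p.1 j) (t j) (t (j + 1))

lemma continuousAt_plantedMean (k : ℕ) [NeZero k] :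
    ContinuousAt (plantedMean k) fun _ => 1 / 3 := by
  have h : ∀ e t t', ContinuousAt (fun y => typeWeight y e t t') fun _ => (1 / 3 : ℝ) := by
    intro e t t'
    unfold typeWeight
    split_ifs
    · exact (continuous_apply _).continuousAt.mul
        ((continuous_apply _).continuousAt.inv₀ (by norm_num))
    · exact (continuous_apply _).continuousAt.mul
        (((continuous_apply _).continuousAt.const_sub 1 |>.inv₀ (by norm_num)))
    · exact continuousAt_const
  exact tendsto_finsetSum _ fun p _ => tendsto_finsetSum _ fun t _ =>
    tendsto_finsetProd _ fun j _ => h _ _ _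

/-- This is the origin of `δ_k`. At equal proportions a step of colour `e` only remembers whether
the matching colour is `e`, so its kernel has rank two. Because consecutive colours differ, the
factors of consecutive kernels are biorthogonal, with eigenvalues `1` and `-1 / 2`; every walk in
`K_2^3` contributes `1 + (-1 / 2) ^ k`. -/
lemma plantedMean_third (k : ℕ) [NeZero k] :
    plantedMean k (fun _ => 1 / 3) = walkCount K23 k * (1 + (-1 / 2) ^ k) := by
  rw [walkCount_K23, ← nsmul_eq_mul, ← sum_const]
  refine sum_congr rfl fun p hp => ?_
  have hp1 := (mem_filter.1 hp).2.1
  have h := sum_prod_cyclic (k := k) (J := Fin 2) (S := Fin 3)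
    (fun j r t => ![1 / 3, if t = p.1 j then 1 else -1 / 2] r)
    (fun j r t => ![1, if t = p.1 j then 2 / 3 else -1 / 3] r) (fun _ => ![1, -1 / 2]) (by
      intro j r r'
      have h1 := hp1 (j - 1)
      rw [sub_add_cancel] at h1
      generalize p.1 j = e at *
      generalize p.1 (j - 1) = e' at *
      fin_cases r <;> fin_cases r' <;> fin_cases e <;> fin_cases e' <;>
        simp [Fin.sum_univ_three] at h1 ⊢ <;> norm_num)
  have h2 : ∀ e t t' : Fin 3, ∑ r : Fin 2, (![1 / 3, if t = e then 1 else -1 / 2] : Fin 2 → ℝ) r *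
      (![1, if t' = e then 2 / 3 else -1 / 3] : Fin 2 → ℝ) r =
      typeWeight (fun _ => 1 / 3) e t t' := by
    intro e t t'
    rw [typeWeight]
    by_cases h3 : t = e <;> by_cases h4 : t' = e <;> simp [h3, h4] <;> norm_num
  simp_rw [h2] at h
  rw [h]
  simp [ZMod.card]

lemma card_filter_cover {τ : Vert n → Fin 3}
    (hτ : ∀ e, counts (fun x => τ (false, x)) e = counts (fun x => τ (true, x)) e)
    (e : Fin 3) (v : Vert n) : (univ.filter fun z => cover τ e (true, z) = cover τ e v).card =
      if τ v = e then counts (fun x => τ (false, x)) e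
        else n - counts (fun x => τ (false, x)) e := by
  rw [hτ]
  split_ifs with h
  · simp [cover, h, counts]
  · have := card_compl (univ.filter fun z => τ (true, z) = e)
    rw [Fintype.card_fin] at this
    rw [counts, ← this]
    congr 1
    ext z
    simp [cover, h]

lemma counts_le (f : Fin n → Fin 3) (e : Fin 3) : counts f e ≤ n :=
  (card_le_univ _).trans (by simp)

lemma sum_walkWeight_cover {τ : Vert n → Fin 3} (hn : 0 < n)
    (hτ : ∀ e, counts (fun x => τ (false, x)) e = counts (fun x => τ (true, x)) e) (k : ℕ)
    [NeZero k] : ∑ α ∈ closedWalks (cover τ) k, walkWeight (cover τ) α =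
      plantedMean k fun e => counts (fun x => τ (false, x)) e / n := by
  have hn0 : (n : ℝ) ≠ 0 := by positivity
  set a : Fin 3 → ℝ := fun e => counts (fun x => τ (false, x)) e with ha
  rw [sum_walkWeight]
  refine sum_congr rfl fun p _ => ?_
  have h1 : ∀ e v w, stepWeight (cover τ) e v w =
      if (τ w = e ↔ τ v = e) then (if τ v = e then a e else n - a e)⁻¹ else 0 := by
    intro e v w
    rw [stepWeight, card_filter_cover hτ]
    refine if_congr (by simp [cover]) ?_ rfl
    congr 1
    split_ifs
    · rfl
    · rw [Nat.cast_sub (counts_le _ _)]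
  simp_rw [h1]
  have h2 := sum_comp_types (fun j x => τ (p.2 j, x)) fun t => ∏ j,
    if (t (j + 1) = p.1 j ↔ t j = p.1 j) then
      (if t j = p.1 j then a (p.1 j) else n - a (p.1 j))⁻¹ else 0
  refine h2.trans (sum_congr rfl fun t _ => ?_)
  rw [← prod_mul_distrib]
  refine prod_congr rfl fun j _ => ?_
  have h3 : (counts (fun x => τ (p.2 j, x)) (t j) : ℝ) = a (t j) := by
    cases p.2 j
    · rfl
    · rw [ha]; simp only; rw [hτ]
  rw [h3, typeWeight, mul_ite, mul_zero]
  refine if_congr Iff.rfl ?_ rfl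
  have h4 : (if t j = p.1 j then a (p.1 j) / n else 1 - a (p.1 j) / n) =
      (if t j = p.1 j then a (p.1 j) else n - a (p.1 j)) / n := by
    split_ifs
    · rfl
    · field_simp
  rw [h4, inv_div, ← mul_div_assoc]
  change _ = a (t j) / n * n / _
  rw [div_mul_cancel₀ _ hn0, div_eq_mul_inv]

lemma spread_cover {τ : Vert n → Fin 3}
    (hτ : ∀ e, counts (fun x => τ (false, x)) e = counts (fun x => τ (true, x)) e)
    (h : ∀ e, |(counts (fun x => τ (false, x)) e : ℝ) / n - 1 / 3| ≤ 1 / 6) :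
    Spread (cover τ) (1 / 6) := by
  intro t
  rw [classSize, card_filter_cover hτ]
  rcases Nat.eq_zero_or_pos n with rfl | hn
  · simp only [CharP.cast_eq_zero, mul_zero]; positivity
  have hn1 : (0 : ℝ) < n := by exact_mod_cast hn
  have h1 := abs_le.1 (h t.1)
  have h2 : (counts (fun x => τ (false, x)) t.1 : ℝ) =
    counts (fun x => τ (false, x)) t.1 / n * n := by field_simp
  split_ifs
  · rw [h2]; nlinarith
  · rw [Nat.cast_sub (counts_le _ _), h2]; nlinarith

/-- The mean number of cycles in a random lift with a given perfect matching. -/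
lemma exists_abs_meanCycles_cover_le (k : ℕ) {η : ℝ} (hη : 0 < η) :
    ∃ ε : ℝ, 0 < ε ∧ ε ≤ 1 / 6 ∧ ∃ n₀ : ℕ, ∀ n ≥ n₀, ∀ τ : Vert n → Fin 3,
      (∀ e, counts (fun x => τ (false, x)) e = counts (fun x => τ (true, x)) e) →
      (∀ e, |(counts (fun x => τ (false, x)) e : ℝ) / n - 1 / 3| ≤ ε) →
      |meanCycles (cover τ) (k + 1) - walkCount K23 (k + 1) * (1 + (-1 / 2) ^ (k + 1))| ≤ η := by
  have hc := continuousAt_plantedMean (k + 1)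
  rw [Metric.continuousAt_iff] at hc
  obtain ⟨ε, hε, h1⟩ := hc (η / 2) (by positivity)
  set δ : ℝ := 1 / 6 with hδ
  set C := (((k : ℝ) + 1) ^ 2 / δ * (12 / δ) ^ (k + 1) +
        3 ^ (k + 1) * ((k + 1) ^ 2 * 2 ^ k) * (1 / δ) ^ (k + 1)) with hC
  have h0 : Tendsto (fun n : ℕ => C / n) atTop (𝓝 0) := tendsto_const_div_atTop_nhds_zero_nat C
  obtain ⟨n₀, hn₀⟩ := eventually_atTop.1 (h0.eventually (gt_mem_nhds (half_pos hη)))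
  refine ⟨min (ε / 2) δ, by positivity, min_le_right _ _, max n₀ (12 * (k + 1)),
    fun n hn τ hτ hb => ?_⟩
  have hn1 := hn₀ n (le_of_max_le_left hn)
  have hn2 := le_of_max_le_right hn
  have hs := spread_cover hτ fun e => (hb e).trans (min_le_right _ _)
  have h2 := abs_meanCycles_sub_le (by norm_num [hδ]) (hs : Spread (cover τ) δ) (k := k) (by
    have : ((12 * (k + 1) : ℕ) : ℝ) ≤ n := by exact_mod_cast hn2
    push_cast at this ⊢
    linarith)
  rw [sum_walkWeight_cover (by omega) hτ] at h2
  change _ ≤ C / n at h2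
  have h3 : dist (fun e => (counts (fun x => τ (false, x)) e : ℝ) / n) (fun _ => 1 / 3) < ε := by
    refine (dist_pi_lt_iff hε).2 fun e => ?_
    rw [Real.dist_eq]
    exact ((hb e).trans (min_le_left _ _)).trans_lt (by linarith)
  have h4 := h1 h3
  rw [plantedMean_third, Real.dist_eq] at h4
  have h5 := abs_sub_le (meanCycles (cover τ) (k + 1))
    (plantedMean (k + 1) fun e => (counts (fun x => τ (false, x)) e : ℝ) / n)
    (walkCount K23 (k + 1) * (1 + (-1 / 2) ^ (k + 1)))
  linarith

end RandomLift

/-! ### Discrete laws that satisfy the Poisson recursion asymptotically. -/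

namespace PoissonRecursion

open Finset Topology

/-- The unnormalized weights of a Poisson variable with mean `l`, on the multiples of `L`. -/
noncomputable def weight (L : ℕ) (l : ℝ) (x : ℕ) : ℝ :=
  if L ∣ x then l ^ (x / L) / (x / L).factorial else 0

lemma weight_nonneg {L : ℕ} {l : ℝ} (hl : 0 ≤ l) (x : ℕ) : 0 ≤ weight L l x := by
  unfold weight; split_ifs <;> positivity

lemma weight_mul {L : ℕ} (l : ℝ) (z : ℕ) (hL : 0 < L) :
    weight L l (L * z) = l ^ z / z.factorial := by
  simp [weight, Nat.mul_div_cancel_left _ hL]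

lemma hasSum_weight {L : ℕ} (hL : 0 < L) (l : ℝ) : HasSum (weight L l) (Real.exp l) := by
  have hinj : Function.Injective fun z : ℕ => L * z := fun _ _ h => Nat.eq_of_mul_eq_mul_left hL h
  rw [← hinj.hasSum_iff]
  · have h := NormedSpace.expSeries_div_hasSum_exp l
    rw [← Real.exp_eq_exp_ℝ] at h
    convert! h using 1
    exact funext fun z => weight_mul l z hL
  · intro x hx
    rw [weight, if_neg]
    rintro ⟨z, rfl⟩
    exact hx ⟨z, rfl⟩

/-- The Poisson recursion `y * p y = l * p (y - 1)`, rescaled by `L`. In the application `L` is the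
number of rootings of a cycle. -/
lemma mul_weight {L : ℕ} (hL : 0 < L) (l : ℝ) {x : ℕ} (hx : 0 < x) :
    x * weight L l x = (L * l) * if L ≤ x then weight L l (x - L) else 0 := by
  by_cases h : L ∣ x
  · obtain ⟨z, rfl⟩ := h
    obtain ⟨z, rfl⟩ : ∃ z', z = z' + 1 := ⟨z - 1, by
      have : z ≠ 0 := by rintro rfl; simp at hx
      omega⟩
    rw [if_pos (Nat.le_mul_of_pos_right _ (by omega)), show L * (z + 1) - L = L * z by
      rw [mul_add, mul_one, Nat.add_sub_cancel], weight_mul _ _ hL, weight_mul _ _ hL,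
      Nat.factorial_succ, pow_succ]
    have : (z.factorial : ℝ) ≠ 0 := by positivity
    push_cast
    field_simp
  · rw [weight, if_neg h, mul_zero]
    split_ifs with h2
    · rw [weight, if_neg, mul_zero]
      intro h3
      have := Nat.dvd_add h3 (dvd_refl L)
      rw [Nat.sub_add_cancel h2] at this
      exact h this
    · simp

variable {ι : Type*} [Fintype ι] [DecidableEq ι]

/-- A sequence of discrete laws that satisfies the recursion of a product of Poisson laws
asymptotically. -/
structure IsAsymptoticallyPoisson (L : ι → ℕ) (l : ι → ℝ) (Q : ℕ → (ι → ℕ) → ℝ) : Prop where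
  nonneg : ∀ n r, 0 ≤ Q n r
  sum_le_one : ∀ᶠ n in atTop, ∀ s : Finset (ι → ℕ), ∑ r ∈ s, Q n r ≤ 1
  tight : ∀ ε > 0, ∃ s : Finset (ι → ℕ), ∀ᶠ n in atTop, 1 - ε ≤ ∑ r ∈ s, Q n r
  recursion : ∀ i r, Tendsto (fun n => r i * Q n r - L i * l i *
    if L i ≤ r i then Q n (r - Pi.single i (L i)) else 0) atTop (𝓝 0)

/-- The weights of the limit law. -/
noncomputable def prodWeight (L : ι → ℕ) (l : ι → ℝ) (r : ι → ℕ) : ℝ :=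
  ∏ i, weight (L i) (l i) (r i)

lemma mul_prodWeight {L : ι → ℕ} (hL : ∀ i, 0 < L i) (l : ι → ℝ) {r : ι → ℕ} {i : ι}
    (hi : 0 < r i) : r i * prodWeight L l r =
      L i * l i * if L i ≤ r i then prodWeight L l (r - Pi.single i (L i)) else 0 := by
  have h := mul_weight (hL i) (l i) hi
  have h1 : ∀ x, (∏ j ∈ univ.erase i, weight (L j) (l j) ((r - Pi.single i x : ι → ℕ) j)) =
      ∏ j ∈ univ.erase i, weight (L j) (l j) (r j) := fun x =>
    prod_congr rfl fun j hj => by simp [(mem_erase.1 hj).1]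
  simp only [prodWeight, ← mul_prod_erase univ _ (mem_univ i), h1]
  rw [← mul_assoc, h]
  split_ifs <;> simp [mul_assoc]

/-- Induction on the total: the recursion lowers a nonzero coordinate `i` by `L i`, or it forces `Q
n r → 0` if `r i < L i`. So the laws are determined up to the factor `Q n 0`. -/
lemma IsAsymptoticallyPoisson.tendsto_sub {L : ι → ℕ} (hL : ∀ i, 0 < L i) {l : ι → ℝ}
    {Q : ℕ → (ι → ℕ) → ℝ} (h : IsAsymptoticallyPoisson L l Q) (N : ℕ) :
    ∀ r : ι → ℕ, ∑ i, r i ≤ N →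
      Tendsto (fun n => Q n r - prodWeight L l r * Q n 0) atTop (𝓝 0) := by
  induction N with
  | zero =>
    intro r hr
    have : r = 0 := by
      ext i
      have := single_le_sum (f := r) (fun j _ => Nat.zero_le _) (mem_univ i)
      simp only [Pi.zero_apply]
      omega
    subst this
    simp [prodWeight, weight]
  | succ N ih =>
    intro r hr
    by_cases hr0 : ∀ i, r i = 0
    · exact ih r (by simp [hr0])
    push Not at hr0
    obtain ⟨i, hi⟩ := hr0
    have hi0 : 0 < r i := Nat.pos_of_ne_zero hi
    have hi1 : (r i : ℝ) ≠ 0 := by positivity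
    have h1 := h.recursion i r
    have h2 := mul_prodWeight hL l hi0
    by_cases hle : L i ≤ r i
    · simp only [if_pos hle] at h1 h2
      have h3 := ih (r - Pi.single i (L i)) (by
        have h4 : ∑ j, (r - Pi.single i (L i) : ι → ℕ) j + L i = ∑ j, r j := by
          rw [← add_sum_erase univ _ (mem_univ i), ← add_sum_erase univ r (mem_univ i)]
          have h5 : ∑ j ∈ univ.erase i, (r - Pi.single i (L i) : ι → ℕ) j = ∑ j ∈ univ.erase i, r j :=
            sum_congr rfl fun j hj => by simp [(mem_erase.1 hj).1]
          rw [h5]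
          simp only [Pi.sub_apply, Pi.single_eq_same]
          omega
        have := hL i
        omega)
      have h4 := (h1.add (h3.const_mul (L i * l i))).const_mul (r i : ℝ)⁻¹
      simp only [mul_zero, add_zero] at h4
      refine h4.congr fun n => ?_
      have h5 : prodWeight L l r = (r i : ℝ)⁻¹ *
          (L i * l i * prodWeight L l (r - Pi.single i (L i))) := by
        rw [← h2, inv_mul_cancel_left₀ hi1]
      rw [h5]
      field_simp
      ring
    · simp only [if_neg hle, mul_zero, sub_zero] at h1 h2
      have h3 : prodWeight L l r = 0 := by simpa [hi1] using h2
      have h4 := h1.const_mul (r i : ℝ)⁻¹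
      rw [mul_zero] at h4
      refine h4.congr fun n => ?_
      rw [h3, inv_mul_cancel_left₀ hi1]
      ring

lemma sum_prodWeight_box (L : ι → ℕ) (l : ι → ℝ) (K : ℕ) :
    ∑ r ∈ Fintype.piFinset fun _ : ι => range K, prodWeight L l r =
      ∏ i, ∑ x ∈ range K, weight (L i) (l i) x := by
  rw [prod_univ_sum]
  rfl

lemma tendsto_sum_prodWeight_box {L : ι → ℕ} (hL : ∀ i, 0 < L i) (l : ι → ℝ) :
    Tendsto (fun K => ∑ r ∈ Fintype.piFinset fun _ : ι => range K, prodWeight L l r) atTop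
      (𝓝 (∏ i, Real.exp (l i))) := by
  simp_rw [sum_prodWeight_box]
  exact tendsto_finsetProd _ fun i _ => (hasSum_weight (hL i) (l i)).tendsto_sum_nat

lemma prodWeight_nonneg {L : ι → ℕ} {l : ι → ℝ} (hl : ∀ i, 0 ≤ l i) (r : ι → ℕ) :
    0 ≤ prodWeight L l r :=
  prod_nonneg fun i _ => weight_nonneg (hl i) _

lemma sum_prodWeight_le {L : ι → ℕ} (hL : ∀ i, 0 < L i) {l : ι → ℝ} (hl : ∀ i, 0 ≤ l i)
    (s : Finset (ι → ℕ)) : ∑ r ∈ s, prodWeight L l r ≤ ∏ i, Real.exp (l i) := by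
  obtain ⟨K, hK⟩ : ∃ K, s ⊆ Fintype.piFinset fun _ : ι => range K := by
    refine ⟨s.sup (fun r => univ.sup r) + 1, fun r hr => Fintype.mem_piFinset.2 fun i => ?_⟩
    rw [mem_range, Nat.lt_succ_iff]
    exact (le_sup (f := r) (mem_univ i)).trans (le_sup (f := fun r => univ.sup r) hr)
  refine (sum_le_sum_of_subset_of_nonneg hK fun r _ _ => prodWeight_nonneg hl r).trans ?_
  rw [sum_prodWeight_box]
  exact prod_le_prod (fun i _ => sum_nonneg fun x _ => weight_nonneg (hl i) x) fun i _ =>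
    sum_le_hasSum _ (fun x _ => weight_nonneg (hl i) x) (hasSum_weight (hL i) (l i))

/-- Tightness and total mass at most `1` fix the remaining factor: `Q n 0` times the total weight `∏
exp (l i)` tends to `1`. -/
lemma IsAsymptoticallyPoisson.tendsto {L : ι → ℕ} (hL : ∀ i, 0 < L i) {l : ι → ℝ}
    (hl : ∀ i, 0 ≤ l i) {Q : ℕ → (ι → ℕ) → ℝ} (h : IsAsymptoticallyPoisson L l Q) (r : ι → ℕ) :
    Tendsto (fun n => Q n r) atTop (𝓝 (prodWeight L l r / ∏ i, Real.exp (l i))) := by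
  set E := ∏ i, Real.exp (l i) with hE
  have hE0 : 0 < E := prod_pos fun i _ => Real.exp_pos _
  have hs : ∀ s : Finset (ι → ℕ), Tendsto (fun n => ∑ r ∈ s, Q n r -
      (∑ r ∈ s, prodWeight L l r) * Q n 0) atTop (𝓝 0) := fun s => by
    have := tendsto_finsetSum s fun r _ => h.tendsto_sub hL _ r le_rfl
    simpa [sum_sub_distrib, sum_mul] using this
  have h0 : Tendsto (fun n => E * Q n 0) atTop (𝓝 1) := by
    rw [Metric.tendsto_nhds]
    intro ε hε
    obtain ⟨K, hK⟩ := ((tendsto_sum_prodWeight_box hL l).eventually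
      (lt_mem_nhds (show E - ε / 3 < E by linarith))).exists
    obtain ⟨s, hs1⟩ := h.tight (ε / 3) (by positivity)
    filter_upwards [h.sum_le_one, hs1,
      (hs s).eventually (gt_mem_nhds (show 0 < ε / 3 by positivity)),
      (hs (Fintype.piFinset fun _ : ι => range K)).eventually
        (lt_mem_nhds (show -(ε / 3) < 0 by linarith))] with n h1 h2 h3 h4
    have h5 := h.nonneg n 0
    have h6 : Q n 0 ≤ 1 := by simpa using h1 {0}
    have h7 := h1 (Fintype.piFinset fun _ : ι => range K)
    have h8 : (∑ r ∈ s, prodWeight L l r) * Q n 0 ≤ E * Q n 0 :=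
      mul_le_mul_of_nonneg_right (sum_prodWeight_le hL hl s) h5
    have h9 : (E - ε / 3) * Q n 0 ≤
        (∑ r ∈ Fintype.piFinset fun _ : ι => range K, prodWeight L l r) * Q n 0 :=
      mul_le_mul_of_nonneg_right hK.le h5
    have h10 : ε / 3 * Q n 0 ≤ ε / 3 := mul_le_of_le_one_right (by positivity) h6
    rw [Real.dist_eq, abs_lt]
    constructor <;> linarith
  have h1 := (h.tendsto_sub hL _ r le_rfl).add ((h0.const_mul (prodWeight L l r / E)))
  rw [zero_add, mul_one] at h1
  refine h1.congr fun n => ?_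
  field_simp
  ring

end PoissonRecursion

/-! ### Poisson limits for mixtures of models. -/

namespace RandomLift

open Finset ColouredWalk Topology PoissonRecursion

/-- The number of lifts that respect the classes `κ` and have given numbers of cycles. -/
noncomputable def cycleVecCard {n : ℕ} (κ : Fin 3 → Vert n → Bool) {m : ℕ} (r : Fin m → ℕ) : ℝ :=
  ∑ σ ∈ model κ, if cycleVec m σ = r then 1 else 0

/-- The law of the numbers of cycles in a mixture of models. -/
noncomputable def mixture {ι : ℕ → Type} [∀ n, Fintype (ι n)]
    (κ : ∀ n, ι n → Fin 3 → Vert n → Bool) (m n : ℕ) (r : Fin m → ℕ) : ℝ :=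
  (∑ a, cycleVecCard (κ n a) r) / ∑ a, ((model (κ n a)).card : ℝ)

lemma cycleVecCard_nonneg {n : ℕ} (κ : Fin 3 → Vert n → Bool) {m : ℕ} (r : Fin m → ℕ) :
    0 ≤ cycleVecCard κ r :=
  sum_nonneg fun σ _ => by split_ifs <;> norm_num

lemma sum_cycleVecCard {n : ℕ} (κ : Fin 3 → Vert n → Bool) {m : ℕ} (s : Finset (Fin m → ℕ)) :
    ∑ r ∈ s, cycleVecCard κ r = ∑ σ ∈ model κ, if cycleVec m σ ∈ s then 1 else 0 := by
  unfold cycleVecCard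
  rw [sum_comm]
  exact sum_congr rfl fun σ _ => by simp

lemma sum_cycleVecCard_le {n : ℕ} (κ : Fin 3 → Vert n → Bool) {m : ℕ} (s : Finset (Fin m → ℕ)) :
    ∑ r ∈ s, cycleVecCard κ r ≤ (model κ).card := by
  rw [sum_cycleVecCard, card_eq_sum_ones]
  push_cast
  exact sum_le_sum fun σ _ => by split_ifs <;> norm_num

lemma cycleVecCard_le {n : ℕ} (κ : Fin 3 → Vert n → Bool) {m : ℕ} (r : Fin m → ℕ) :
    cycleVecCard κ r ≤ (model κ).card := by
  simpa using sum_cycleVecCard_le κ {r}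

lemma sum_shift_eq {n : ℕ} (κ : Fin 3 → Vert n → Bool) {m : ℕ} (r : Fin m → ℕ) (i : Fin m)
    (L : ℕ) : (∑ σ ∈ model κ, if cycleVec m σ + Pi.single i L = r then (1 : ℝ) else 0) =
      if L ≤ r i then cycleVecCard κ (r - Pi.single i L) else 0 := by
  split_ifs with h
  · refine sum_congr rfl fun σ _ => if_congr ?_ rfl rfl
    refine (eq_tsub_iff_add_eq_of_le ?_).symm
    intro j
    by_cases hj : j = i
    · subst hj; simpa using h
    · simp [hj]
  · refine sum_eq_zero fun σ _ => if_neg fun h1 => h ?_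
    rw [← h1]
    simp

lemma sum_le_of_exceptional {ι : Type*} [Fintype ι] {x M : ι → ℝ} {B : Finset ι} {c D : ℝ}
    (hc : 0 ≤ c) (hM : ∀ a, 0 ≤ M a) (hB : ∀ a ∈ B, x a ≤ D * M a)
    (hG : ∀ a ∉ B, x a ≤ c * M a) : ∑ a, x a ≤ c * ∑ a, M a + D * ∑ a ∈ B, M a := by
  classical
  rw [← sum_add_sum_compl B x, mul_sum, mul_sum, add_comm]
  refine add_le_add ?_ (sum_le_sum hB)
  refine (sum_le_sum fun a ha => hG a (mem_compl.1 ha)).trans ?_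
  exact sum_le_sum_of_subset_of_nonneg (subset_univ _) fun a _ _ => mul_nonneg hc (hM a)

/-- The numbers of cycles are asymptotically Poisson in a mixture of models with the same
asymptotic mean numbers of cycles. -/
theorem isAsymptoticallyPoisson_mixture {ι : ℕ → Type} [∀ n, Fintype (ι n)]
    (κ : ∀ n, ι n → Fin 3 → Vert n → Bool) {m : ℕ} {W : Fin m → ℝ} (hW : ∀ i, 0 ≤ W i) {δ : ℝ}
    (hδ : 0 < δ) (hZ : ∀ᶠ n in atTop, 0 < ∑ a, ((model (κ n a)).card : ℝ))
    (hgood : ∀ η > 0, ∀ᶠ n in atTop, ∃ B : Finset (ι n),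
      (∀ a ∉ B, Spread (κ n a) δ ∧
        ∀ i : Fin m, |meanCycles (κ n a) (2 * ((i : ℕ) + 1)) - W i| ≤ η) ∧
      ∑ a ∈ B, ((model (κ n a)).card : ℝ) ≤ η * ∑ a, ((model (κ n a)).card : ℝ)) :
    IsAsymptoticallyPoisson (fun i : Fin m => 2 * (2 * ((i : ℕ) + 1)))
      (fun i => W i / (2 * (2 * ((i : ℕ) + 1)) : ℕ)) (mixture κ m) where
  nonneg n r := div_nonneg (sum_nonneg fun a _ => cycleVecCard_nonneg _ _)
    (sum_nonneg fun a _ => by positivity)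
  sum_le_one := by
    filter_upwards [hZ] with n hn s
    unfold mixture
    rw [← sum_div, sum_comm, div_le_one hn]
    exact sum_le_sum fun a _ => sum_cycleVecCard_le _ _
  tight := by
    intro ε hε
    -- Markov's inequality: outside the box some coordinate is at least `K`, and the mean cycle
    -- numbers are bounded.
    obtain ⟨K, hK⟩ := exists_nat_gt ((∑ i, (W i + ε / 2)) / (ε / 2))
    have hK0 : (0 : ℝ) < K := lt_of_le_of_lt (div_nonneg (sum_nonneg fun i _ => by
      have := hW i; positivity) (by positivity)) hK
    refine ⟨Fintype.piFinset fun _ => range K, ?_⟩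
    filter_upwards [hZ, hgood (ε / 2) (by positivity),
      (tendsto_natCast_atTop_atTop.const_mul_atTop hδ).eventually_ge_atTop
        (2 * (2 * m : ℝ))] with n hn ⟨B, hB1, hB2⟩ hnm
    unfold mixture
    rw [← sum_div, sum_comm, le_div_iff₀ hn]
    have h1 := sum_le_of_exceptional (B := B) (c := ε / 2) (D := 1)
      (x := fun a => ((model (κ n a)).card : ℝ) -
        ∑ r ∈ Fintype.piFinset fun _ : Fin m => range K, cycleVecCard (κ n a) r)
      (M := fun a => ((model (κ n a)).card : ℝ)) (by positivity) (fun a => by positivity)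
      (fun a _ => by
        have := sum_nonneg fun r (_ : r ∈ Fintype.piFinset fun _ : Fin m => range K) =>
          cycleVecCard_nonneg (κ n a) r
        linarith) (fun a ha => by
        obtain ⟨hs, hm⟩ := hB1 a ha
        rw [sum_cycleVecCard, card_eq_sum_ones]
        push_cast
        rw [← sum_sub_distrib]
        calc _ ≤ ∑ σ ∈ model (κ n a), ∑ i : Fin m, (cycleVec m σ i : ℝ) / K := by
              refine sum_le_sum fun σ _ => ?_
              split_ifs with h
              · rw [sub_self]; positivity
              · rw [Fintype.mem_piFinset] at h
                push Not at h
                obtain ⟨i, hi⟩ := h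
                rw [mem_range, not_lt] at hi
                rw [sub_zero]
                refine le_trans ?_ (single_le_sum (fun i _ => by positivity) (mem_univ i))
                rw [le_div_iff₀ hK0, one_mul]
                exact_mod_cast hi
          _ = ∑ i : Fin m, (meanCycles (κ n a) (2 * ((i : ℕ) + 1)) / K) *
                (model (κ n a)).card := by
              rw [sum_comm]
              refine sum_congr rfl fun i _ => ?_
              rw [← sum_div]
              unfold cycleVec
              rw [sum_cycleCount hδ hs]
              · ring
              · refine le_trans ?_ hnm
                have : ((i : ℕ) : ℝ) + 1 ≤ m := by exact_mod_cast i.2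
                push_cast
                linarith
          _ ≤ ∑ i : Fin m, ((W i + ε / 2) / K) * (model (κ n a)).card := by
              refine sum_le_sum fun i _ => ?_
              have := (abs_le.1 (hm i)).2
              gcongr
              linarith
          _ = (∑ i : Fin m, (W i + ε / 2)) / K * (model (κ n a)).card := by
              rw [← sum_mul, sum_div]
          _ ≤ ε / 2 * (model (κ n a)).card := by
              refine mul_le_mul_of_nonneg_right ?_ (by positivity)
              rw [div_lt_iff₀ (by positivity)] at hK
              rw [div_le_iff₀ hK0]
              linarith
          _ = _ := by rw [card_eq_sum_ones]; push_cast; rfl)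
    rw [sum_sub_distrib] at h1
    linarith
  recursion := by
    intro i r
    obtain ⟨C, n₀, hC⟩ := exists_switching_error hδ i
    have hWi := hW i
    set D : ℝ := r i + W i with hD
    have hD0 : 0 ≤ D := by positivity
    rw [Metric.tendsto_nhds]
    intro ε hε
    set η := ε / (2 * (1 + D)) with hη
    have hη0 : 0 < η := by positivity
    have hηD : η * (1 + D) = ε / 2 := by rw [hη]; field_simp
    have hC0 : Tendsto (fun n : ℕ => C / n) atTop (𝓝 0) :=
      tendsto_const_div_atTop_nhds_zero_nat C
    filter_upwards [hZ, hgood η hη0, eventually_ge_atTop n₀,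
      hC0.eventually (gt_mem_nhds (half_pos hε))] with n hn ⟨B, hB1, hB2⟩ hn0 hCn
    rw [Real.dist_eq, sub_zero]
    set L := 2 * (2 * ((i : ℕ) + 1)) with hL
    have hL0 : ((L : ℕ) : ℝ) ≠ 0 := by positivity
    -- The Poisson mean is `W i / L`, since a cycle has `L` rootings, and the recursion multiplies
    -- it by `L`; the rooted mean `W i` of the switching identity remains.
    rw [mul_div_cancel₀ _ hL0]
    set N : ι n → ℝ := fun a => cycleVecCard (κ n a) r with hN
    set N' : ι n → ℝ := fun a =>
      if L ≤ r i then cycleVecCard (κ n a) (r - Pi.single i L) else 0 with hN'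
    have h1 : r i * mixture κ m n r - W i *
        (if L ≤ r i then mixture κ m n (r - Pi.single i L) else 0) =
        (∑ a, (r i * N a - W i * N' a)) / ∑ a, ((model (κ n a)).card : ℝ) := by
      rw [sum_sub_distrib, ← mul_sum, ← mul_sum, sub_div, mul_div_assoc, mul_div_assoc]
      congr 2
      simp only [hN', mixture]
      split_ifs <;> simp
    rw [h1, abs_div, abs_of_pos hn, div_lt_iff₀ hn]
    have hN'le : ∀ a, 0 ≤ N' a ∧ N' a ≤ (model (κ n a)).card := fun a => by
      simp only [hN']
      split_ifs
      · exact ⟨cycleVecCard_nonneg _ _, cycleVecCard_le _ _⟩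
      · exact ⟨le_rfl, by positivity⟩
    have hNle : ∀ a, 0 ≤ N a ∧ N a ≤ (model (κ n a)).card := fun a =>
      ⟨cycleVecCard_nonneg _ _, cycleVecCard_le _ _⟩
    have h2 := sum_le_of_exceptional (B := B) (c := max (C / n) 0 + η) (D := D)
      (x := fun a => |r i * N a - W i * N' a|)
      (M := fun a => ((model (κ n a)).card : ℝ)) (by positivity) (fun a => by positivity)
      (fun a _ => by
        rw [abs_le, hD]
        have := hNle a
        have := hN'le a
        constructor <;> nlinarith [Nat.cast_nonneg (α := ℝ) (r i)]) (fun a ha => by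
        obtain ⟨hs, hm⟩ := hB1 a ha
        -- The switching identity for the indicator of `r`. On good models the only losses are its
        -- error `C / n` and the deviation of the mean from `W i`.
        have h3 := hC n hn0 (κ n a) hs (fun r' => if r' = r then 1 else 0)
          (fun r' => by split_ifs <;> norm_num) (fun r' => by split_ifs <;> norm_num)
        rw [sum_shift_eq] at h3
        have h4 : ∑ σ ∈ model (κ n a), (cycleVec m σ i : ℝ) *
            (if cycleVec m σ = r then 1 else 0) = r i * N a := by
          simp only [hN, cycleVecCard]
          rw [mul_sum]
          refine sum_congr rfl fun σ _ => ?_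
          split_ifs with h
          · rw [h]
          · simp
        rw [h4] at h3
        change |r i * N a - meanCycles (κ n a) (2 * ((i : ℕ) + 1)) * N' a| ≤ _ at h3
        have h5 := hm i
        have h6 : |(meanCycles (κ n a) (2 * ((i : ℕ) + 1)) - W i) * N' a| ≤
            η * (model (κ n a)).card := by
          rw [abs_mul, abs_of_nonneg (hN'le a).1]
          exact mul_le_mul h5 (hN'le a).2 (hN'le a).1 hη0.le
        have h7 : r i * N a - W i * N' a =
            (r i * N a - meanCycles (κ n a) (2 * ((i : ℕ) + 1)) * N' a) +
            (meanCycles (κ n a) (2 * ((i : ℕ) + 1)) - W i) * N' a := by ring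
        rw [h7, add_mul]
        refine (abs_add_le _ _).trans (add_le_add (h3.trans ?_) h6)
        exact mul_le_mul_of_nonneg_right (le_max_left _ _) (by positivity))
    refine (abs_sum_le_sum_abs _ _).trans_lt (h2.trans_lt ?_)
    have h8 : max (C / n) 0 < ε / 2 := max_lt hCn (half_pos hε)
    calc _ ≤ (max (C / n) 0 + η) * ∑ a, ((model (κ n a)).card : ℝ) +
          D * (η * ∑ a, ((model (κ n a)).card : ℝ)) := by gcongr
      _ = (max (C / n) 0 + η * (1 + D)) * ∑ a, ((model (κ n a)).card : ℝ) := by ring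
      _ < _ := by
          refine mul_lt_mul_of_pos_right ?_ hn
          linarith

end RandomLift

/-! ### Poisson limits under the uniform and the planted law. -/

namespace RandomLift

open Finset ColouredWalk Topology PoissonRecursion

lemma counts_eq_of_model_nonempty {n : ℕ} {τ : Vert n → Fin 3} (h : (model (cover τ)).Nonempty)
    (e : Fin 3) : counts (fun x => τ (false, x)) e = counts (fun x => τ (true, x)) e := by
  obtain ⟨σ, hσ⟩ := h
  rw [mem_model_cover] at hσ
  refine card_nbij (σ e) (fun x hx => ?_) (σ e).injective.injOn fun y hy => ?_
  · have := hσ e (false, x)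
    simp_all
  · have := hσ e (true, y)
    refine ⟨(σ e).symm y, ?_, by simp⟩
    simp_all

lemma sum_counts_eq {n : ℕ} (f : Fin n → Fin 3) : ∑ e, counts f e = n := by
  have := card_eq_sum_card_fiberwise (f := f) (s := univ) (t := univ) (fun _ _ => by simp)
  simpa [counts] using this.symm

/-- The counts add up to `n`, so lower bounds for all three colours bound each of them from above.
-/
lemma abs_counts_div_sub_le {n : ℕ} (hn : 0 < n) {f : Fin n → Fin 3} {ε : ℝ}
    (h : ∀ e, (1 / 3 - ε) * n < counts f e) (e : Fin 3) :
    |(counts f e : ℝ) / n - 1 / 3| ≤ 2 * ε := by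
  have hn1 : (0 : ℝ) < n := by exact_mod_cast hn
  have h1 : ∑ e, (counts f e : ℝ) = n := by exact_mod_cast sum_counts_eq f
  rw [Fin.sum_univ_three] at h1
  have h2 := h 0
  have h3 := h 1
  have h4 := h 2
  have h5 : 0 ≤ ε := by nlinarith
  rw [abs_le, le_sub_iff_add_le, le_div_iff₀ hn1, sub_le_iff_le_add, div_le_iff₀ hn1]
  fin_cases e <;> simp only [Fin.zero_eta, Fin.mk_one, Fin.reduceFinMk] <;>
    constructor <;> nlinarith

lemma lam_coe (k : ℕ) : (lam k : ℝ) = walkCount K23 k / (2 * k) := by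
  simp [lam]

/-- Summing over the matchings biases the law of the lift by `X`: the mixture is the planted law. -/
lemma mixture_cover {m : ℕ} (n : ℕ) (r : Fin m → ℕ) :
    mixture (ι := fun n => Vert n → Fin 3) (fun _ τ => cover τ) m n r =
      (∑ σ, X K23 n σ * if cycleVec m σ = r then 1 else 0) / pairCount n := by
  rw [mixture, pairCount]
  congr 1
  simp_rw [X_K23, sum_mul, cycleVecCard]
  rw [sum_comm]
  refine sum_congr rfl fun τ _ => ?_
  simp_rw [ite_mul, one_mul, zero_mul]
  rw [← sum_filter]
  simp

lemma mixture_uniform {m : ℕ} (n : ℕ) (r : Fin m → ℕ) :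
    mixture (ι := fun _ => Unit) (fun _ _ _ _ => true) m n r =
      (∑ σ : Fin 3 → Equiv.Perm (Fin n), if cycleVec m σ = r then 1 else 0) /
        (n.factorial : ℝ) ^ 3 := by
  have h : model (fun _ _ => true : Fin 3 → Vert n → Bool) = univ := by ext; simp [model]
  simp [mixture, cycleVecCard, h, Fintype.card_perm]

/-- The numbers of cycles of a uniform random lift are asymptotically Poisson. -/
lemma isAsymptoticallyPoisson_uniform (m : ℕ) :
    IsAsymptoticallyPoisson (fun i : Fin m => 2 * (2 * ((i : ℕ) + 1)))
      (fun i => (lam (2 * ((i : ℕ) + 1)) : ℝ)) fun n r =>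
        (∑ σ : Fin 3 → Equiv.Perm (Fin n), if cycleVec m σ = r then 1 else 0) /
          (n.factorial : ℝ) ^ 3 := by
  have h := isAsymptoticallyPoisson_mixture (ι := fun _ => Unit) (fun _ _ _ _ => true)
    (m := m) (W := fun i => walkCount K23 (2 * ((i : ℕ) + 1))) (fun i => by positivity) (δ := 1)
    one_pos (Eventually.of_forall fun n => by
      have h : model (fun _ _ => true : Fin 3 → Vert n → Bool) = univ := by ext; simp [model]
      simp only [univ_unique, sum_singleton, h]
      rw [card_univ]
      exact_mod_cast Fintype.card_pos) (fun η hη => by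
      have h1 : ∀ i : Fin m, ∀ᶠ n in atTop, |meanCycles
          (fun _ _ => true : Fin 3 → Vert n → Bool) (2 * ((i : ℕ) + 1)) -
          walkCount K23 (2 * ((i : ℕ) + 1))| ≤ η := fun i => by
        have := (Metric.tendsto_nhds.1 (tendsto_meanCycles (2 * i + 1))) η hη
        filter_upwards [this] with n hn
        exact le_of_lt hn
      filter_upwards [eventually_all.2 h1] with n hn
      refine ⟨∅, fun _ _ => ⟨fun t => by simp [classSize], hn⟩, ?_⟩
      rw [sum_empty]
      positivity)
  convert! h using 1
  · ext i
    rw [lam_coe]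
    push_cast
    rfl
  · ext n r
    exact (mixture_uniform n r).symm

/-- The numbers of cycles of a random lift with a random perfect matching are asymptotically
Poisson. -/
lemma isAsymptoticallyPoisson_planted (m : ℕ) :
    IsAsymptoticallyPoisson (fun i : Fin m => 2 * (2 * ((i : ℕ) + 1)))
      (fun i => lam (2 * ((i : ℕ) + 1)) * (1 + delta (2 * ((i : ℕ) + 1)))) fun n r =>
        (∑ σ, X K23 n σ * if cycleVec m σ = r then 1 else 0) / pairCount n := by
  have hδ0 : ∀ i, 0 < 1 + delta (2 * (i + 1)) := fun i => by
    rw [delta, pow_mul]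
    positivity
  have hpos : ∀ᶠ n in atTop, 0 < pairCount n := by
    filter_upwards [eventually_firstMoment_pos] with n hn
    rw [firstMoment_eq] at hn
    by_contra h
    exact absurd hn (not_lt.2 (div_nonpos_of_nonpos_of_nonneg (not_lt.1 h) (by positivity)))
  have h := isAsymptoticallyPoisson_mixture (ι := fun n => Vert n → Fin 3) (fun _ τ => cover τ)
    (m := m) (W := fun i => walkCount K23 (2 * ((i : ℕ) + 1)) * (1 + delta (2 * ((i : ℕ) + 1))))
    (fun i => by have := hδ0 i; positivity) (δ := 1 / 6) (by norm_num) hpos (fun η hη => by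
      choose ε hε hε' n₀ hn₀ using fun i : Fin m => exists_abs_meanCycles_cover_le (2 * i + 1) hη
      have h1 : ∀ᶠ x in 𝓝[>] (0 : ℝ), ∀ i, 2 * x ≤ ε i := eventually_all.2 fun i =>
        eventually_nhdsWithin_of_eventually_nhds (by
          filter_upwards [gt_mem_nhds (half_pos (hε i))] with x hx
          linarith)
      have h2 : ∀ᶠ x in 𝓝[>] (0 : ℝ), x < 1 / 12 :=
        eventually_nhdsWithin_of_eventually_nhds (gt_mem_nhds (by norm_num))
      obtain ⟨x, ⟨hx1, hx2⟩, hx0⟩ := ((h1.and h2).and self_mem_nhdsWithin).exists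
      have h3 := (tendsto_unbalanced hx0 (by linarith)).eventually (gt_mem_nhds hη)
      filter_upwards [h3, hpos, eventually_gt_atTop 0,
        eventually_all.2 fun i => eventually_ge_atTop (n₀ i)] with n hn hn1 hn2 hn3
      classical
      -- The exceptional matchings are the unbalanced ones, which are rare, and those that occur in
      -- no lift, which have weight `0`.
      refine ⟨univ.filter fun τ => (∃ e, (counts (fun x => τ (false, x)) e : ℝ) ≤
        (1 / 3 - x) * n) ∨ model (cover τ) = ∅, fun τ hτ => ?_, ?_⟩
      · simp only [mem_filter, mem_univ, true_and, not_or, not_exists, not_le] at hτ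
        have h4 := counts_eq_of_model_nonempty (nonempty_iff_ne_empty.2 hτ.2)
        have h5 := abs_counts_div_sub_le hn2 hτ.1
        refine ⟨spread_cover h4 fun e => (h5 e).trans (by linarith), fun i => ?_⟩
        exact hn₀ i n (hn3 i) τ h4 fun e => (h5 e).trans (hx1 i)
      · rw [div_lt_iff₀ hn1] at hn
        refine le_trans ?_ hn.le
        rw [sum_filter]
        refine sum_le_sum fun τ _ => ?_
        split_ifs with h4 h5 h5
        · exact le_rfl
        · rw [h4.resolve_left h5]; simp
        · exact absurd (Or.inl h5) h4
        · exact le_rfl)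
  convert! h using 1
  · ext i
    rw [lam_coe]
    push_cast
    ring
  · ext n r
    exact (mixture_cover n r).symm

end RandomLift

/-! ### Second moments and convergence of the limit product. -/

namespace RandomLift

open Finset Topology

lemma lam_even (i : ℕ) : (lam (2 * (i + 1)) : ℝ) = (4 ^ (i + 1) + 2) / (2 * (i + 1)) := by
  rw [lam_coe, walkCount_K23_even]
  push_cast
  field_simp

lemma delta_even (i : ℕ) : delta (2 * (i + 1)) = (1 / 4) ^ (i + 1) := by
  rw [delta, pow_mul]
  norm_num

lemma one_add_delta_even_pos (i : ℕ) : 0 < 1 + delta (2 * (i + 1)) := by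
  rw [delta_even]
  positivity

/-- This form shows two logarithmic series, at `1/4` and at `1/16`. -/
lemma lam_mul_delta_sq_eq (i : ℕ) : lam (2 * (i + 1)) * delta (2 * (i + 1)) ^ 2 =
    1 / 2 * ((1 / 4 : ℝ) ^ (i + 1) / (i + 1)) + (1 / 16 : ℝ) ^ (i + 1) / (i + 1) := by
  have h : (1 / 16 : ℝ) ^ (i + 1) = (1 / 4) ^ (i + 1) * (1 / 4) ^ (i + 1) := by
    rw [← mul_pow]; norm_num
  have h2 : (4 : ℝ) ^ (i + 1) * (1 / 4) ^ (i + 1) = 1 := by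
    rw [← mul_pow]; norm_num
  rw [lam_even, delta_even, h]
  generalize (4 : ℝ) ^ (i + 1) = a at *
  generalize (1 / 4 : ℝ) ^ (i + 1) = b at *
  have h3 : (a + 2) * b ^ 2 = b + 2 * (b * b) := by linear_combination b * h2
  rw [div_mul_eq_mul_div, h3]
  field_simp

lemma lam_mul_delta_sq_le (i : ℕ) :
    lam (2 * (i + 1)) * delta (2 * (i + 1)) ^ 2 ≤ (1 / 4 : ℝ) ^ i := by
  rw [lam_mul_delta_sq_eq]
  have h : (1 / 16 : ℝ) ^ (i + 1) ≤ (1 / 4) ^ (i + 1) :=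
    pow_le_pow_left₀ (by norm_num) (by norm_num) _
  have h1 : (1 / 4 : ℝ) ^ (i + 1) / (i + 1) ≤ (1 / 4 : ℝ) ^ (i + 1) :=
    div_le_self (by positivity) (by linarith [(Nat.cast_nonneg i : (0 : ℝ) ≤ i)])
  have h2 : (1 / 16 : ℝ) ^ (i + 1) / (i + 1) ≤ (1 / 16 : ℝ) ^ (i + 1) :=
    div_le_self (by positivity) (by linarith [(Nat.cast_nonneg i : (0 : ℝ) ≤ i)])
  have h3 : (1 / 4 : ℝ) ^ (i + 1) = (1 / 4) ^ i / 4 := by rw [pow_succ]; ring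
  have : (0 : ℝ) < (1 / 4) ^ i := by positivity
  linarith

/-- The second moment of the limit is `32 / (15 √3)`. -/
lemma hasSum_lam_mul_delta_sq :
    HasSum (fun i : ℕ => (lam (2 * (i + 1)) * delta (2 * (i + 1)) ^ 2 : ℝ))
      (Real.log (32 / (15 * √3))) := by
  have h1 := Real.hasSum_pow_div_log_of_abs_lt_one (x := 1 / 4) (by norm_num [abs_of_pos])
  have h2 := Real.hasSum_pow_div_log_of_abs_lt_one (x := 1 / 16) (by norm_num [abs_of_pos])
  have h3 := (h1.mul_left (1 / 2)).add h2
  convert! h3 using 1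
  · exact funext lam_mul_delta_sq_eq
  · have h4 : Real.log (1 - 1 / 4) = Real.log 3 - Real.log 4 := by
      rw [← Real.log_div (by norm_num) (by norm_num)]; norm_num
    have h5 : Real.log (1 - 1 / 16) = Real.log 15 - Real.log 16 := by
      rw [← Real.log_div (by norm_num) (by norm_num)]; norm_num
    have h6 : Real.log 4 = 2 * Real.log 2 := by
      rw [show (4 : ℝ) = 2 ^ 2 by norm_num, Real.log_pow]; norm_num
    have h7 : Real.log 16 = 4 * Real.log 2 := by
      rw [show (16 : ℝ) = 2 ^ 4 by norm_num, Real.log_pow]; norm_num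
    have h8 : Real.log 32 = 5 * Real.log 2 := by
      rw [show (32 : ℝ) = 2 ^ 5 by norm_num, Real.log_pow]; norm_num
    rw [Real.log_div (by norm_num) (by positivity), Real.log_mul (by norm_num) (by positivity),
      Real.log_sqrt (by norm_num), h4, h5, h6, h7, h8]
    ring

lemma hasSum_pow_poissonMeasure (r : ℝ≥0) (a : ℝ) :
    HasSum (fun n : ℕ => Real.exp (-r) * r ^ n / n.factorial * a ^ n) (Real.exp (r * (a - 1))) := by
  have h := (NormedSpace.expSeries_div_hasSum_exp (r * a : ℝ)).mul_left (Real.exp (-r))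
  rw [← Real.exp_eq_exp_ℝ, ← Real.exp_add] at h
  convert! h using 1
  · ext n
    rw [mul_pow]
    ring
  · ring_nf

lemma integrable_pow_poissonMeasure (r : ℝ≥0) {a : ℝ} (ha : 0 ≤ a) :
    Integrable (fun n : ℕ => a ^ n) (poissonMeasure r) := by
  rw [integrable_poissonMeasure_iff]
  refine (hasSum_pow_poissonMeasure r a).summable.congr fun n => ?_
  rw [Real.norm_of_nonneg (by positivity)]

lemma integral_pow_poissonMeasure (r : ℝ≥0) (a : ℝ) :
    ∫ n : ℕ, a ^ n ∂poissonMeasure r = Real.exp (r * (a - 1)) := by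
  rw [integral_poissonMeasure]
  exact (hasSum_pow_poissonMeasure r a).tsum_eq

lemma integrable_factor_sub_one_sq (i : ℕ) :
    Integrable (fun y => (factor (2 * (i + 1)) y - 1) ^ 2)
      (poissonMeasure (lam (2 * (i + 1)))) := by
  have h := one_add_delta_even_pos i
  have h1 := integrable_pow_poissonMeasure (lam (2 * (i + 1))) h.le
  have h2 := integrable_pow_poissonMeasure (lam (2 * (i + 1))) (sq_nonneg (1 + delta (2 * (i + 1))))
  have h3 := ((h2.mul_const (Real.exp (-(lam (2 * (i + 1)) * delta (2 * (i + 1)))) ^ 2)).sub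
    (h1.mul_const (2 * Real.exp (-(lam (2 * (i + 1)) * delta (2 * (i + 1))))))).add
    (integrable_const (1 : ℝ))
  refine h3.congr (Eventually.of_forall fun y => ?_)
  simp only [Pi.add_apply, Pi.sub_apply, factor]
  rw [← pow_mul, mul_comm 2 y, pow_mul]
  ring

/-- By the Poisson generating function the factor has mean `1` and second moment `exp (λ δ²)`. -/
lemma integral_factor_sub_one_sq (i : ℕ) :
    ∫ y, (factor (2 * (i + 1)) y - 1) ^ 2 ∂poissonMeasure (lam (2 * (i + 1))) =
      Real.exp (lam (2 * (i + 1)) * delta (2 * (i + 1)) ^ 2) - 1 := by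
  have h := one_add_delta_even_pos i
  set l : ℝ≥0 := lam (2 * (i + 1))
  set d := delta (2 * (i + 1))
  have h1 := integrable_pow_poissonMeasure l h.le
  have h2 := integrable_pow_poissonMeasure l (sq_nonneg (1 + d))
  have h3 : ∀ y, (factor (2 * (i + 1)) y - 1) ^ 2 =
      ((1 + d) ^ 2) ^ y * Real.exp (-(l * d)) ^ 2 - (1 + d) ^ y * (2 * Real.exp (-(l * d))) + 1 :=
    fun y => by
      simp only [factor]
      rw [← pow_mul, mul_comm 2 y, pow_mul]
      ring
  simp_rw [h3]
  rw [integral_add (f := fun y : ℕ => ((1 + d) ^ 2) ^ y * Real.exp (-(l * d)) ^ 2 -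
      (1 + d) ^ y * (2 * Real.exp (-(l * d)))) ((h2.mul_const _).sub (h1.mul_const _))
      (integrable_const _), integral_sub (h2.mul_const _) (h1.mul_const _), integral_mul_const, integral_mul_const,
    integral_pow_poissonMeasure, integral_pow_poissonMeasure, integral_const, ← Real.exp_nat_mul,
    ← Real.exp_add, mul_left_comm, ← Real.exp_add]
  simp only [probReal_univ, smul_eq_mul]
  rw [show (l : ℝ) * (1 + d - 1) + -(l * d) = 0 by ring,
    show (l : ℝ) * ((1 + d) ^ 2 - 1) + (2 : ℕ) * -(l * d) = l * d ^ 2 by push_cast; ring,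
    Real.exp_zero]
  ring

/-- With `a = (1 / 2) ^ i` and `2 a x ≤ a² + x²`, a second moment of order `a²` gives a first
absolute moment of order `a`, which is summable. -/
lemma integral_abs_factor_sub_one_le (i : ℕ) :
    ∫ y, |factor (2 * (i + 1)) y - 1| ∂poissonMeasure (lam (2 * (i + 1))) ≤ 2 * (1 / 2) ^ i := by
  have h1 := integral_factor_sub_one_sq i
  have h2 := lam_mul_delta_sq_le i
  have h0 : 0 ≤ lam (2 * (i + 1)) * delta (2 * (i + 1)) ^ 2 := by positivity
  have h3 : (1 / 4 : ℝ) ^ i ≤ 1 := pow_le_one₀ (by norm_num) (by norm_num)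
  have h4 := Real.abs_exp_sub_one_le (x := lam (2 * (i + 1)) * delta (2 * (i + 1)) ^ 2)
    (by rw [abs_of_nonneg h0]; linarith)
  rw [abs_of_nonneg h0] at h4
  have h5 := (le_abs_self _).trans h4
  have hp : (0 : ℝ) < (1 / 2) ^ i := by positivity
  have hI := integrable_factor_sub_one_sq i
  have h6 : ∫ y, |factor (2 * (i + 1)) y - 1| ∂poissonMeasure (lam (2 * (i + 1))) ≤
      ∫ y, ((1 / 2) ^ i / 2 + (factor (2 * (i + 1)) y - 1) ^ 2 / (2 * (1 / 2) ^ i))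
        ∂poissonMeasure (lam (2 * (i + 1))) := by
    refine integral_mono_of_nonneg (Eventually.of_forall fun y => abs_nonneg _)
      ((integrable_const _).add (hI.div_const _)) (Eventually.of_forall fun y => ?_)
    simp only
    rw [← sq_abs (factor (2 * (i + 1)) y - 1)]
    generalize |factor (2 * (i + 1)) y - 1| = x
    rw [div_add_div _ _ two_ne_zero (by positivity), le_div_iff₀ (by positivity)]
    nlinarith [sq_nonneg (x - (1 / 2) ^ i)]
  rw [integral_add (integrable_const _) (hI.div_const _), integral_div _ fun y => (factor (2 * (i + 1)) y - 1) ^ 2, h1,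
    integral_const] at h6
  simp only [probReal_univ, smul_eq_mul, one_mul] at h6
  have h7 : (1 / 4 : ℝ) ^ i = (1 / 2) ^ i * (1 / 2) ^ i := by rw [← mul_pow]; norm_num
  have h8 : (Real.exp (lam (2 * (i + 1)) * delta (2 * (i + 1)) ^ 2) - 1) / (2 * (1 / 2) ^ i) ≤
      (1 / 2) ^ i := by
    rw [div_le_iff₀ (by positivity)]
    nlinarith
  linarith

lemma integrable_factor_sub_one (i : ℕ) :
    Integrable (fun y => factor (2 * (i + 1)) y - 1) (poissonMeasure (lam (2 * (i + 1)))) :=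
  ((integrable_pow_poissonMeasure _ (one_add_delta_even_pos i).le).mul_const _).sub
    (integrable_const _)

variable {Ω : Type*} [MeasurableSpace Ω] {μ : Measure Ω}

/-- The infinite product converges almost surely. -/
lemma ae_multipliable_factor {Y : ℕ → Ω → ℕ}
    (hY : ∀ k, 2 ≤ k → HasLaw (Y k) (poissonMeasure (lam k)) μ) :
    ∀ᵐ ω ∂μ, Multipliable fun i : ℕ => factor (2 * (i + 1)) (Y (2 * (i + 1)) ω) := by
  have hint : ∀ i, Integrable (fun ω => factor (2 * (i + 1)) (Y (2 * (i + 1)) ω) - 1) μ :=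
    fun i => by
      have h := hY (2 * (i + 1)) (by omega)
      have h1 := integrable_factor_sub_one i
      rw [← h.map_eq] at h1
      exact h1.comp_aemeasurable h.aemeasurable
  have hle : ∀ i, ∫ ω, ‖factor (2 * (i + 1)) (Y (2 * (i + 1)) ω) - 1‖ ∂μ ≤ 2 * (1 / 2) ^ i :=
    fun i => by
      have h := hY (2 * (i + 1)) (by omega)
      have h1 := integral_abs_factor_sub_one_le i
      rwa [← h.map_eq, integral_map h.aemeasurable (by fun_prop)] at h1
  have hsum : Summable fun i => ∫ ω, ‖factor (2 * (i + 1)) (Y (2 * (i + 1)) ω) - 1‖ ∂μ :=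
    Summable.of_nonneg_of_le (fun i => integral_nonneg fun ω => norm_nonneg _) hle
      ((summable_geometric_of_lt_one (by norm_num) (by norm_num)).mul_left 2)
  have hfin : ∫⁻ ω, ∑' i, ‖factor (2 * (i + 1)) (Y (2 * (i + 1)) ω) - 1‖ₑ ∂μ ≠ ⊤ := by
    rw [lintegral_tsum fun i => (hint i).aestronglyMeasurable.enorm]
    simp_rw [← ofReal_integral_norm_eq_lintegral_enorm (hint _)]
    exact hsum.tsum_ofReal_ne_top
  filter_upwards [ae_lt_top' (AEMeasurable.tsum fun i =>
    (hint i).aestronglyMeasurable.enorm) hfin] with ω hω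
  -- Absolute summability of `factor - 1` makes the product converge unconditionally.
  have h1 : Summable fun i => ‖factor (2 * (i + 1)) (Y (2 * (i + 1)) ω) - 1‖ := by
    have := ENNReal.summable_toReal hω.ne
    simpa using this
  have := multipliable_one_add_of_summable h1
  simpa using this

end RandomLift

/-! ### Tilted Poisson laws and the approximation in L². -/

namespace PoissonRecursion

open Finset

lemma weight_mul_eq (L : ℕ) (l a : ℝ) (x : ℕ) :
    weight L (l * a) x = weight L l x * a ^ (x / L) := by
  unfold weight
  split_ifs
  · rw [mul_pow]; ring
  · simp

lemma prodWeight_mul_eq {ι : Type*} [Fintype ι] (L : ι → ℕ) (l a : ι → ℝ) (r : ι → ℕ) :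
    prodWeight L (fun i => l i * a i) r = prodWeight L l r * ∏ i, a i ^ (r i / L i) := by
  simp_rw [prodWeight, weight_mul_eq, prod_mul_distrib]

end PoissonRecursion

namespace RandomLift

open Finset Topology PoissonRecursion

/-- The limit of the probability that the cycle vector of a random lift is `r`. -/
noncomputable def limitProb (m : ℕ) (r : Fin m → ℕ) : ℝ :=
  prodWeight (fun i : Fin m => 2 * (2 * ((i : ℕ) + 1)))
    (fun i => (lam (2 * ((i : ℕ) + 1)) : ℝ)) r / ∏ i : Fin m, Real.exp (lam (2 * ((i : ℕ) + 1)))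

/-- The limit of the conditional mean of `X / 𝔼 X`, given that the cycle vector of a random lift
is `r`. -/
noncomputable def limitRatio (m : ℕ) (r : Fin m → ℕ) : ℝ :=
  ∏ i : Fin m, factor (2 * ((i : ℕ) + 1)) (r i / (2 * (2 * ((i : ℕ) + 1))))

/-- Multiplying the Poisson law of mean `λ` by `(1 + δ) ^ y * exp (-λ δ)` gives the Poisson law of
mean `λ (1 + δ)`. So `limitRatio` is the density of the planted limit law with respect to the
uniform one. -/
lemma limitProb_mul_limitRatio (m : ℕ) (r : Fin m → ℕ) :
    limitProb m r * limitRatio m r =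
      prodWeight (fun i : Fin m => 2 * (2 * ((i : ℕ) + 1)))
        (fun i => lam (2 * ((i : ℕ) + 1)) * (1 + delta (2 * ((i : ℕ) + 1)))) r /
        ∏ i : Fin m, Real.exp (lam (2 * ((i : ℕ) + 1)) * (1 + delta (2 * ((i : ℕ) + 1)))) := by
  rw [prodWeight_mul_eq, limitProb, limitRatio]
  simp_rw [factor, prod_mul_distrib, mul_add, mul_one, Real.exp_add, Real.exp_neg,
    prod_mul_distrib, prod_inv_distrib]
  have h1 : ∏ i : Fin m, Real.exp (lam (2 * ((i : ℕ) + 1))) ≠ 0 :=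
    prod_ne_zero_iff.2 fun i _ => Real.exp_ne_zero _
  have h2 : ∏ i : Fin m, Real.exp (lam (2 * ((i : ℕ) + 1)) * delta (2 * ((i : ℕ) + 1))) ≠ 0 :=
    prod_ne_zero_iff.2 fun i _ => Real.exp_ne_zero _
  field_simp

/-- The tilt applied twice leads to the weights of mean `λ (1 + δ) ^ 2`. The normalisation lacks `λ
δ²` in the exponent, so the total mass is `∏ exp (λ δ²)`. -/
lemma limitProb_mul_limitRatio_sq (m : ℕ) (r : Fin m → ℕ) :
    limitProb m r * limitRatio m r ^ 2 =
      prodWeight (fun i : Fin m => 2 * (2 * ((i : ℕ) + 1)))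
        (fun i => lam (2 * ((i : ℕ) + 1)) * (1 + delta (2 * ((i : ℕ) + 1))) ^ 2) r /
        ∏ i : Fin m, Real.exp (lam (2 * ((i : ℕ) + 1)) * (1 + 2 * delta (2 * ((i : ℕ) + 1)))) := by
  rw [prodWeight_mul_eq _ _ fun i : Fin m => (1 + delta (2 * ((i : ℕ) + 1))) ^ 2, limitProb,
    limitRatio]
  have h : ∀ i : Fin m, Real.exp (lam (2 * ((i : ℕ) + 1)) * (1 + 2 * delta (2 * ((i : ℕ) + 1)))) =
      Real.exp (lam (2 * ((i : ℕ) + 1))) *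
        Real.exp (lam (2 * ((i : ℕ) + 1)) * delta (2 * ((i : ℕ) + 1))) ^ 2 := fun i => by
    rw [← Real.exp_nat_mul, ← Real.exp_add]
    push_cast
    ring_nf
  simp_rw [factor, prod_mul_distrib, h, Real.exp_neg, prod_mul_distrib, prod_inv_distrib, prod_pow,
    pow_right_comm _ 2, prod_pow]
  have h1 : ∏ i : Fin m, Real.exp (lam (2 * ((i : ℕ) + 1))) ≠ 0 :=
    prod_ne_zero_iff.2 fun i _ => Real.exp_ne_zero _
  have h2 : ∏ i : Fin m, Real.exp (lam (2 * ((i : ℕ) + 1)) * delta (2 * ((i : ℕ) + 1))) ≠ 0 :=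
    prod_ne_zero_iff.2 fun i _ => Real.exp_ne_zero _
  field_simp

lemma tendsto_sum_limitProb_box (m : ℕ) :
    Tendsto (fun K => ∑ r ∈ Fintype.piFinset fun _ : Fin m => range K, limitProb m r) atTop
      (𝓝 1) := by
  have h := tendsto_sum_prodWeight_box (L := fun i : Fin m => 2 * (2 * ((i : ℕ) + 1)))
    (fun i => by positivity) fun i => (lam (2 * ((i : ℕ) + 1)) : ℝ)
  have h1 := h.div_const (∏ i : Fin m, Real.exp (lam (2 * ((i : ℕ) + 1))))
  rw [div_self (prod_ne_zero_iff.2 fun i _ => Real.exp_ne_zero _)] at h1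
  simpa only [limitProb, sum_div] using h1

lemma tendsto_sum_limitProb_mul_sq_box (m : ℕ) :
    Tendsto (fun K => ∑ r ∈ Fintype.piFinset fun _ : Fin m => range K,
      limitProb m r * limitRatio m r ^ 2) atTop
      (𝓝 (∏ i : Fin m, Real.exp (lam (2 * ((i : ℕ) + 1)) * delta (2 * ((i : ℕ) + 1)) ^ 2))) := by
  have h := tendsto_sum_prodWeight_box (L := fun i : Fin m => 2 * (2 * ((i : ℕ) + 1)))
    (fun i => by positivity)
    fun i => (lam (2 * ((i : ℕ) + 1)) * (1 + delta (2 * ((i : ℕ) + 1))) ^ 2 : ℝ)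
  have h1 := h.div_const (∏ i : Fin m,
    Real.exp (lam (2 * ((i : ℕ) + 1)) * (1 + 2 * delta (2 * ((i : ℕ) + 1)))))
  simp_rw [limitProb_mul_limitRatio_sq, ← sum_div]
  convert! h1 using 2
  rw [← prod_div_distrib]
  refine prod_congr rfl fun i _ => ?_
  rw [← Real.exp_sub]
  ring_nf

lemma tendsto_prod_exp_lam_mul_delta_sq :
    Tendsto (fun m : ℕ => ∏ i : Fin m,
      Real.exp (lam (2 * ((i : ℕ) + 1)) * delta (2 * ((i : ℕ) + 1)) ^ 2)) atTop
      (𝓝 (32 / (15 * √3))) := by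
  have h := (Real.continuous_exp.tendsto _).comp hasSum_lam_mul_delta_sq.tendsto_sum_nat
  rw [Real.exp_log (by positivity)] at h
  refine h.congr fun m => ?_
  rw [Function.comp_apply, Real.exp_sum, prod_range]

lemma sum_ite_cycleVec {m n : ℕ} (s : Finset (Fin m → ℕ)) (F : (Fin m → ℕ) → ℝ)
    (w : (Fin 3 → Equiv.Perm (Fin n)) → ℝ) :
    ∑ σ, w σ * (if cycleVec m σ ∈ s then F (cycleVec m σ) else 0) =
      ∑ r ∈ s, F r * ∑ σ, w σ * if cycleVec m σ = r then 1 else 0 := by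
  simp_rw [mul_sum]
  rw [sum_comm]
  refine sum_congr rfl fun σ _ => ?_
  simp [mul_comm]

lemma tendsto_integral_cycleVec {m : ℕ} (s : Finset (Fin m → ℕ)) (F : (Fin m → ℕ) → ℝ) :
    Tendsto (fun n => ∫ σ, (if cycleVec m σ ∈ s then F (cycleVec m σ) else 0)
      ∂liftMeasure (Fin 3) n) atTop (𝓝 (∑ r ∈ s, F r * limitProb m r)) := by
  have h := tendsto_finsetSum s fun r _ => ((isAsymptoticallyPoisson_uniform m).tendsto
    (fun i => by positivity) (fun i => NNReal.coe_nonneg _) r).const_mul (F r)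
  refine h.congr fun n => ?_
  have h1 := sum_ite_cycleVec s F (fun _ : Fin 3 → Equiv.Perm (Fin n) => 1)
  simp only [one_mul] at h1
  rw [integral_liftMeasure, h1, sum_div]
  simp_rw [mul_div_assoc]

/-- The weight `X / 𝔼 X` turns the uniform law into the planted one, so this mixed moment is a
planted expectation. -/
lemma tendsto_integral_X_mul_cycleVec {m : ℕ} (s : Finset (Fin m → ℕ)) (F : (Fin m → ℕ) → ℝ) :
    Tendsto (fun n => (∫ σ, X K23 n σ * (if cycleVec m σ ∈ s then F (cycleVec m σ) else 0)
      ∂liftMeasure (Fin 3) n) / firstMoment n) atTop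
      (𝓝 (∑ r ∈ s, F r * (limitProb m r * limitRatio m r))) := by
  have h := tendsto_finsetSum s fun r _ => ((isAsymptoticallyPoisson_planted m).tendsto
    (fun i => by positivity) (fun i : Fin m => mul_nonneg (NNReal.coe_nonneg _)
      (one_add_delta_even_pos (i : ℕ)).le) r).const_mul (F r)
  simp_rw [← limitProb_mul_limitRatio] at h
  refine h.congr fun n => ?_
  have hn : (n.factorial : ℝ) ^ 3 ≠ 0 := by positivity
  rw [integral_liftMeasure, sum_ite_cycleVec s F, firstMoment_eq, div_div_div_cancel_right₀ hn,
    sum_div]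
  simp_rw [mul_div_assoc]

/-- The mean square distance of `X / 𝔼 X` to a function of the cycle vector. -/
lemma eventually_integral_sub_sq_le {m : ℕ} (s : Finset (Fin m → ℕ)) {η : ℝ} (hη : 0 < η) :
    ∀ᶠ n in atTop, ∫ σ, (X K23 n σ / firstMoment n -
      if cycleVec m σ ∈ s then limitRatio m (cycleVec m σ) else 0) ^ 2 ∂liftMeasure (Fin 3) n ≤
        32 / (15 * √3) - ∑ r ∈ s, limitProb m r * limitRatio m r ^ 2 + η := by
  have h1 := tendsto_integral_X_mul_cycleVec s (limitRatio m)
  have h2 := tendsto_integral_cycleVec s fun r => limitRatio m r ^ 2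
  -- In the expanded square the mixed term tends to `-2 S` and the square of the approximation to
  -- `S`, with the same sum `S`.
  have h3 : Tendsto (fun n => -2 * ((∫ σ, X K23 n σ *
      (if cycleVec m σ ∈ s then limitRatio m (cycleVec m σ) else 0)
        ∂liftMeasure (Fin 3) n) / firstMoment n) +
      ∫ σ, (if cycleVec m σ ∈ s then limitRatio m (cycleVec m σ) ^ 2 else 0)
        ∂liftMeasure (Fin 3) n) atTop
      (𝓝 (-∑ r ∈ s, limitProb m r * limitRatio m r ^ 2)) := by
    convert! (h1.const_mul (-2)).add h2 using 2
    rw [mul_sum, ← sum_add_distrib, ← sum_neg_distrib]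
    exact sum_congr rfl fun r _ => by ring
  filter_upwards [eventually_firstMoment_pos, eventually_secondMoment_le (half_pos hη),
    h3.eventually (gt_mem_nhds (lt_add_of_pos_right _ (half_pos hη)))] with n hn hn1 hn2
  have h4 : ∀ σ, (X K23 n σ / firstMoment n -
      if cycleVec m σ ∈ s then limitRatio m (cycleVec m σ) else 0) ^ 2 =
      X K23 n σ ^ 2 / firstMoment n ^ 2 + -2 * (X K23 n σ *
        (if cycleVec m σ ∈ s then limitRatio m (cycleVec m σ) else 0) / firstMoment n) +
      if cycleVec m σ ∈ s then limitRatio m (cycleVec m σ) ^ 2 else 0 := fun σ => by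
    split_ifs <;> ring
  simp_rw [h4]
  rw [integral_add .of_finite .of_finite, integral_add .of_finite .of_finite, integral_div,
    integral_X_sq, integral_const_mul, integral_div]
  have h5 : secondMoment n / firstMoment n ^ 2 ≤ 32 / (15 * √3) + η / 2 := by
    rwa [div_le_iff₀ (by positivity)]
  linarith

/-- The L² bound enters through `y ≤ t / 2 + y² / (2 t)` for the distance `y` of `f` and `g`. -/
lemma abs_integral_sub_le_of_lipschitz {α : Type*} [MeasurableSpace α] [Finite α]
    [MeasurableSingletonClass α] {P : Measure α} [IsProbabilityMeasure P] {φ : ℝ → ℝ} {c : ℝ≥0}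
    (hφ : LipschitzWith c φ) (f g : α → ℝ) {t : ℝ} (ht : 0 < t)
    (h : ∫ x, (f x - g x) ^ 2 ∂P ≤ t ^ 2) : |∫ x, φ (f x) ∂P - ∫ x, φ (g x) ∂P| ≤ c * t := by
  rw [← integral_sub .of_finite .of_finite]
  have h1 : |∫ x, (φ (f x) - φ (g x)) ∂P| ≤
      ∫ x, c * (t / 2 + (f x - g x) ^ 2 * (2 * t)⁻¹) ∂P := by
    refine (abs_integral_le_integral_abs).trans (integral_mono .of_finite .of_finite fun x => ?_)
    have h2 := hφ.dist_le_mul (f x) (g x)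
    rw [Real.dist_eq, Real.dist_eq] at h2
    refine h2.trans (mul_le_mul_of_nonneg_left ?_ c.coe_nonneg)
    rw [← sq_abs (f x - g x), ← div_eq_mul_inv]
    generalize |f x - g x| = y
    rw [div_add_div _ _ two_ne_zero (by positivity), le_div_iff₀ (by positivity)]
    nlinarith [sq_nonneg (y - t)]
  refine h1.trans ?_
  rw [integral_const_mul, integral_add .of_finite .of_finite, integral_const, integral_mul_const,
    probReal_univ, one_smul]
  refine mul_le_mul_of_nonneg_left ?_ c.coe_nonneg
  have h3 : (∫ x, (f x - g x) ^ 2 ∂P) * (2 * t)⁻¹ ≤ t ^ 2 * (2 * t)⁻¹ :=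
    mul_le_mul_of_nonneg_right h (by positivity)
  have h4 : t ^ 2 * (2 * t)⁻¹ = t / 2 := by field_simp
  linarith

end RandomLift

/-! ### Convergence in distribution. -/

namespace RandomLift

open Finset Topology PoissonRecursion

variable {Ω : Type*}

/-- The limit of the cycle vector of a random lift. -/
def limitVec (Y : ℕ → Ω → ℕ) (m : ℕ) (ω : Ω) (i : Fin m) : ℕ :=
  2 * (2 * ((i : ℕ) + 1)) * Y (2 * ((i : ℕ) + 1)) ω

lemma limitRatio_limitVec (Y : ℕ → Ω → ℕ) (m : ℕ) (ω : Ω) : limitRatio m (limitVec Y m ω) =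
    ∏ i ∈ range m, factor (2 * (i + 1)) (Y (2 * (i + 1)) ω) := by
  rw [limitRatio, prod_range]
  refine prod_congr rfl fun i _ => ?_
  rw [limitVec, Nat.mul_div_cancel_left _ (by positivity)]

variable [MeasurableSpace Ω] {μ : Measure Ω}

lemma aemeasurable_limitVec {Y : ℕ → Ω → ℕ}
    (hY : ∀ k, 2 ≤ k → HasLaw (Y k) (poissonMeasure (lam k)) μ) (m : ℕ) :
    AEMeasurable (limitVec Y m) μ :=
  aemeasurable_pi_lambda _ fun i => (hY (2 * ((i : ℕ) + 1)) (by omega)).aemeasurable.const_mul _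

lemma poissonMeasure_real_eq_weight (l : ℝ≥0) {L : ℕ} (hL : 0 < L) (x : ℕ) :
    (poissonMeasure l).real {y | L * y = x} = weight L l x / Real.exp l := by
  by_cases h : L ∣ x
  · obtain ⟨y, rfl⟩ := h
    have h1 : {z | L * z = L * y} = {y} := by
      ext z
      simp [hL.ne']
    rw [h1, poissonMeasure_real_singleton, weight_mul _ _ hL, Real.exp_neg]
    field_simp
  · have h1 : {y | L * y = x} = ∅ := by
      ext y
      simp only [Set.mem_ofPred_eq, Set.mem_empty_iff_false, iff_false]
      rintro rfl
      exact h (dvd_mul_right _ _)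
    rw [h1, weight, if_neg h]
    simp

lemma map_limitVec_real [IsProbabilityMeasure μ] {Y : ℕ → Ω → ℕ}
    (hY : ∀ k, 2 ≤ k → HasLaw (Y k) (poissonMeasure (lam k)) μ)
    (hind : iIndepFun (fun k : {k : ℕ // 2 ≤ k} => Y k) μ) {m : ℕ} (r : Fin m → ℕ) :
    (μ.map (limitVec Y m)).real {r} = limitProb m r := by
  have hinj : Function.Injective fun i : Fin m =>
      (⟨2 * ((i : ℕ) + 1), by omega⟩ : {k : ℕ // 2 ≤ k}) := fun i j h => by
    simp only [Subtype.mk.injEq] at h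
    exact Fin.ext (by omega)
  have h1 := (hind.precomp hinj).measure_inter_preimage_eq_mul univ
    (sets := fun i => {y | 2 * (2 * ((i : ℕ) + 1)) * y = r i}) fun i _ => .of_discrete
  have h2 : limitVec Y m ⁻¹' {r} = ⋂ i ∈ (univ : Finset (Fin m)),
      (fun ω => Y (2 * ((i : ℕ) + 1)) ω) ⁻¹' {y | 2 * (2 * ((i : ℕ) + 1)) * y = r i} := by
    ext ω
    simp [funext_iff, limitVec]
  rw [map_measureReal_apply_of_aemeasurable (aemeasurable_limitVec hY m) .of_discrete, h2,
    measureReal_def]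
  refine (congrArg ENNReal.toReal h1).trans ?_
  rw [ENNReal.toReal_prod, limitProb, prodWeight, ← prod_div_distrib]
  refine prod_congr rfl fun i _ => ?_
  have h := hY (2 * ((i : ℕ) + 1)) (by omega)
  rw [← poissonMeasure_real_eq_weight _ (by positivity), ← h.map_eq,
    map_measureReal_apply_of_aemeasurable h.aemeasurable .of_discrete]
  rfl

/-- `limitProb` is the exact law of `limitVec`, so the difference is an integral of `ψ` over the
complement of `s`. -/
lemma abs_sum_limitProb_sub_integral_le [IsProbabilityMeasure μ] {Y : ℕ → Ω → ℕ}
    (hY : ∀ k, 2 ≤ k → HasLaw (Y k) (poissonMeasure (lam k)) μ)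
    (hind : iIndepFun (fun k : {k : ℕ // 2 ≤ k} => Y k) μ) {m : ℕ} (s : Finset (Fin m → ℕ))
    {ψ : (Fin m → ℕ) → ℝ} {C : ℝ} (hψ : ∀ r, |ψ r| ≤ C) :
    |∑ r ∈ s, ψ r * limitProb m r - ∫ ω, ψ (limitVec Y m ω) ∂μ| ≤
      C * (1 - ∑ r ∈ s, limitProb m r) := by
  have hV := aemeasurable_limitVec hY m
  have := Measure.isProbabilityMeasure_map hV
  set ν := μ.map (limitVec Y m) with hν
  have hint : Integrable ψ ν := (integrable_const C).mono' (by fun_prop)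
    (Eventually.of_forall hψ)
  have h1 : ∑ r ∈ s, ψ r * limitProb m r = ∫ r in s, ψ r ∂ν := by
    rw [setIntegral_finset s hint.integrableOn]
    refine sum_congr rfl fun r _ => ?_
    rw [hν, map_limitVec_real hY hind, smul_eq_mul, mul_comm]
  have h2 : ∑ r ∈ s, limitProb m r = ν.real s := by
    rw [← sum_measureReal_singleton]
    exact sum_congr rfl fun r _ => (map_limitVec_real hY hind r).symm
  have h3 : ν.real (s : Set (Fin m → ℕ))ᶜ = 1 - ν.real s := probReal_compl_eq_one_sub .of_discrete
  rw [← integral_map hV (f := ψ) (by fun_prop), ← hν, h1, h2, ← h3,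
    ← integral_add_compl (s := (s : Set (Fin m → ℕ))) .of_discrete hint, sub_add_cancel_left,
    abs_neg]
  rw [← Real.norm_eq_abs]
  exact norm_setIntegral_le_of_norm_le_const (measure_lt_top _ _) fun r _ => hψ r

lemma ae_tendsto_limitRatio {Y : ℕ → Ω → ℕ}
    (hY : ∀ k, 2 ≤ k → HasLaw (Y k) (poissonMeasure (lam k)) μ) :
    ∀ᵐ ω ∂μ, Tendsto (fun m => limitRatio m (limitVec Y m ω)) atTop
      (𝓝 (∏' i : ℕ, factor (2 * (i + 1)) (Y (2 * (i + 1)) ω))) := by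
  filter_upwards [ae_multipliable_factor hY] with ω hω
  simp_rw [limitRatio_limitVec]
  exact hω.hasProd.tendsto_prod_nat

lemma aemeasurable_limitRatio {Y : ℕ → Ω → ℕ}
    (hY : ∀ k, 2 ≤ k → HasLaw (Y k) (poissonMeasure (lam k)) μ) (m : ℕ) :
    AEMeasurable (fun ω => limitRatio m (limitVec Y m ω)) μ :=
  (measurable_of_countable (limitRatio m)).comp_aemeasurable (aemeasurable_limitVec hY m)

/-- Integrals of bounded Lipschitz functions of `X / 𝔼 X` converge. -/
lemma tendsto_integral_lipschitz [IsProbabilityMeasure μ] {Y : ℕ → Ω → ℕ}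
    (hY : ∀ k, 2 ≤ k → HasLaw (Y k) (poissonMeasure (lam k)) μ)
    (hind : iIndepFun (fun k : {k : ℕ // 2 ≤ k} => Y k) μ) {φ : ℝ → ℝ} {C : ℝ}
    (hC : ∀ x y, dist (φ x) (φ y) ≤ C) {c : ℝ≥0} (hφ : LipschitzWith c φ) :
    Tendsto (fun n => ∫ σ, φ (X K23 n σ / firstMoment n) ∂liftMeasure (Fin 3) n) atTop
      (𝓝 (∫ ω, φ (∏' i : ℕ, factor (2 * (i + 1)) (Y (2 * (i + 1)) ω)) ∂μ)) := by
  have hC0 : 0 ≤ C := dist_nonneg.trans (hC 0 0)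
  have hC1 : ∀ x, |φ x - φ 0| ≤ C := fun x => hC x 0
  have hb : ∀ x, ‖φ x‖ ≤ |φ 0| + C := fun x => by
    have h1 := hC1 x
    have h2 := abs_sub_abs_le_abs_sub (φ x) (φ 0)
    rw [Real.norm_eq_abs]
    linarith
  have hlim : Tendsto (fun m => ∫ ω, φ (limitRatio m (limitVec Y m ω)) ∂μ) atTop
      (𝓝 (∫ ω, φ (∏' i : ℕ, factor (2 * (i + 1)) (Y (2 * (i + 1)) ω)) ∂μ)) := by
    refine tendsto_integral_of_dominated_convergence (fun _ => |φ 0| + C) (fun m =>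
      (hφ.continuous.measurable.comp_aemeasurable
        (aemeasurable_limitRatio hY m)).aestronglyMeasurable)
      (integrable_const _) (fun m => Eventually.of_forall fun ω => hb _) ?_
    filter_upwards [ae_tendsto_limitRatio hY] with ω hω
    exact (hφ.continuous.tendsto _).comp hω
  rw [Metric.tendsto_nhds]
  intro ε hε
  obtain ⟨t, ht, htc⟩ : ∃ t > 0, c * t < ε / 4 := ⟨ε / (4 * (c + 1)), by positivity, by
    rw [← mul_div_assoc, div_lt_div_iff₀ (by positivity) (by positivity)]
    nlinarith [c.coe_nonneg]⟩
  have ht2 : 0 < t ^ 2 := by positivity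
  -- First `m` is chosen such that the partial product has second moment within `t ^ 2 / 2` of the
  -- limit. Then the box is taken so large that truncation preserves this and loses little
  -- probability.
  obtain ⟨m, hm1, hm2⟩ := ((tendsto_prod_exp_lam_mul_delta_sq.eventually (lt_mem_nhds
    (show 32 / (15 * √3) - t ^ 2 / 2 < 32 / (15 * √3) by linarith))).and
    ((Metric.tendsto_nhds.1 hlim) (ε / 4) (by positivity))).exists
  obtain ⟨K, hK1, hK2⟩ := (((tendsto_sum_limitProb_mul_sq_box m).eventually (lt_mem_nhds hm1)).and
    ((tendsto_sum_limitProb_box m).eventually (lt_mem_nhds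
      (show 1 - ε / (4 * (C + 1)) < 1 by linarith [show 0 < ε / (4 * (C + 1)) by positivity])))).exists
  set s := Fintype.piFinset fun _ : Fin m => range K
  -- Outside the box the approximation of `X / 𝔼 X` is `0`; subtracting `φ 0` makes the test
  -- function vanish there.
  have h1 := abs_sum_limitProb_sub_integral_le hY hind s
    (ψ := fun r => φ (limitRatio m r) - φ 0) fun r => hC1 _
  have hint : Integrable (fun ω => φ (limitRatio m (limitVec Y m ω))) μ :=
    (integrable_const (|φ 0| + C)).mono' (hφ.continuous.measurable.comp_aemeasurable
      (aemeasurable_limitRatio hY m)).aestronglyMeasurable (Eventually.of_forall fun ω => hb _)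
  rw [integral_sub hint (integrable_const _), integral_const, probReal_univ, one_smul] at h1
  have h2 : C * (1 - ∑ r ∈ s, limitProb m r) < ε / 4 := by
    have h3 : C * (1 - ∑ r ∈ s, limitProb m r) ≤ C * (ε / (4 * (C + 1))) :=
      mul_le_mul_of_nonneg_left (by linarith) hC0
    refine h3.trans_lt ?_
    rw [← mul_div_assoc, div_lt_div_iff₀ (by positivity) (by positivity)]
    nlinarith
  filter_upwards [eventually_integral_sub_sq_le s (half_pos ht2),
    (Metric.tendsto_nhds.1 (tendsto_integral_cycleVec s fun r => φ (limitRatio m r) - φ 0)) (ε / 4)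
      (by positivity)] with n hn1 hn2
  have h3 := abs_integral_sub_le_of_lipschitz hφ _ _ ht (hn1.trans (by linarith))
  have h4 : ∀ σ : Fin 3 → Equiv.Perm (Fin n),
      φ (if cycleVec m σ ∈ s then limitRatio m (cycleVec m σ) else 0) = φ 0 +
        if cycleVec m σ ∈ s then φ (limitRatio m (cycleVec m σ)) - φ 0 else 0 := fun σ => by
    split_ifs <;> ring
  simp_rw [h4] at h3
  rw [integral_add .of_finite .of_finite, integral_const, probReal_univ, one_smul] at h3
  rw [Real.dist_eq] at hm2 hn2 ⊢
  rw [abs_lt] at hm2 hn2 ⊢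
  rw [abs_le] at h1 h3
  constructor <;> linarith [h1.1, h1.2, h3.1, h3.2, hm2.1, hm2.2, hn2.1, hn2.2]

end RandomLift

/-- Let `Y k`, `k ≥ 2`, be independent Poisson variables with means `λ_k`. The infinite product
`W = ∏_{i ≥ 1} (1 + δ_{2i})^{Y_{2i}} e^{-λ_{2i} δ_{2i}}` converges almost surely, and
`X_G / E X_G` converges in distribution to `W` as `n → ∞`, for `G = K_2^3`. -/
theorem corollary5p6 {Ω : Type*} [MeasurableSpace Ω] (μ : Measure Ω) [IsProbabilityMeasure μ]
    (Y : ℕ → Ω → ℕ)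
    (hY : ∀ k, 2 ≤ k → HasLaw (Y k) (poissonMeasure (RandomLift.lam k)) μ)
    (hind : iIndepFun (fun k : {k : ℕ // 2 ≤ k} => Y k) μ) :
    (∀ᵐ ω ∂μ, Multipliable fun i : ℕ =>
      RandomLift.factor (2 * (i + 1)) (Y (2 * (i + 1)) ω)) ∧
    TendstoInDistribution
      (fun (n : ℕ) (σ : Fin 3 → Equiv.Perm (Fin n)) =>
        RandomLift.X RandomLift.K23 n σ /
          ∫ τ, RandomLift.X RandomLift.K23 n τ ∂(RandomLift.liftMeasure (Fin 3) n))
      atTop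
      (fun ω => ∏' i : ℕ, RandomLift.factor (2 * (i + 1)) (Y (2 * (i + 1)) ω))
      (fun n => RandomLift.liftMeasure (Fin 3) n) μ := by
  refine ⟨RandomLift.ae_multipliable_factor hY, fun n => Measurable.of_discrete.aemeasurable,
    aemeasurable_of_tendsto_metrizable_ae atTop (RandomLift.aemeasurable_limitRatio hY)
      (RandomLift.ae_tendsto_limitRatio hY), ?_⟩
  -- Bounded Lipschitz test functions suffice for weak convergence, and L² distances control their
  -- integrals.
  refine tendsto_iff_forall_lipschitz_integral_tendsto.2 ?_
  rintro φ ⟨C, hC⟩ ⟨c, hφ⟩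
  convert! RandomLift.tendsto_integral_lipschitz hY hind hC hφ using 1
  · ext n
    rw [← RandomLift.integral_X]
    exact integral_map Measurable.of_discrete.aemeasurable
      hφ.continuous.measurable.aestronglyMeasurable
  · exact congrArg _ (integral_map (aemeasurable_of_tendsto_metrizable_ae atTop
      (RandomLift.aemeasurable_limitRatio hY) (RandomLift.ae_tendsto_limitRatio hY))
      hφ.continuous.measurable.aestronglyMeasurable)
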